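/- An Interval Debt Model (IDM) instance $(G,D,A^0)$ consists of a finite directed multigraph $G=(V,E)$ on banks $V=\{v_1,\dots,v_n\}$, terms $D(e)=(a,t_1,t_2)$ with positive integers $a$ and $t_1\le t_2$ for every edge (debt) $e$ (its debtor owes its creditor the amount $a$, payable from time $t_1$ and due at time $t_2$), and initial external assets $A^0=(c^0_v)_{v\in V}\in\mathbb N^n$. Let $T$ be the greatest time-stamp in any debt. In the Partial Payments (PP) variant, a schedule is a family of payments $p_e^t\in\mathbb N$ ($e\in E$, $1\le t\le T$). For $t\ge 1$ let $c_v^t=c_v^{t-1}+I_v^t-O_v^t$, where $I_v^t$ and $O_v^t$ are the total payments to and by $v$ at time $t$. A debt $e$ with terms $(a,t_1,t_2)$ is overdue at time $t$, $t_2\le t\le T$, if $\sum_{s\le t}p_e^s<a$. A schedule is valid if $c_v^t\ge 0$ for all $v$ and $0\le t\le T$; $\sum_{t\le T}p_e^t\le a$ and $\sum_{t<t_1}p_e^t=0$ for every debt $e$ with terms $(a,t_1,t_2)$; and there are no bank $v$ and time $t$ such that $v$ is the debtor of a debt that is overdue at time $t$ while $c_v^t\ge 1$. It is perfect if it is valid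 and no debt is ever overdue. Perfect Scheduling asks, given an instance $(G,D,A^0)$, whether it has a perfect schedule. Bailout Minimization asks, given $(G,D,A^0)$ and an integer $b$, whether there is $B\in\mathbb N^n$ with $\sum_i B_i\le b$ such that $(G,D,A^0+B)$ has a perfect schedule. $G$ is a rooted out-tree if its underlying undirected simple graph is a tree, $G$ has no loops, and for some root every edge of $G$ is directed away from the root (parallel edges are allowed). **Theorem.** Bailout Minimization in the PP variant, restricted to instances in which $G$ is a rooted out-tree, is solvable in polynomial time: some Turing machine, given such an instance with all numbers written in binary and with the banks and the debts listed one by one, decides it in time polynomial in the length of the input. The same holds for Perfect Scheduling in the PP variant. -/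

import Mathlib

/-- A debt between banks `0, …, n - 1`: an edge from `debtor` to `creditor` with terms
`amount@[start, due]`, where `amount, start, due` are positive integers and `start ≤ due`. -/
structure Debt (n : ℕ) where
  debtor : Fin n
  creditor : Fin n
  amount : ℕ
  start : ℕ
  due : ℕ
  amount_pos : 0 < amount
  start_pos : 0 < start
  start_le_due : start ≤ due

/-- An Interval Debt Model instance `(G, D, A⁰)`: a finite directed multigraph on the banks
`Fin n`, given by the family of its `m` edges (the debts) together with their terms, and the
initial external assets of the banks. Parallel debts are told apart by their index in `Fin m`. -/
structure IDM where
  n : ℕ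
  m : ℕ
  debt : Fin m → Debt n
  assets : Fin n → ℕ

namespace IDM

/-- The lifetime `T`: the greatest time-stamp in any debt. -/
def lifetime (I : IDM) : ℕ :=
  Finset.univ.sup fun e => (I.debt e).due

/-- A payment schedule with integer partial payments (the PP variant): `p e t` is the amount of
debt `e` paid at time `t`. Only the values at the times `1 ≤ t ≤ T` are payments; the other
values are never looked at. -/
abbrev Schedule (I : IDM) : Type := Fin I.m → ℕ → ℕ

/-- `I_v^t`: the total of the payments to bank `v` at time `t`. -/
def income (I : IDM) (p : I.Schedule) (v : Fin I.n) (t : ℕ) : ℕ :=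
  ∑ e with (I.debt e).creditor = v, p e t

/-- `O_v^t`: the total of the payments by bank `v` at time `t`. -/
def outgoing (I : IDM) (p : I.Schedule) (v : Fin I.n) (t : ℕ) : ℕ :=
  ∑ e with (I.debt e).debtor = v, p e t

/-- `c_v^t`: the cash assets of bank `v` at time `t`, after the payments of time `t`. -/
def cash (I : IDM) (p : I.Schedule) (v : Fin I.n) : ℕ → ℤ
  | 0 => (I.assets v : ℤ)
  | t + 1 => I.cash p v t + (I.income p v (t + 1) : ℤ) - (I.outgoing p v (t + 1) : ℤ)

/-- The part of debt `e` paid at the times `1, …, t`. -/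
def paidBy (I : IDM) (p : I.Schedule) (e : Fin I.m) (t : ℕ) : ℕ :=
  ∑ s ∈ Finset.Icc 1 t, p e s

/-- Debt `e` is overdue at time `t`: its due time has been reached, but it is not fully paid,
even after the payments of time `t`. -/
def Overdue (I : IDM) (p : I.Schedule) (e : Fin I.m) (t : ℕ) : Prop :=
  (I.debt e).due ≤ t ∧ t ≤ I.lifetime ∧ I.paidBy p e t < (I.debt e).amount

/-- Bank `v` is withholding: at some time it is the debtor of an overdue debt and has enough cash
to pay part of it; as payments are integers, this means at least one unit of cash. -/
def Withholding (I : IDM) (p : I.Schedule) (v : Fin I.n) : Prop :=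
  ∃ t, 1 ≤ t ∧ t ≤ I.lifetime ∧
    (∃ e, (I.debt e).debtor = v ∧ I.Overdue p e t) ∧ 1 ≤ I.cash p v t

/-- Valid schedules of the PP variant (payments are natural numbers, hence nonnegative). -/
structure Valid (I : IDM) (p : I.Schedule) : Prop where
  cash_nonneg : ∀ v t, t ≤ I.lifetime → 0 ≤ I.cash p v t
  not_overpaid : ∀ e, I.paidBy p e I.lifetime ≤ (I.debt e).amount
  not_early : ∀ e, I.paidBy p e ((I.debt e).start - 1) = 0
  not_withholding : ∀ v, ¬ I.Withholding p v

/-- A perfect schedule: a valid schedule in which no debt is ever overdue. -/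
def Perfect (I : IDM) (p : I.Schedule) : Prop :=
  I.Valid p ∧ ∀ e t, ¬ I.Overdue p e t

/-- The yes-instances of Perfect Scheduling (PP variant). -/
def HasPerfectSchedule (I : IDM) : Prop :=
  ∃ p : I.Schedule, I.Perfect p

/-- The instance `(G, D, A⁰ + B)`. -/
def bailout (I : IDM) (B : Fin I.n → ℕ) : IDM :=
  { I with assets := fun v => I.assets v + B v }

/-- The yes-instances `(I, b)` of Bailout Minimization (PP variant). -/
def Bailoutable (I : IDM) (b : ℤ) : Prop :=
  ∃ B : Fin I.n → ℕ, (∑ v, (B v : ℤ)) ≤ b ∧ (I.bailout B).HasPerfectSchedule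

/-- The footprint: the undirected graph obtained by forgetting the orientations (and the
multiplicities) of the debts. -/
def footprint (I : IDM) : SimpleGraph (Fin I.n) :=
  SimpleGraph.fromRel fun u v => ∃ e, (I.debt e).debtor = u ∧ (I.debt e).creditor = v

/-- The graph is a rooted out-tree: its footprint is a tree, and for some root `r` every debt is
directed away from `r` (in particular, there are no loops). -/
def IsOutTree (I : IDM) : Prop :=
  I.footprint.IsTree ∧ ∃ r : Fin I.n, ∀ e,
    I.footprint.dist r (I.debt e).creditor = I.footprint.dist r (I.debt e).debtor + 1

/-- A number in binary (least significant bit first), followed by the separator `none`. -/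
def encodeNumber (k : ℕ) : List (Option Bool) :=
  k.bits.map some ++ [none]

/-- The input string of an instance: the number of banks, their initial assets, the number of
debts, and for each debt its debtor, its creditor and its terms, all in binary. -/
def encode (I : IDM) : List (Option Bool) :=
  encodeNumber I.n ++ (List.ofFn fun v => encodeNumber (I.assets v)).flatten ++
  encodeNumber I.m ++ (List.ofFn fun e =>
    encodeNumber (I.debt e).debtor ++ encodeNumber (I.debt e).creditor ++
    encodeNumber (I.debt e).amount ++ encodeNumber (I.debt e).start ++
    encodeNumber (I.debt e).due).flatten

/-- The input string of an instance `(I, b)` of Bailout Minimization: the sign of `b` (`1` if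
`b < 0`, else `0`), the absolute value of `b`, and the instance `I`. -/
def encodeWithBudget (I : IDM) (b : ℤ) : List (Option Bool) :=
  encodeNumber (if b < 0 then 1 else 0) ++ encodeNumber b.natAbs ++ I.encode

end IDM

/-- The IDM instances whose graph is a rooted out-tree. -/
abbrev OutTreeIDM : Type := {I : IDM // I.IsOutTree}

/-- The decision problem with instances `x : α`, presented to the machine as the strings `enc x`,
and with yes-instances those that satisfy `P`, is solvable in polynomial time: some
(multi-stack) Turing machine, started on `enc x`, halts with the correct answer after at most
polynomially many steps in the length of `enc x`, for all `x : α`. -/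
def SolvableInPolyTime {α Γ : Type} (enc : α → List Γ) (P : α → Prop) : Prop :=
  ∃ f : α → Bool, (∀ x, f x = true ↔ P x) ∧
    Nonempty (Turing.TM2ComputableInPolyTime enc Computability.encodeBool f)

/-! Money flows only away from the root, so the tree is treated from the leaves upwards. For each
bank `v` let `l v t` be the total that `v` must have been paid by time `t` when bailouts are kept
minimal. Two things force it: the debts to `v` that are due by `t`, and the payments that `v` must
itself have made, namely the sum of `l w t` over its creditors `w` (`demand`), as far as its assets
and its bailout do not cover them. A bailout of `v` is unavoidable only if `v` falls short even when
everything owed to it is paid at the first permitted moment; `grant` is the largest such shortfall.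
All further shortfall is passed on to the debtor of `v` as a requirement to pay early.
`nextRequired` is the least function that covers these needs and grows, between any times `s` and
`t`, by at least the amount of the debts to `v` that are both payable after `s` and due by `t`.

The grants suffice. All debts to `v` have the same debtor, so for cash purposes only the total paid
to `v` by each time matters. The earliest-deadline-first argument `exists_processing` splits `l v`
into payments of the single debts within their windows, and `demand_le` says that every bank can
afford its share.

The grants are optimal (`sum_grant_le`). Given a perfect schedule for a bailout `B`, let `X v` be
the surplus of `B` over the grants, summed over `v` and its descendants. Induction from the leaves
shows that `X v ≥ 0` and that the payments to `v` never lag behind `l v` by more than `X v`. Adding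
up the surpluses at the roots gives the inequality.

Computation. Time-stamps may be exponentially large, but `l v` changes only at due times
(`nextRequired_eq_of`), so a table indexed by banks and debts suffices. Its entries are built with
sums, maxima, comparisons and truncated subtractions over banks and debts. No order on the tree is
computed: the whole table is refilled in rounds, and after `k` rounds the entries of all banks of
depth at least `n - k` are right (`run_fill`).

The Turing machine comes from a chain of languages: expressions over an addressed memory (`Expr`,
`Stm`), stacks of numbers (`NCmd`), stacks of symbols (`Cmd`), `TM2`. There is no multiplication, so
each operation lengthens numbers by at most one digit, and polynomially many operations cost
polynomially many steps (`solvableInPolyTime`). -/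

namespace StackProgram

/-! ### Structured stack programs and their compilation to Turing machines -/

open Turing StateTransition

/-- Structured programs acting on stacks indexed by `K` with symbols in `Γ`, and on a finite
control state in `σ`. -/
inductive Cmd (K Γ σ : Type) : Type
  | push (k : K) (f : σ → Γ)
  | pop (k : K) (f : σ → Option Γ → σ)
  | load (f : σ → σ)
  | seq (a b : Cmd K Γ σ)
  | ite (p : σ → Bool) (a b : Cmd K Γ σ)
  | loop (p : σ → Bool) (a : Cmd K Γ σ)

namespace Cmd

variable {K Γ σ : Type}

/-- The program positions. -/
def Lab : Cmd K Γ σ → Type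
  | push _ _ => Unit
  | pop _ _ => Unit
  | load _ => Unit
  | seq a b => a.Lab ⊕ b.Lab
  | ite _ a b => Option (a.Lab ⊕ b.Lab)
  | loop _ a => Option a.Lab

/-- The position at which a program starts. -/
def entry : (c : Cmd K Γ σ) → c.Lab
  | push _ _ => ()
  | pop _ _ => ()
  | load _ => ()
  | seq a _ => Sum.inl a.entry
  | ite _ _ _ => none
  | loop _ _ => none

noncomputable instance labFintype : (c : Cmd K Γ σ) → Fintype c.Lab
  | push _ _ => inferInstanceAs (Fintype Unit)
  | pop _ _ => inferInstanceAs (Fintype Unit)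
  | load _ => inferInstanceAs (Fintype Unit)
  | seq a b =>
    haveI := labFintype a
    haveI := labFintype b
    inferInstanceAs (Fintype (a.Lab ⊕ b.Lab))
  | ite _ a b =>
    haveI := labFintype a
    haveI := labFintype b
    inferInstanceAs (Fintype (Option (a.Lab ⊕ b.Lab)))
  | loop _ a =>
    haveI := labFintype a
    inferInstanceAs (Fintype (Option a.Lab))

variable [DecidableEq K]

/-- `c.Runs s s' n`: started in the state `s`, the program `c` stops in the state `s'` after `n`
elementary steps. -/
inductive Exec : Cmd K Γ σ → σ × (K → List Γ) → σ × (K → List Γ) → ℕ → Prop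
  | push (k : K) (f : σ → Γ) (v S) :
      Exec (push k f) (v, S) (v, Function.update S k (f v :: S k)) 1
  | pop (k : K) (f : σ → Option Γ → σ) (v S) :
      Exec (pop k f) (v, S) (f v (S k).head?, Function.update S k (S k).tail) 1
  | load (f : σ → σ) (v S) : Exec (load f) (v, S) (f v, S) 1
  | seq {a b s s' s'' n n'} (ha : Exec a s s' n) (hb : Exec b s' s'' n') :
      Exec (seq a b) s s'' (n + n')
  | ite_true {p a b s s' n} (hp : p s.1 = true) (ha : Exec a s s' n) :
      Exec (ite p a b) s s' (1 + n)
  | ite_false {p a b s s' n} (hp : p s.1 = false) (hb : Exec b s s' n) :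
      Exec (ite p a b) s s' (1 + n)
  | loop_false {p a s} (hp : p s.1 = false) : Exec (loop p a) s s 1
  | loop_true {p a s s' s'' n n'} (hp : p s.1 = true) (ha : Exec a s s' n)
      (hl : Exec (loop p a) s' s'' n') : Exec (loop p a) s s'' (1 + n + n')

/-- The alphabets of the machine: the stacks of the program and an output stack of Booleans. -/
abbrev MachineΓ (K Γ : Type) : Option K → Type
  | none => Bool
  | some _ => Γ

/-- The machine code of a program whose positions are labelled by `emb`, and which jumps to the
label `exit` when it stops. -/
def code {Λ : Type} : (c : Cmd K Γ σ) → (c.Lab → Λ) → Λ → c.Lab → TM2.Stmt (MachineΓ K Γ) Λ σ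
  | push k f, _, exit, _ => .push (some k) f (.goto fun _ => exit)
  | pop k f, _, exit, _ => .pop (some k) f (.goto fun _ => exit)
  | load f, _, exit, _ => .load f (.goto fun _ => exit)
  | seq a b, emb, _, .inl l => a.code (fun x => emb (.inl x)) (emb (.inr b.entry)) l
  | seq _ b, emb, exit, .inr l => b.code (fun x => emb (.inr x)) exit l
  | ite p a b, emb, _, none =>
    .branch p (.goto fun _ => emb (some (.inl a.entry))) (.goto fun _ => emb (some (.inr b.entry)))
  | ite _ a _, emb, exit, some (.inl l) => a.code (fun x => emb (some (.inl x))) exit l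
  | ite _ _ b, emb, exit, some (.inr l) => b.code (fun x => emb (some (.inr x))) exit l
  | loop p a, emb, exit, none =>
    .branch p (.goto fun _ => emb (some a.entry)) (.goto fun _ => exit)
  | loop _ a, emb, _, some l => a.code (fun x => emb (some x)) (emb none) l

/-- The machine stacks for the program toStacks `S` and the output `o`. -/
def toStacks (S : K → List Γ) (o : List Bool) : (k : Option K) → List (MachineΓ K Γ k)
  | none => o
  | some k => S k

theorem toStacks_update (S : K → List Γ) (o : List Bool) (k : K) (l : List Γ) :
    toStacks (Function.update S k l) o = Function.update (toStacks S o) (some k) l := by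
  funext j
  cases j with
  | none => simp [toStacks]
  | some j =>
    by_cases h : j = k
    · subst h; simp [toStacks]
    · rw [Function.update_of_ne (by simpa using h)]
      simp [toStacks, Function.update_of_ne h]

theorem iterate_bind_trans {τ : Type*} {f : τ → Option τ} {a b : τ} {c : Option τ} {n n' : ℕ}
    (h : (flip bind f)^[n] (some a) = some b) (h' : (flip bind f)^[n'] (some b) = c) :
    (flip bind f)^[n + n'] (some a) = c := by
  rw [Nat.add_comm, Function.iterate_add_apply, h, h']

theorem step_branch {Λ : Type} {M : Λ → TM2.Stmt (MachineΓ K Γ) Λ σ} {l l₁ l₂ : Λ} {v : σ}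
    {S : ∀ k, List (MachineΓ K Γ k)} {p : σ → Bool}
    (h : M l = .branch p (.goto fun _ => l₁) (.goto fun _ => l₂)) :
    (flip bind (TM2.step M))^[1] (some ⟨some l, v, S⟩) =
      some ⟨some (if p v then l₁ else l₂), v, S⟩ := by
  simp only [flip, Function.iterate_one, Option.bind_eq_bind, Option.bind_some, TM2.step, h,
    TM2.stepAux]
  cases p v <;> rfl

/-- The machine `M` has to agree with the code only on the labels `emb l`, so the statement applies
to a subprogram inside a larger machine. The exit label varies in the induction: the first half of a
sequence exits into the second half, a loop body to the loop test. Elementary steps and machine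
steps correspond one to one. -/
theorem Exec.steps {Λ : Type} {M : Λ → TM2.Stmt (MachineΓ K Γ) Λ σ} {c : Cmd K Γ σ}
    {s s' : σ × (K → List Γ)} {n : ℕ} (h : c.Exec s s' n) (o : List Bool) (emb : c.Lab → Λ)
    (exit : Λ) (hM : ∀ l, M (emb l) = c.code emb exit l) :
    (flip bind (TM2.step M))^[n] (some ⟨some (emb c.entry), s.1, toStacks s.2 o⟩) =
      some ⟨some exit, s'.1, toStacks s'.2 o⟩ := by
  induction h generalizing exit with
  | push k f v S =>
    simp [flip, hM, code, toStacks_update]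
    rfl
  | pop k f v S =>
    simp [flip, hM, code, toStacks_update]
    constructor <;> rfl
  | load f v S => simp [flip, hM, code]
  | @seq a b _ _ _ _ _ ha hb iha ihb =>
    exact iterate_bind_trans
      (iha (fun x => emb (.inl x)) (emb (.inr b.entry)) fun l => hM (.inl l))
      (ihb (fun x => emb (.inr x)) exit fun l => hM (.inr l))
  | @ite_true p a b s s' n hp ha ih =>
    refine iterate_bind_trans (b := ⟨some (emb (some (.inl a.entry))), s.1, toStacks s.2 o⟩) ?_
      (ih (fun x => emb (some (.inl x))) exit fun l => hM (some (.inl l)))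
    refine (step_branch (hM none)).trans ?_
    simp [hp]
  | @ite_false p a b s s' n hp ha ih =>
    refine iterate_bind_trans (b := ⟨some (emb (some (.inr b.entry))), s.1, toStacks s.2 o⟩) ?_
      (ih (fun x => emb (some (.inr x))) exit fun l => hM (some (.inr l)))
    refine (step_branch (hM none)).trans ?_
    simp [hp]
  | loop_false hp =>
    refine (step_branch (hM none)).trans ?_
    simp [hp]
  | @loop_true p a s s' s'' n n' hp ha hl iha ihl =>
    refine iterate_bind_trans (iterate_bind_trans
      (b := ⟨some (emb (some a.entry)), s.1, toStacks s.2 o⟩) ?_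
      (iha (fun x => emb (some x)) (emb none) fun l => hM (some l))) (ihl emb exit hM)
    refine (step_branch (hM none)).trans ?_
    simp [hp]

/-- The machine that runs `c` and then outputs the Boolean `out` of the control state. -/
noncomputable def machine [Fintype K] [Fintype Γ] [Fintype σ] (c : Cmd K Γ σ) (inp : K) (v₀ : σ)
    (out : σ → Bool) : FinTM2 where
  K := Option K
  k₀ := some inp
  k₁ := none
  Γ := MachineΓ K Γ
  Λ := Option c.Lab
  main := some c.entry
  σ := σ
  initialState := v₀
  Γk₀Fin := inferInstanceAs (Fintype Γ)
  m := fun l => match l with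
    | some l => c.code some none l
    -- Besides empty work stacks, `haltList` demands the initial control state.
    | none => .push none out (.load (fun _ => v₀) .halt)

/-- A program that clears all its stacks and computes `f` within a polynomial time bound yields a
polynomial-time Turing machine. -/
theorem computable [Fintype K] [Fintype Γ] [Fintype σ] {α : Type} (c : Cmd K Γ σ) (inp : K)
    (v₀ : σ) (out : σ → Bool) (enc : α → List Γ) (f : α → Bool) (time : Polynomial ℕ)
    (h : ∀ x, ∃ v n, c.Exec (v₀, Function.update (fun _ => []) inp (enc x)) (v, fun _ => []) n ∧
      out v = f x ∧ n ≤ time.eval (enc x).length) :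
    Nonempty (TM2ComputableInPolyTime enc Computability.encodeBool f) := by
  -- The additional step writes the output and halts.
  refine ⟨⟨⟨c.machine inp v₀ out, Equiv.refl Γ, Equiv.refl Bool⟩, time + 1, fun x => ?_⟩⟩
  let n := (h x).choose_spec.choose
  have hn := (h x).choose_spec.choose_spec
  refine ⟨⟨n + 1, ?_⟩, ?_⟩
  swap
  · simpa using hn.2.2
  have h1 := hn.1.steps (M := (c.machine inp v₀ out).m) [] some none fun l => rfl
  have e : initList (c.machine inp v₀ out) (List.map (Equiv.refl Γ).invFun (enc x)) =
      ⟨some (some c.entry), v₀, toStacks (Function.update (fun _ => []) inp (enc x)) []⟩ := by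
    unfold initList
    congr 1
    funext k
    cases k with
    | none => simp [machine, toStacks]
    | some k =>
      by_cases hk : k = inp
      · subst hk; simp [machine, toStacks]; rfl
      · simp [machine, toStacks, hk]
  have e' : Option.map (haltList (c.machine inp v₀ out))
      (some (List.map (Equiv.refl Bool).invFun (Computability.encodeBool (f x)))) =
      some ⟨none, v₀, toStacks (fun _ => []) [f x]⟩ := by
    simp only [Option.map_some, haltList]
    congr 2
    funext k
    cases k with
    | none => simp [machine, toStacks, Computability.encodeBool]; rfl
    | some k => simp [machine, toStacks]
  show (flip bind (TM2.step (c.machine inp v₀ out).m))^[n + 1]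
    (some (initList (c.machine inp v₀ out) (List.map (Equiv.refl Γ).invFun (enc x)))) = _
  rw [e', e]
  refine iterate_bind_trans h1 ?_
  have e2 : Function.update (toStacks (fun _ : K => ([] : List Γ)) []) none [f x]
      = toStacks (fun _ => []) [f x] := by
    funext k
    cases k <;> simp [toStacks]
  simp only [flip, machine, Function.iterate_one, Option.bind_eq_bind, Option.bind_some, TM2.step,
    TM2.stepAux, hn.2.1]
  rw [← e2]
  rfl

end Cmd

end StackProgram

/-! ### Binary arithmetic on stacks of digits -/

namespace StackProgram

/-- The number with the given binary digits, least significant digit first. -/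
def bitVal : List Bool → ℕ
  | [] => 0
  | b :: l => Nat.bit b (bitVal l)

theorem bitVal_bits (n : ℕ) : bitVal n.bits = n := by
  induction n using Nat.binaryRec' with
  | zero => simp [bitVal]
  | bit b n h ih => rw [Nat.bits_append_bit _ _ h, bitVal, ih]

theorem bitVal_lt (l : List Bool) : bitVal l < 2 ^ l.length := by
  induction l with
  | nil => simp [bitVal]
  | cons b l ih =>
    simp only [bitVal, List.length_cons, pow_succ, Nat.bit_val]
    cases b <;> simp <;> omega

theorem bitVal_append (l l' : List Bool) :
    bitVal (l ++ l') = bitVal l + 2 ^ l.length * bitVal l' := by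
  induction l with
  | nil => simp [bitVal]
  | cons b l ih =>
    simp only [bitVal, List.cons_append, List.length_cons, pow_succ, Nat.bit_val, ih]
    ring

/-- Removing the leading zeros of a string of digits gives the canonical string of digits. -/
theorem dropWhile_eq_bits (l : List Bool) :
    (l.reverse.dropWhile (fun b => !b)).reverse = (bitVal l).bits := by
  induction l with
  | nil => simp [bitVal]
  | cons b l ih =>
    rw [List.reverse_cons, List.dropWhile_append, bitVal]
    by_cases h : l.reverse.dropWhile (fun b => !b) = []
    · have h0 : bitVal l = 0 := by
        rw [h] at ih
        have := congrArg bitVal ih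
        rw [bitVal_bits] at this
        simpa [bitVal] using this.symm
      rw [h, h0]
      cases b <;> simp
    · have h0 : bitVal l ≠ 0 := by
        intro h0
        rw [h0] at ih
        simp at ih
        apply h
        simpa using ih
      have : (l.reverse.dropWhile (fun b => !b)).isEmpty = false := by
        simpa using h
      rw [this]
      simp only [Bool.false_eq_true, if_false, List.reverse_append, List.reverse_cons,
        List.reverse_nil, List.nil_append, List.singleton_append, ih]
      rw [Nat.bits_append_bit _ _ (fun h => absurd h h0)]

/-- Digitwise processing of two numbers with a carry; a string that has ended is continued by
zeros. -/
def ripple (f : Bool → Bool → Bool → Bool × Bool) : Bool → List Bool → List Bool → List Bool × Bool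
  | c, [], [] => ([], c)
  | c, y :: ys, [] =>
    ((f c y false).1 :: (ripple f (f c y false).2 ys []).1, (ripple f (f c y false).2 ys []).2)
  | c, [], x :: xs =>
    ((f c false x).1 :: (ripple f (f c false x).2 [] xs).1, (ripple f (f c false x).2 [] xs).2)
  | c, y :: ys, x :: xs =>
    ((f c y x).1 :: (ripple f (f c y x).2 ys xs).1, (ripple f (f c y x).2 ys xs).2)

/-- The full adder. -/
def fullAdd (c y x : Bool) : Bool × Bool :=
  (xor (xor x y) c, (x && y) || (c && (x || y)))

/-- The full subtractor. -/
def fullSub (c y x : Bool) : Bool × Bool :=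
  (xor (xor x y) c, (!x && (y || c)) || (y && c))

theorem length_ripple (f : Bool → Bool → Bool → Bool × Bool) (c : Bool) (ys xs : List Bool) :
    (ripple f c ys xs).1.length = max ys.length xs.length := by
  fun_induction ripple f c ys xs <;> simp_all

/-- The carry left at the end has the weight of the position after the last output digit. -/
theorem bitVal_ripple_fullAdd (c : Bool) (ys xs : List Bool) :
    bitVal (ripple fullAdd c ys xs).1 +
      2 ^ (ripple fullAdd c ys xs).1.length * (ripple fullAdd c ys xs).2.toNat =
      bitVal xs + bitVal ys + c.toNat := by
  fun_induction ripple fullAdd c ys xs with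
  | case1 c => simp [bitVal]
  | case2 c y ys ih =>
    simp only [bitVal, List.length_cons, pow_succ, Nat.bit_val] at ih ⊢
    cases c <;> cases y <;> simp [fullAdd] at ih ⊢ <;> linarith
  | case3 c x xs ih =>
    simp only [bitVal, List.length_cons, pow_succ, Nat.bit_val] at ih ⊢
    cases c <;> cases x <;> simp [fullAdd] at ih ⊢ <;> linarith
  | case4 c y ys x xs ih =>
    simp only [bitVal, List.length_cons, pow_succ, Nat.bit_val] at ih ⊢
    cases c <;> cases y <;> cases x <;> simp [fullAdd] at ih ⊢ <;> linarith

/-- The output is the difference modulo a power of two, and the final borrow supplies the missing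
multiple; since the output is below that power, the borrow tells whether the difference is negative.
-/
theorem bitVal_ripple_fullSub (c : Bool) (ys xs : List Bool) :
    bitVal xs + 2 ^ (ripple fullSub c ys xs).1.length * (ripple fullSub c ys xs).2.toNat =
      bitVal (ripple fullSub c ys xs).1 + bitVal ys + c.toNat := by
  fun_induction ripple fullSub c ys xs with
  | case1 c => simp [bitVal]
  | case2 c y ys ih =>
    simp only [bitVal, List.length_cons, pow_succ, Nat.bit_val] at ih ⊢
    cases c <;> cases y <;> simp [fullSub] at ih ⊢ <;> linarith
  | case3 c x xs ih =>
    simp only [bitVal, List.length_cons, pow_succ, Nat.bit_val] at ih ⊢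
    cases c <;> cases x <;> simp [fullSub] at ih ⊢ <;> linarith
  | case4 c y ys x xs ih =>
    simp only [bitVal, List.length_cons, pow_succ, Nat.bit_val] at ih ⊢
    cases c <;> cases y <;> cases x <;> simp [fullSub] at ih ⊢ <;> linarith

/-- The control state: two symbols read from stacks and a flag. -/
abbrev Reg : Type := Option (Option Bool) × Option (Option Bool) × Bool

/-- Whether the symbol read is a digit. -/
def isBit : Option (Option Bool) → Bool
  | some (some _) => true
  | _ => false

/-- The digit read, or `0`. -/
def toBit : Option (Option Bool) → Bool
  | some (some b) => b
  | _ => false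

namespace Cmd

section Runs
variable {K Γ σ : Type} [DecidableEq K]

/-- The program runs from `s` to `s'` in at most `b` steps. -/
def Runs (c : Cmd K Γ σ) (s s' : σ × (K → List Γ)) (b : ℕ) : Prop :=
  ∃ n ≤ b, c.Exec s s' n

theorem Runs.mono {c : Cmd K Γ σ} {s s' : σ × (K → List Γ)} {b b' : ℕ} (h : c.Runs s s' b)
    (hb : b ≤ b') : c.Runs s s' b' :=
  let ⟨n, hn, h⟩ := h
  ⟨n, hn.trans hb, h⟩

theorem Exec.runs {c : Cmd K Γ σ} {s s' : σ × (K → List Γ)} {n : ℕ} (h : c.Exec s s' n) :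
    c.Runs s s' n :=
  ⟨n, le_rfl, h⟩

theorem Runs.seq {c d : Cmd K Γ σ} {s s' s'' : σ × (K → List Γ)} {b b' : ℕ} (h : c.Runs s s' b)
    (h' : d.Runs s' s'' b') : (c.seq d).Runs s s'' (b + b') :=
  let ⟨_, hn, h⟩ := h
  let ⟨_, hn', h'⟩ := h'
  ⟨_, add_le_add hn hn', .seq h h'⟩

theorem Runs.ite {p : σ → Bool} {c d : Cmd K Γ σ} {s s' : σ × (K → List Γ)} {b : ℕ}
    (h : (if p s.1 then c else d).Runs s s' b) : (Cmd.ite p c d).Runs s s' (1 + b) := by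
  obtain ⟨n, hn, h⟩ := h
  refine ⟨1 + n, by omega, ?_⟩
  cases hp : p s.1 with
  | true => exact .ite_true hp (by simpa [hp] using h)
  | false => exact .ite_false hp (by simpa [hp] using h)

theorem Runs.loop_true {p : σ → Bool} {c : Cmd K Γ σ} {s s' s'' : σ × (K → List Γ)} {b b' : ℕ}
    (hp : p s.1 = true) (h : c.Runs s s' b) (h' : (Cmd.loop p c).Runs s' s'' b') :
    (Cmd.loop p c).Runs s s'' (1 + b + b') :=
  let ⟨_, hn, h⟩ := h
  let ⟨_, hn', h'⟩ := h'
  ⟨_, by omega, .loop_true hp h h'⟩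

end Runs

variable {J : Type}

/-- Reads a symbol into the first register. -/
def popX (i : J) : Cmd J (Option Bool) Reg := .pop i fun v s => (s, v.2)

/-- Reads a symbol into the second register. -/
def popY (i : J) : Cmd J (Option Bool) Reg := .pop i fun v s => (v.1, s, v.2.2)

/-- Writes a fixed symbol. -/
def put (j : J) (s : Option Bool) : Cmd J (Option Bool) Reg := .push j fun _ => s

/-- Writes the digit in the first register. -/
def putX (j : J) : Cmd J (Option Bool) Reg := .push j fun v => some (toBit v.1)

/-- Does nothing. -/
def skip : Cmd J (Option Bool) Reg := .load id

/-- Moves the top string of digits of `i`, with its separator removed, to `j`; it is reversed. -/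
def shift (i j : J) : Cmd J (Option Bool) Reg :=
  .seq (popX i) (.loop (fun v => isBit v.1) (.seq (putX j) (popX i)))

/-- Like `shift`, with two copies made. -/
def shiftTwo (i j j' : J) : Cmd J (Option Bool) Reg :=
  .seq (popX i) (.loop (fun v => isBit v.1) (.seq (putX j) (.seq (putX j') (popX i))))

/-- Removes the top string of digits of `i` together with its separator. -/
def discard (i : J) : Cmd J (Option Bool) Reg :=
  .seq (popX i) (.loop (fun v => isBit v.1) (popX i))

/-- Digitwise processing of the string of digits on `t'` and the top one on `k`; the result is
left on `t`, reversed, and the last carry in the flag. -/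
def rippleCmd (f : Bool → Bool → Bool → Bool × Bool) (k t t' : J) : Cmd J (Option Bool) Reg :=
  .seq (.load fun v => (v.1, v.2.1, false)) <| .seq (popX t') <| .seq (popY k) <|
    .loop (fun v => isBit v.1 || isBit v.2.1) <|
      .seq (.push t fun v => some (f v.2.2 (toBit v.1) (toBit v.2.1)).1) <|
      .seq (.load fun v => (v.1, v.2.1, (f v.2.2 (toBit v.1) (toBit v.2.1)).2)) <|
      .seq (popX t') (.ite (fun v => isBit v.2.1) (popY k) skip)

/-- Removes the zeros on top of `t`. -/
def strip (t : J) : Cmd J (Option Bool) Reg :=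
  .seq (popX t) <| .seq (.loop (fun v => isBit v.1 && !toBit v.1) (popX t))
    (.ite (fun v => isBit v.1) (putX t) skip)

/-- Replaces the two numbers on top of `k` by the result of an operation. -/
def arith (f : Bool → Bool → Bool → Bool × Bool) (fin : Cmd J (Option Bool) Reg) (k t t' : J) :
    Cmd J (Option Bool) Reg :=
  .seq (shift k t) <| .seq (shift t t') <| .seq (rippleCmd f k t t') <|
    .seq (.ite (fun v => v.2.2) fin skip) <| .seq (strip t) <| .seq (put k none) (shift t k)

variable [DecidableEq J]

theorem popX_runs (i : J) (v : Reg) (S : J → List (Option Bool)) :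
    (popX i).Runs (v, S) (((S i).head?, v.2), Function.update S i (S i).tail) 1 :=
  (Exec.pop _ _ _ _).runs

theorem popY_runs (i : J) (v : Reg) (S : J → List (Option Bool)) :
    (popY i).Runs (v, S) ((v.1, (S i).head?, v.2.2), Function.update S i (S i).tail) 1 :=
  (Exec.pop _ _ _ _).runs

theorem put_runs (j : J) (s : Option Bool) (v : Reg) (S : J → List (Option Bool)) :
    (put j s).Runs (v, S) (v, Function.update S j (s :: S j)) 1 :=
  (Exec.push _ _ _ _).runs

theorem putX_runs (j : J) (v : Reg) (S : J → List (Option Bool)) :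
    (putX j).Runs (v, S) (v, Function.update S j (some (toBit v.1) :: S j)) 1 :=
  (Exec.push _ _ _ _).runs

theorem skip_runs (v : Reg) (S : J → List (Option Bool)) :
    (skip : Cmd J (Option Bool) Reg).Runs (v, S) (v, S) 1 :=
  (Exec.load _ _ _).runs

/-- The hypothesis `htl` covers both ways in which a string can end, at a separator or at the bottom
of the stack; in either case `tl.tail` is what remains. -/
theorem shift_runs {i j : J} (hij : i ≠ j) (bits : List Bool) (tl : List (Option Bool))
    (htl : isBit tl.head? = false) (v : Reg) (S : J → List (Option Bool))
    (hS : S i = bits.map some ++ tl) :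
    ∃ v', (shift i j).Runs (v, S)
      (v', Function.update (Function.update S j (bits.reverse.map some ++ S j)) i tl.tail)
      (3 * bits.length + 2) := by
  -- Loop invariant: the next symbol has already been read into the register, and only the rest is
  -- on `i`.
  have key : ∀ (bits : List Bool) (v : Reg) (S : J → List (Option Bool)),
      v.1 = (bits.map some ++ tl).head? → S i = (bits.map some ++ tl).tail →
      ∃ v', (Cmd.loop (fun v => isBit v.1) (.seq (putX j) (popX i))).Runs (v, S)
        (v', Function.update (Function.update S j (bits.reverse.map some ++ S j)) i tl.tail)
        (3 * bits.length + 1) := by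
    intro bits
    induction bits with
    | nil =>
      intro v S hv hS
      refine ⟨v, ?_⟩
      have : Function.update (Function.update S j (([] : List Bool).reverse.map some ++ S j)) i
          tl.tail = S := by
        funext l
        simp only [Function.update_apply]
        split_ifs <;> simp_all
      rw [this]
      exact (Exec.loop_false (by simpa [hv] using htl)).runs
    | cons b bits ih =>
      intro v S hv hS
      obtain ⟨v', h'⟩ := ih ((bits.map some ++ tl).head?, v.2)
        (Function.update (Function.update S j (some b :: S j)) i (bits.map some ++ tl).tail) rfl
        (by simp)
      refine ⟨v', ?_⟩
      have hv' : v.1 = some (some b) := by simpa using hv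
      refine ((Runs.loop_true (by simp [hv', isBit])
        ((putX_runs j v S).seq (popX_runs i _ _)) ?_).mono (b := 1 + 2 + (3 * bits.length + 1)) ?_)
      · clear ih
        convert h' using 2
        · simp [hij, hS, hv']
        · funext l
          simp only [Function.update_apply]
          split_ifs <;> simp_all [toBit]
        · funext l
          simp only [Function.update_apply]
          split_ifs <;> simp_all
      · simp; omega
  obtain ⟨v', h⟩ := key bits ((bits.map some ++ tl).head?, v.2)
    (Function.update S i (bits.map some ++ tl).tail) rfl (by simp)
  refine ⟨v', (((popX_runs i v S).seq ?_).mono (b := 1 + (3 * bits.length + 1)) (by omega))⟩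
  convert h using 2
  · rw [hS]
  · rw [hS]
  · funext l
    simp only [Function.update_apply]
    split_ifs <;> simp_all

theorem shiftTwo_runs {i j j' : J} (hij : i ≠ j) (hij' : i ≠ j') (hjj' : j ≠ j')
    (bits : List Bool) (tl : List (Option Bool))
    (htl : isBit tl.head? = false) (v : Reg) (S : J → List (Option Bool))
    (hS : S i = bits.map some ++ tl) :
    ∃ v', (shiftTwo i j j').Runs (v, S)
      (v', Function.update (Function.update (Function.update S j (bits.reverse.map some ++ S j))
        j' (bits.reverse.map some ++ S j')) i tl.tail)
      (4 * bits.length + 2) := by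
  have key : ∀ (bits : List Bool) (v : Reg) (S : J → List (Option Bool)),
      v.1 = (bits.map some ++ tl).head? → S i = (bits.map some ++ tl).tail →
      ∃ v', (Cmd.loop (fun v => isBit v.1)
        (.seq (putX j) (.seq (putX j') (popX i)))).Runs (v, S)
        (v', Function.update (Function.update (Function.update S j (bits.reverse.map some ++ S j))
          j' (bits.reverse.map some ++ S j')) i tl.tail)
        (4 * bits.length + 1) := by
    intro bits
    induction bits with
    | nil =>
      intro v S hv hS
      refine ⟨v, ?_⟩
      have : Function.update (Function.update (Function.update S j
          (([] : List Bool).reverse.map some ++ S j)) j'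
          (([] : List Bool).reverse.map some ++ S j')) i tl.tail = S := by
        funext l
        simp only [Function.update_apply]
        split_ifs <;> simp_all
      rw [this]
      exact (Exec.loop_false (by simpa [hv] using htl)).runs
    | cons b bits ih =>
      intro v S hv hS
      obtain ⟨v', h'⟩ := ih ((bits.map some ++ tl).head?, v.2)
        (Function.update (Function.update (Function.update S j (some b :: S j))
          j' (some b :: S j')) i (bits.map some ++ tl).tail) rfl
        (by simp)
      refine ⟨v', ?_⟩
      have hv' : v.1 = some (some b) := by simpa using hv
      refine ((Runs.loop_true (by simp [hv', isBit])
        ((putX_runs j v S).seq ((putX_runs j' _ _).seq (popX_runs i _ _))) ?_).mono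
          (b := 1 + 3 + (4 * bits.length + 1)) ?_)
      · clear ih
        convert h' using 2
        · simp [hij, hij', hS, hv']
        · funext l
          simp only [Function.update_apply]
          split_ifs <;> simp_all [toBit]
        · funext l
          simp only [Function.update_apply]
          split_ifs <;> simp_all
      · simp; omega
  obtain ⟨v', h⟩ := key bits ((bits.map some ++ tl).head?, v.2)
    (Function.update S i (bits.map some ++ tl).tail) rfl (by simp)
  refine ⟨v', (((popX_runs i v S).seq ?_).mono (b := 1 + (4 * bits.length + 1)) (by omega))⟩
  convert h using 2
  · rw [hS]
  · rw [hS]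
  · funext l
    simp only [Function.update_apply]
    split_ifs <;> simp_all

theorem discard_runs (i : J) (bits : List Bool) (tl : List (Option Bool))
    (htl : isBit tl.head? = false) (v : Reg) (S : J → List (Option Bool))
    (hS : S i = bits.map some ++ tl) :
    ∃ v', (discard i).Runs (v, S) (v', Function.update S i tl.tail) (2 * bits.length + 2) := by
  have key : ∀ (bits : List Bool) (v : Reg) (S : J → List (Option Bool)),
      v.1 = (bits.map some ++ tl).head? → S i = (bits.map some ++ tl).tail →
      ∃ v', (Cmd.loop (fun v => isBit v.1) (popX i)).Runs (v, S)
        (v', Function.update S i tl.tail) (2 * bits.length + 1) := by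
    intro bits
    induction bits with
    | nil =>
      intro v S hv hS
      refine ⟨v, ?_⟩
      have : Function.update S i tl.tail = S := by
        funext l
        simp only [Function.update_apply]
        split_ifs <;> simp_all
      rw [this]
      exact (Exec.loop_false (by simpa [hv] using htl)).runs
    | cons b bits ih =>
      intro v S hv hS
      obtain ⟨v', h'⟩ := ih ((bits.map some ++ tl).head?, v.2)
        (Function.update S i (bits.map some ++ tl).tail) rfl (by simp)
      refine ⟨v', ?_⟩
      have hv' : v.1 = some (some b) := by simpa using hv
      refine ((Runs.loop_true (by simp [hv', isBit])
        (popX_runs i _ _) ?_).mono (b := 1 + 1 + (2 * bits.length + 1)) ?_)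
      · convert h' using 2
        · simp [hS]
        · simp [hS]
        · simp
      · simp; omega
  obtain ⟨v', h⟩ := key bits ((bits.map some ++ tl).head?, v.2)
    (Function.update S i (bits.map some ++ tl).tail) rfl (by simp)
  refine ⟨v', (((popX_runs i v S).seq ?_).mono (b := 1 + (2 * bits.length + 1)) (by omega))⟩
  convert h using 2
  · rw [hS]
  · rw [hS]
  · simp

end Cmd
end StackProgram

namespace StackProgram
namespace Cmd
variable {J : Type} [DecidableEq J]

/-- The scratch stack `t'` holds nothing but the one string, so it may be read beyond its end. On
`k` other numbers follow, so once the separator is in the second register nothing more is popped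
from `k`. -/
theorem ripple_body_runs (f : Bool → Bool → Bool → Bool × Bool) {k t t' : J} (hkt : k ≠ t)
    (hkt' : k ≠ t') (htt' : t ≠ t') (v : Reg) (S : J → List (Option Bool)) :
    (Cmd.seq (.push t fun v : Reg => some (f v.2.2 (toBit v.1) (toBit v.2.1)).1) <|
      .seq (.load fun v => (v.1, v.2.1, (f v.2.2 (toBit v.1) (toBit v.2.1)).2)) <|
      .seq (popX t') (.ite (fun v => isBit v.2.1) (popY k) skip)).Runs (v, S)
      (((S t').head?, if isBit v.2.1 then (S k).head? else v.2.1,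
        (f v.2.2 (toBit v.1) (toBit v.2.1)).2),
        Function.update (Function.update (Function.update S t
          (some (f v.2.2 (toBit v.1) (toBit v.2.1)).1 :: S t)) t' (S t').tail) k
          (if isBit v.2.1 then (S k).tail else S k)) 5 := by
  refine (((Exec.push _ _ _ _).runs.seq ((Exec.load _ _ _).runs.seq
    ((popX_runs _ _ _).seq (Runs.ite (b := 1) ?_)))).mono (by omega))
  cases h : isBit v.2.1 with
  | true =>
    simp only [if_true]
    convert popY_runs k _ _ using 2
    · simp [hkt, hkt', htt'.symm]
    · funext l
      simp only [Function.update_apply]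
      split_ifs <;> simp_all
  | false =>
    simp only [Bool.false_eq_true, if_false]
    convert (skip_runs (J := J) _ _) using 2
    · simp [htt'.symm]
    · funext l
      simp only [Function.update_apply]
      split_ifs <;> simp_all

theorem ripple_loop_runs (f : Bool → Bool → Bool → Bool × Bool) {k t t' : J} (hkt : k ≠ t)
    (hkt' : k ≠ t') (htt' : t ≠ t') (tl : List (Option Bool)) (c : Bool) (ys xs : List Bool)
    (v : Reg) (S : J → List (Option Bool)) (hc : v.2.2 = c) (h1 : v.1 = (ys.map some).head?)
    (h2 : S t' = (ys.map some).tail) (h3 : v.2.1 = (xs.map some ++ none :: tl).head?)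
    (h4 : S k = (xs.map some ++ none :: tl).tail) :
    ∃ v', v'.2.2 = (ripple f c ys xs).2 ∧
      (Cmd.loop (fun v => isBit v.1 || isBit v.2.1) <|
      .seq (.push t fun v : Reg => some (f v.2.2 (toBit v.1) (toBit v.2.1)).1) <|
      .seq (.load fun v => (v.1, v.2.1, (f v.2.2 (toBit v.1) (toBit v.2.1)).2)) <|
      .seq (popX t') (.ite (fun v => isBit v.2.1) (popY k) skip)).Runs (v, S)
      (v', Function.update (Function.update (Function.update S t
          ((ripple f c ys xs).1.reverse.map some ++ S t)) t' []) k tl)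
      (6 * (ripple f c ys xs).1.length + 1) := by
  fun_induction ripple f c ys xs generalizing v S with
  | case1 c =>
    refine ⟨v, hc, ?_⟩
    have : Function.update (Function.update (Function.update S t
          (([] : List Bool).reverse.map some ++ S t)) t' []) k tl = S := by
      funext l
      simp only [Function.update_apply]
      split_ifs <;> simp_all
    rw [this]
    exact (Exec.loop_false (by simp [h1, h3, isBit])).runs
  | case2 c y ys ih =>
    have hb := ripple_body_runs f hkt hkt' htt' v S
    have e1 : v.1 = some (some y) := by simpa using h1
    have e3 : v.2.1 = some none := by simpa using h3
    obtain ⟨v', hv', h'⟩ := ih (S := Function.update (Function.update (Function.update S t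
          (some (f v.2.2 (toBit v.1) (toBit v.2.1)).1 :: S t)) t' (S t').tail) k
          (if isBit v.2.1 then (S k).tail else S k)) (v := ((S t').head?,
            if isBit v.2.1 then (S k).head? else v.2.1,
            (f v.2.2 (toBit v.1) (toBit v.2.1)).2))
          (by simp [e1, e3, toBit, hc]) (by simp [h2])
          (by simp [hkt'.symm, h2]) (by simp [e3, isBit]) (by simp [e3, isBit, h4])
    refine ⟨v', hv', ?_⟩
    have h := Runs.loop_true (by simp [e1, isBit]) hb h'
    refine Runs.mono (b := 1 + 5 + (6 * (ripple f (f c y false).2 ys []).1.length + 1)) ?_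
      (by simp only [List.length_cons]; omega)
    convert h using 2
    clear ih h' h hb
    funext l
    simp only [Function.update_apply]
    split_ifs <;> simp_all [toBit]
  | case3 c x xs ih =>
    have hb := ripple_body_runs f hkt hkt' htt' v S
    have e1 : v.1 = none := by simpa using h1
    have e3 : v.2.1 = some (some x) := by simpa using h3
    obtain ⟨v', hv', h'⟩ := ih (S := Function.update (Function.update (Function.update S t
          (some (f v.2.2 (toBit v.1) (toBit v.2.1)).1 :: S t)) t' (S t').tail) k
          (if isBit v.2.1 then (S k).tail else S k)) (v := ((S t').head?,
            if isBit v.2.1 then (S k).head? else v.2.1,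
            (f v.2.2 (toBit v.1) (toBit v.2.1)).2))
          (by simp [e1, e3, toBit, hc]) (by simp [h2])
          (by simp [hkt'.symm, h2]) (by simp [e3, isBit, h4]) (by simp [e3, isBit, h4])
    refine ⟨v', hv', ?_⟩
    have h := Runs.loop_true (by simp [e3, isBit]) hb h'
    refine Runs.mono (b := 1 + 5 + (6 * (ripple f (f c false x).2 [] xs).1.length + 1)) ?_
      (by simp only [List.length_cons]; omega)
    convert h using 2
    clear ih h' h hb
    funext l
    simp only [Function.update_apply]
    split_ifs <;> simp_all [toBit]
  | case4 c y ys x xs ih =>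
    have hb := ripple_body_runs f hkt hkt' htt' v S
    have e1 : v.1 = some (some y) := by simpa using h1
    have e3 : v.2.1 = some (some x) := by simpa using h3
    obtain ⟨v', hv', h'⟩ := ih (S := Function.update (Function.update (Function.update S t
          (some (f v.2.2 (toBit v.1) (toBit v.2.1)).1 :: S t)) t' (S t').tail) k
          (if isBit v.2.1 then (S k).tail else S k)) (v := ((S t').head?,
            if isBit v.2.1 then (S k).head? else v.2.1,
            (f v.2.2 (toBit v.1) (toBit v.2.1)).2))
          (by simp [e1, e3, toBit, hc]) (by simp [h2])
          (by simp [hkt'.symm, h2]) (by simp [e3, isBit, h4]) (by simp [e3, isBit, h4])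
    refine ⟨v', hv', ?_⟩
    have h := Runs.loop_true (by simp [e3, isBit]) hb h'
    refine Runs.mono (b := 1 + 5 + (6 * (ripple f (f c y x).2 ys xs).1.length + 1)) ?_
      (by simp only [List.length_cons]; omega)
    convert h using 2
    clear ih h' h hb
    funext l
    simp only [Function.update_apply]
    split_ifs <;> simp_all [toBit]

theorem rippleCmd_runs (f : Bool → Bool → Bool → Bool × Bool) {k t t' : J} (hkt : k ≠ t)
    (hkt' : k ≠ t') (htt' : t ≠ t') (tl : List (Option Bool)) (ys xs : List Bool)
    (v : Reg) (S : J → List (Option Bool)) (h2 : S t' = ys.map some)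
    (h4 : S k = xs.map some ++ none :: tl) :
    ∃ v', v'.2.2 = (ripple f false ys xs).2 ∧ (rippleCmd f k t t').Runs (v, S)
      (v', Function.update (Function.update (Function.update S t
          ((ripple f false ys xs).1.reverse.map some ++ S t)) t' []) k tl)
      (6 * max ys.length xs.length + 4) := by
  obtain ⟨v', hv', h⟩ := ripple_loop_runs f hkt hkt' htt' tl false ys xs
    ((ys.map some).head?, (xs.map some ++ none :: tl).head?, false)
    (Function.update (Function.update S t' (ys.map some).tail) k
      (xs.map some ++ none :: tl).tail) rfl rfl (by simp [hkt'.symm]) rfl (by simp)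
  refine ⟨v', hv', ?_⟩
  rw [length_ripple] at h
  refine (((Exec.load _ _ _).runs.seq ((popX_runs _ _ _).seq ((popY_runs _ _ _).seq
    (b' := 6 * max ys.length xs.length + 1) ?_))).mono (by omega))
  convert h using 2
  · simp [h2, h4, hkt']
  · simp [h2, h4, hkt']
  · funext l
    simp only [Function.update_apply]
    split_ifs <;> simp_all

theorem strip_runs (t : J) (bits : List Bool) (v : Reg) (S : J → List (Option Bool))
    (hS : S t = bits.map some) :
    ∃ v', (strip t).Runs (v, S)
      (v', Function.update S t ((bits.dropWhile (fun b => !b)).map some))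
      (2 * bits.length + 4) := by
  have key : ∀ (bits : List Bool) (v : Reg) (S : J → List (Option Bool)),
      v.1 = (bits.map some).head? → S t = (bits.map some).tail →
      ∃ v', v'.1 = ((bits.dropWhile (fun b => !b)).map some).head? ∧
        (Cmd.loop (fun v => isBit v.1 && !toBit v.1) (popX t)).Runs (v, S)
        (v', Function.update S t ((bits.dropWhile (fun b => !b)).map some).tail)
        (2 * bits.length + 1) := by
    intro bits
    induction bits with
    | nil =>
      intro v S hv hS
      refine ⟨v, hv, ?_⟩
      have : Function.update S t ((([] : List Bool).dropWhile (fun b => !b)).map some).tail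
          = S := by
        simpa using hS
      rw [this]
      exact (Exec.loop_false (by simp [hv, isBit])).runs
    | cons b bits ih =>
      intro v S hv hS
      have hv' : v.1 = some (some b) := by simpa using hv
      cases b with
      | true =>
        refine ⟨v, by simpa using hv', ?_⟩
        have : Function.update S t (((true :: bits).dropWhile (fun b => !b)).map some).tail
            = S := by
          simpa using hS.symm
        rw [this]
        exact (Exec.loop_false (by simp [hv', toBit])).runs.mono (by omega)
      | false =>
        obtain ⟨v', h1, h'⟩ := ih ((bits.map some).head?, v.2)
          (Function.update S t (bits.map some).tail) rfl (by simp)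
        refine ⟨v', by simpa using h1, ?_⟩
        refine ((Runs.loop_true (by simp [hv', isBit, toBit])
          (popX_runs t _ _) ?_).mono (b := 1 + 1 + (2 * bits.length + 1)) ?_)
        · convert h' using 2
          · simp [hS]
          · simp [hS]
          · simp
        · simp; omega
  obtain ⟨v', h1, h⟩ := key bits ((bits.map some).head?, v.2)
    (Function.update S t (bits.map some).tail) rfl (by simp)
  refine ⟨v', (((popX_runs t v S).seq (Runs.seq (b := 2 * bits.length + 1) (b' := 2)
    (s' := (v', Function.update S t ((bits.dropWhile (fun b => !b)).map some).tail)) ?_ ?_)).mono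
    (by omega))⟩
  · convert h using 2
    · rw [hS]
    · rw [hS]
    · simp
  -- The loop stops only after popping the leading `1`, if there is one; it is put back here.
  · refine Runs.ite (b := 1) ?_
    cases hd : bits.dropWhile (fun b => !b) with
    | nil =>
      rw [hd] at h1
      simp only [h1, List.map_nil, List.head?_nil, isBit]
      exact skip_runs _ _
    | cons b l =>
      rw [hd] at h1
      simp only [h1, List.map_cons, List.head?_cons, isBit, if_true]
      convert putX_runs t _ _ using 2
      simp [h1, toBit]

end Cmd
end StackProgram

namespace StackProgram
namespace Cmd
variable {J : Type} [DecidableEq J]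

/-- Moving `y` twice, to `t` and on to `t'`, restores its order, least significant digit on top, as
the digitwise pass needs it. The pass leaves its result on `t` with the most significant digit on
top, which is where leading zeros can be stripped and where `fin` reacts to a last carry; `g` is the
effect of `fin` on that reversed string. The final move to `k` reverses it again. Stripping is
needed because stacks must hold the canonical strings `Nat.bits`. The costs add up to at most `19 *
l + 23`. -/
theorem arith_runs (f : Bool → Bool → Bool → Bool × Bool) (fin : Cmd J (Option Bool) Reg)
    (g : List Bool → List Bool) {k t t' : J} (hkt : k ≠ t) (hkt' : k ≠ t') (htt' : t ≠ t')
    (hg : ∀ l, (g l).length ≤ l.length + 1)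
    (hfin : ∀ v S bits, S t = bits.map some →
      ∃ v', fin.Runs (v, S) (v', Function.update S t ((g bits).map some)) (2 * bits.length + 2))
    (x y r l : ℕ)
    (hr : r = bitVal (if (ripple f false y.bits x.bits).2 then
      (g (ripple f false y.bits x.bits).1.reverse).reverse else (ripple f false y.bits x.bits).1))
    (hx : x.bits.length ≤ l) (hy : y.bits.length ≤ l) (tl : List (Option Bool)) (v : Reg)
    (S : J → List (Option Bool)) (ht : S t = []) (ht' : S t' = [])
    (hk : S k = y.bits.map some ++ none :: (x.bits.map some ++ none :: tl)) :
    ∃ v', (arith f fin k t t').Runs (v, S)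
      (v', Function.update S k (r.bits.map some ++ none :: tl)) (23 * (l + 1)) := by
  set p := ripple f false y.bits x.bits with hp
  have hpl : p.1.length ≤ l := by rw [hp, length_ripple]; exact max_le hy hx
  obtain ⟨v1, h1⟩ := shift_runs hkt y.bits (none :: (x.bits.map some ++ none :: tl)) rfl v S hk
  set S1 := Function.update (Function.update S t (y.bits.reverse.map some ++ S t)) k
    (none :: (x.bits.map some ++ none :: tl)).tail with hS1
  obtain ⟨v2, h2⟩ := shift_runs htt' y.bits.reverse [] rfl v1 S1 (by simp [hS1, hkt.symm, ht])
  set S2 := Function.update (Function.update S1 t' (y.bits.reverse.reverse.map some ++ S1 t')) t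
    ([] : List (Option Bool)).tail with hS2
  obtain ⟨v3, hc, h3⟩ := rippleCmd_runs f hkt hkt' htt' tl y.bits x.bits v2 S2
    (by simp [hS2, hS1, htt'.symm, hkt'.symm, ht']) (by simp [hS2, hS1, hkt, hkt'])
  rw [← hp] at h3 hc
  set S3 := Function.update (Function.update (Function.update S2 t
          (p.1.reverse.map some ++ S2 t)) t' []) k tl with hS3
  have hS3t : S3 t = p.1.reverse.map some := by simp [hS3, hS2, hkt.symm, htt']
  set res := if p.2 then g p.1.reverse else p.1.reverse with hres
  have hresl : res.length ≤ l + 1 := by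
    rw [hres]
    split_ifs
    · exact (hg _).trans (by simpa using hpl)
    · simpa using hpl.trans (Nat.le_succ _)
  obtain ⟨v4, h4⟩ : ∃ v4, (Cmd.ite (fun v : Reg => v.2.2) fin skip).Runs (v3, S3)
      (v4, Function.update S3 t (res.map some)) (1 + (2 * p.1.length + 2)) := by
    cases hc' : p.2 with
    | true =>
      obtain ⟨v', h'⟩ := hfin v3 S3 p.1.reverse hS3t
      refine ⟨v', Runs.ite ?_⟩
      rw [hc'] at hc
      simpa [hc, hres, hc'] using h'
    | false =>
      refine ⟨v3, Runs.ite ?_⟩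
      rw [hc'] at hc
      simp only [hc, hres, hc', Bool.false_eq_true, if_false]
      rw [← hS3t, Function.update_eq_self]
      exact (skip_runs v3 S3).mono (by omega)
  obtain ⟨v5, h5⟩ := strip_runs t res v4 (Function.update S3 t (res.map some)) (by simp)
  have hdrop : res.dropWhile (fun b => !b) = r.bits.reverse := by
    have := dropWhile_eq_bits res.reverse
    rw [List.reverse_reverse] at this
    rw [hr, List.reverse_eq_iff.mp this]
    congr 3
    rw [hres]
    split_ifs <;> simp
  rw [hdrop] at h5
  have hrl : r.bits.length ≤ l + 1 := by
    have := List.length_dropWhile_le (fun b => !b) res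
    rw [hdrop, List.length_reverse] at this
    omega
  set S5 := Function.update (Function.update S3 t (res.map some)) t (r.bits.reverse.map some)
    with hS5
  have h6 := put_runs k none v5 S5
  set S6 := Function.update S5 k (none :: S5 k) with hS6
  obtain ⟨v7, h7⟩ := shift_runs hkt.symm r.bits.reverse [] rfl v5 S6
    (by simp [hS6, hS5, hkt.symm])
  refine ⟨v7, ?_⟩
  have hfinal : Function.update (Function.update S6 k (r.bits.reverse.reverse.map some ++ S6 k)) t
      ([] : List (Option Bool)).tail = Function.update S k (r.bits.map some ++ none :: tl) := by
    clear h1 h2 h3 h4 h5 h6 h7 hfin hg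
    funext j
    by_cases hjk : j = k
    · subst hjk
      simp [hS6, hS5, hS3, hkt]
    · by_cases hjt : j = t
      · subst hjt
        simp [hjk, ht]
      · by_cases hjt' : j = t'
        · subst hjt'
          simp [hS6, hS5, hS3, hjk, hjt, ht']
        · simp [hS6, hS5, hS3, hS2, hS1, hjk, hjt, hjt']
  rw [hfinal] at h7
  refine (h1.seq (h2.seq (h3.seq (h4.seq (h5.seq (h6.seq h7)))))).mono ?_
  simp only [List.length_reverse]
  omega

/-- Addition of the two numbers on top of `k`. -/
def addCmd (k t t' : J) : Cmd J (Option Bool) Reg := arith fullAdd (put t (some true)) k t t'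

/-- Truncated subtraction of the two numbers on top of `k`. -/
def subCmd (k t t' : J) : Cmd J (Option Bool) Reg := arith fullSub (discard t) k t t'

theorem addCmd_runs {k t t' : J} (hkt : k ≠ t) (hkt' : k ≠ t') (htt' : t ≠ t') (x y l : ℕ)
    (hx : x.bits.length ≤ l) (hy : y.bits.length ≤ l) (tl : List (Option Bool)) (v : Reg)
    (S : J → List (Option Bool)) (ht : S t = []) (ht' : S t' = [])
    (hk : S k = y.bits.map some ++ none :: (x.bits.map some ++ none :: tl)) :
    ∃ v', (addCmd k t t').Runs (v, S)
      (v', Function.update S k ((x + y).bits.map some ++ none :: tl)) (23 * (l + 1)) := by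
  -- A last carry becomes a new leading digit.
  refine arith_runs fullAdd _ (fun l => true :: l) hkt hkt' htt' (by simp) ?_ x y (x + y) l ?_
    hx hy tl v S ht ht' hk
  · intro v S bits hS
    refine ⟨v, Runs.mono (b := 1) ?_ (by omega)⟩
    simpa [hS] using put_runs t (some true) v S
  · have := bitVal_ripple_fullAdd false y.bits x.bits
    simp only [bitVal_bits, Bool.toNat_false, add_zero] at this
    rw [← this]
    cases (ripple fullAdd false y.bits x.bits).2 with
    | false => simp
    | true => simp [bitVal_append, bitVal]

theorem subCmd_runs {k t t' : J} (hkt : k ≠ t) (hkt' : k ≠ t') (htt' : t ≠ t') (x y l : ℕ)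
    (hx : x.bits.length ≤ l) (hy : y.bits.length ≤ l) (tl : List (Option Bool)) (v : Reg)
    (S : J → List (Option Bool)) (ht : S t = []) (ht' : S t' = [])
    (hk : S k = y.bits.map some ++ none :: (x.bits.map some ++ none :: tl)) :
    ∃ v', (subCmd k t t').Runs (v, S)
      (v', Function.update S k ((x - y).bits.map some ++ none :: tl)) (23 * (l + 1)) := by
  -- A last borrow means `x < y`; all digits are thrown away, which leaves the truncated difference
  -- `0`.
  refine arith_runs fullSub _ (fun _ => []) hkt hkt' htt' (by simp) ?_ x y (x - y) l ?_
    hx hy tl v S ht ht' hk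
  · intro v S bits hS
    obtain ⟨v', h⟩ := discard_runs t bits [] rfl v S (by simpa using hS)
    exact ⟨v', by simpa using h⟩
  · have := bitVal_ripple_fullSub false y.bits x.bits
    simp only [bitVal_bits, Bool.toNat_false, add_zero] at this
    have hlt := bitVal_lt (ripple fullSub false y.bits x.bits).1
    cases h : (ripple fullSub false y.bits x.bits).2 with
    | false =>
      simp only [h, Bool.toNat_false, mul_zero, add_zero] at this
      simp only [Bool.false_eq_true, if_false]
      omega
    | true =>
      simp only [h, Bool.toNat_true, mul_one] at this
      simp only [if_true, List.reverse_nil, bitVal]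
      omega

/-- Moves the number on top of `i` to `j`. -/
def moveCmd (i j t : J) : Cmd J (Option Bool) Reg :=
  .seq (shift i t) (.seq (put j none) (shift t j))

/-- Copies the number on top of `i` to `j`. -/
def copyCmd (i j t : J) : Cmd J (Option Bool) Reg :=
  .seq (shift i t) (.seq (put i none) (.seq (put j none) (shiftTwo t i j)))

theorem moveCmd_runs {i j t : J} (hij : i ≠ j) (hit : i ≠ t) (hjt : j ≠ t) (x : ℕ)
    (tl : List (Option Bool)) (v : Reg) (S : J → List (Option Bool)) (ht : S t = [])
    (hi : S i = x.bits.map some ++ none :: tl) :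
    ∃ v', (moveCmd i j t).Runs (v, S)
      (v', Function.update (Function.update S i tl) j (x.bits.map some ++ none :: S j))
      (6 * x.bits.length + 5) := by
  obtain ⟨v1, h1⟩ := shift_runs hit x.bits (none :: tl) rfl v S hi
  set S1 := Function.update (Function.update S t (x.bits.reverse.map some ++ S t)) i
    (none :: tl).tail with hS1
  have h2 := put_runs j none v1 S1
  set S2 := Function.update S1 j (none :: S1 j) with hS2
  obtain ⟨v3, h3⟩ := shift_runs hjt.symm x.bits.reverse [] rfl v1 S2
    (by simp [hS2, hS1, hjt.symm, hit.symm, ht])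
  refine ⟨v3, ?_⟩
  have hfinal : Function.update (Function.update S2 j (x.bits.reverse.reverse.map some ++ S2 j)) t
      ([] : List (Option Bool)).tail =
      Function.update (Function.update S i tl) j (x.bits.map some ++ none :: S j) := by
    funext l
    by_cases hlj : l = j
    · subst hlj; simp [hS2, hS1, hjt, hij.symm]
    · by_cases hlt : l = t
      · subst hlt; simp [hlj, hit.symm, ht]
      · by_cases hli : l = i
        · subst hli; simp [hlj, hlt, hS2, hS1]
        · simp [hlj, hlt, hli, hS2, hS1]
  rw [hfinal] at h3
  refine (h1.seq (h2.seq h3)).mono ?_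
  simp only [List.length_reverse]
  omega

theorem copyCmd_runs {i j t : J} (hij : i ≠ j) (hit : i ≠ t) (hjt : j ≠ t) (x : ℕ)
    (tl : List (Option Bool)) (v : Reg) (S : J → List (Option Bool)) (ht : S t = [])
    (hi : S i = x.bits.map some ++ none :: tl) :
    ∃ v', (copyCmd i j t).Runs (v, S)
      (v', Function.update S j (x.bits.map some ++ none :: S j))
      (7 * x.bits.length + 6) := by
  obtain ⟨v1, h1⟩ := shift_runs hit x.bits (none :: tl) rfl v S hi
  set S1 := Function.update (Function.update S t (x.bits.reverse.map some ++ S t)) i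
    (none :: tl).tail with hS1
  have h2 := put_runs i none v1 S1
  set S2 := Function.update S1 i (none :: S1 i) with hS2
  have h3 := put_runs j none v1 S2
  set S3 := Function.update S2 j (none :: S2 j) with hS3
  obtain ⟨v4, h4⟩ := shiftTwo_runs hit.symm hjt.symm hij x.bits.reverse [] rfl v1 S3
    (by simp [hS3, hS2, hS1, hjt.symm, hit.symm, ht])
  refine ⟨v4, ?_⟩
  have hfinal : Function.update (Function.update (Function.update S3 i
      (x.bits.reverse.reverse.map some ++ S3 i)) j (x.bits.reverse.reverse.map some ++ S3 j)) t
      ([] : List (Option Bool)).tail =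
      Function.update S j (x.bits.map some ++ none :: S j) := by
    funext l
    by_cases hlj : l = j
    · subst hlj; simp [hS3, hS2, hS1, hjt, hij.symm]
    · by_cases hlt : l = t
      · subst hlt; simp [hlj, ht]
      · by_cases hli : l = i
        · subst hli; simp [hlj, hlt, hS3, hS2, hS1, hi]
        · simp [hlj, hlt, hli, hS3, hS2, hS1]
  rw [hfinal] at h4
  refine (h1.seq (h2.seq (h3.seq h4))).mono ?_
  simp only [List.length_reverse]
  omega

end Cmd

/-! ### Programs on stacks of numbers and their simulation on strings -/

/-- Operations on stacks of numbers. -/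
inductive Prim (K : Type) : Type
  | push (b : Bool) (k : K)
  | drop (k : K)
  | move (i j : K)
  | copy (i j : K)
  | add (k : K)
  | sub (k : K)

/-- Tests on stacks of numbers. -/
inductive Test (K : Type) : Type
  | nonempty (k : K)
  | nonzero (k : K)

/-- Structured programs acting on stacks of numbers. -/
inductive NCmd (K : Type) : Type
  | prim (p : Prim K)
  | seq (a b : NCmd K)
  | ite (t : Test K) (a b : NCmd K)
  | loop (t : Test K) (a : NCmd K)

section
variable {K : Type}

/-- The outcome of a test. -/
def Test.holds : Test K → (K → List ℕ) → Bool
  | nonempty k, S => !(S k).isEmpty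
  | nonzero k, S => (S k).headD 0 != 0

variable [DecidableEq K]

/-- The effect of an operation. -/
inductive Prim.Step : Prim K → (K → List ℕ) → (K → List ℕ) → Prop
  | push (b k S) : Step (push b k) S (Function.update S k (b.toNat :: S k))
  | drop {k S x l} (h : S k = x :: l) : Step (drop k) S (Function.update S k l)
  | move {i j S x l} (h : S i = x :: l) (hij : i ≠ j) :
      Step (move i j) S (Function.update (Function.update S i l) j (x :: S j))
  | copy {i j S x l} (h : S i = x :: l) (hij : i ≠ j) :
      Step (copy i j) S (Function.update S j (x :: S j))
  | add {k S x y l} (h : S k = y :: x :: l) : Step (add k) S (Function.update S k ((x + y) :: l))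
  | sub {k S x y l} (h : S k = y :: x :: l) : Step (sub k) S (Function.update S k ((x - y) :: l))

/-- `c.Exec S S' n`: the program `c` transforms `S` to `S'` with `n` operations and tests. -/
inductive NCmd.Exec : NCmd K → (K → List ℕ) → (K → List ℕ) → ℕ → Prop
  | prim {p S S'} (h : p.Step S S') : Exec (prim p) S S' 1
  | seq {a b S S' S'' n n'} (ha : Exec a S S' n) (hb : Exec b S' S'' n') :
      Exec (seq a b) S S'' (n + n')
  | ite {t a b S S' n} (h : Exec (if t.holds S then a else b) S S' n) :
      Exec (ite t a b) S S' (1 + n)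
  | loop_false {t a S} (ht : t.holds S = false) : Exec (loop t a) S S 1
  | loop_true {t a S S' S'' n n'} (ht : t.holds S = true) (ha : Exec a S S' n)
      (hl : Exec (loop t a) S' S'' n') : Exec (loop t a) S S'' (1 + n + n')

end

open IDM (encodeNumber)

/-- The string for a stack of numbers. -/
def encodeStack (l : List ℕ) : List (Option Bool) := l.flatMap encodeNumber

theorem encodeStack_cons (x : ℕ) (l : List ℕ) :
    encodeStack (x :: l) = x.bits.map some ++ none :: encodeStack l := by
  simp [encodeStack, encodeNumber]

variable {K : Type}

/-- The strings for the stacks of numbers; there are two further stacks for scratch work. -/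
def encodeStacks (S : K → List ℕ) : K ⊕ Bool → List (Option Bool)
  | .inl k => encodeStack (S k)
  | .inr _ => []

theorem encodeStacks_update [DecidableEq K] (S : K → List ℕ) (k : K) (l : List ℕ) :
    encodeStacks (Function.update S k l) =
      Function.update (encodeStacks S) (.inl k) (encodeStack l) := by
  funext j
  cases j with
  | inl j =>
    by_cases h : j = k
    · subst h; simp [encodeStacks]
    · rw [Function.update_of_ne (by simpa using h)]
      simp [encodeStacks, h]
  | inr b => simp [encodeStacks]

open Cmd in
/-- The program on strings for an operation. -/
def Prim.cmd : Prim K → Cmd (K ⊕ Bool) (Option Bool) Reg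
  | push false k => put (.inl k) none
  | push true k => .seq (put (.inl k) none) (put (.inl k) (some true))
  | drop k => discard (.inl k)
  | move i j => moveCmd (.inl i) (.inl j) (.inr false)
  | copy i j => copyCmd (.inl i) (.inl j) (.inr false)
  | add k => addCmd (.inl k) (.inr false) (.inr true)
  | sub k => subCmd (.inl k) (.inr false) (.inr true)

open Cmd in
/-- The program on strings for a test; the outcome is put into the flag. -/
def Test.cmd : Test K → Cmd (K ⊕ Bool) (Option Bool) Reg
  | nonempty k => .seq (popX (.inl k)) (.seq (.ite (fun v => v.1.isSome)
      (.push (.inl k) fun v => v.1.getD none) skip) (.load fun v => (v.1, v.2.1, v.1.isSome)))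
  | nonzero k => .seq (popX (.inl k)) (.seq (.ite (fun v => v.1.isSome)
      (.push (.inl k) fun v => v.1.getD none) skip) (.load fun v => (v.1, v.2.1, isBit v.1)))

/-- The program on strings for a program on numbers. -/
def NCmd.cmd : NCmd K → Cmd (K ⊕ Bool) (Option Bool) Reg
  | prim p => p.cmd
  | seq a b => .seq a.cmd b.cmd
  | ite t a b => .seq t.cmd (.ite (fun v => v.2.2) a.cmd b.cmd)
  | loop t a => .seq t.cmd (.loop (fun v => v.2.2) (.seq a.cmd t.cmd))

/-- All numbers on the stacks have at most `w` digits. -/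
def WidthLE (S : K → List ℕ) (w : ℕ) : Prop :=
  ∀ k, ∀ x ∈ S k, x.size ≤ w

theorem WidthLE.mono {S : K → List ℕ} {w w' : ℕ} (h : WidthLE S w) (hw : w ≤ w') : WidthLE S w' :=
  fun k x hx => (h k x hx).trans hw

theorem WidthLE.update [DecidableEq K] {S : K → List ℕ} {w : ℕ} (h : WidthLE S w) (k : K) (l : List ℕ)
    (hl : ∀ x ∈ l, x.size ≤ w) : WidthLE (Function.update S k l) w := by
  intro j x hx
  by_cases hj : j = k
  · subst hj
    exact hl x (by simpa using hx)
  · exact h j x (by simpa [hj] using hx)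

theorem size_add_le {x y w : ℕ} (hx : x.size ≤ w) (hy : y.size ≤ w) : (x + y).size ≤ w + 1 := by
  rw [Nat.size_le] at *
  rw [pow_succ]
  omega

variable [DecidableEq K]

/-- Addition is the only operation that can exceed the old width, and by one digit at most. This
keeps numbers short in any program with few operations. -/
theorem Prim.Step.widthLE {p : Prim K} {S S' : K → List ℕ} (h : p.Step S S') {w : ℕ}
    (hw : WidthLE S w) : WidthLE S' (w + 1) := by
  have hw' : WidthLE S (w + 1) := hw.mono (Nat.le_succ w)
  cases h with
  | push b k =>
    refine hw'.update _ _ ?_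
    rintro x (_ | ⟨_, hx⟩)
    · cases b <;> simp
    · exact hw' k x hx
  | drop h =>
    exact hw'.update _ _ fun x hx => hw' _ x (by rw [h]; exact List.mem_cons_of_mem _ hx)
  | @move i j _ x l hi hij =>
    refine (hw'.update _ _ fun y hy => hw' i y (by rw [hi]; exact List.mem_cons_of_mem _ hy)).update
      _ _ ?_
    rintro y (_ | ⟨_, hy⟩)
    · exact hw' i x (by simp [hi])
    · exact hw' j y hy
  | @copy i j _ x l hi hij =>
    refine hw'.update _ _ ?_
    rintro y (_ | ⟨_, hy⟩)
    · exact hw' i x (by simp [hi])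
    · exact hw' j y hy
  | @add k _ x y l hk =>
    refine hw'.update _ _ ?_
    rintro z (_ | ⟨_, hz⟩)
    · exact size_add_le (hw k x (by simp [hk])) (hw k y (by simp [hk]))
    · exact hw' k z (by rw [hk]; exact List.mem_cons_of_mem _ (List.mem_cons_of_mem _ hz))
  | @sub k _ x y l hk =>
    refine hw'.update _ _ ?_
    rintro z (_ | ⟨_, hz⟩)
    · exact (Nat.size_le_size (Nat.sub_le x y)).trans (hw' k x (by simp [hk]))
    · exact hw' k z (by rw [hk]; exact List.mem_cons_of_mem _ (List.mem_cons_of_mem _ hz))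

theorem NCmd.Exec.widthLE {c : NCmd K} {S S' : K → List ℕ} {n : ℕ} (h : c.Exec S S' n) {w : ℕ}
    (hw : WidthLE S w) : WidthLE S' (w + n) := by
  induction h generalizing w with
  | prim h => exact h.widthLE hw
  | seq _ _ iha ihb => exact (ihb (iha hw)).mono (by omega)
  | ite _ ih => exact (ih hw).mono (by omega)
  | loop_false _ => exact hw.mono (by omega)
  | loop_true _ _ _ iha ihl => exact (ihl (iha hw)).mono (by omega)

theorem length_bits (x : ℕ) : x.bits.length = x.size := (Nat.size_eq_bits_len x)

/-- In canonical notation only `0` has no digits, so the top symbol alone decides whether a number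
vanishes. -/
theorem isBit_head_encode (l : List ℕ) (x : ℕ) :
    isBit (encodeStack (x :: l)).head? = (x != 0) := by
  rw [encodeStack_cons]
  cases h : x.bits with
  | nil =>
    have : x = 0 := by
      rw [← bitVal_bits x, h, bitVal]
    simp [this, isBit]
  | cons b l =>
    have : x ≠ 0 := by
      rintro rfl
      simp at h
    simp [this, isBit]

theorem Prim.Step.runs {p : Prim K} {S S' : K → List ℕ} (h : p.Step S S') {w : ℕ}
    (hw : WidthLE S w) (v : Reg) :
    ∃ v', p.cmd.Runs (v, encodeStacks S) (v', encodeStacks S') (23 * (w + 1)) := by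
  have hlen : ∀ {k : K} {x : ℕ}, x ∈ S k → x.bits.length ≤ w := fun hx => by
    rw [length_bits]; exact hw _ _ hx
  cases h with
  | push b k =>
    cases b with
    | false =>
      refine ⟨v, Cmd.Runs.mono (b := 1) ?_ (by omega)⟩
      rw [encodeStacks_update, Bool.toNat_false, encodeStack_cons]
      simpa [encodeStacks, Prim.cmd] using Cmd.put_runs (Sum.inl k) none v (encodeStacks S)
    | true =>
      refine ⟨v, Cmd.Runs.mono (b := 1 + 1) ?_ (by omega)⟩
      rw [encodeStacks_update, Bool.toNat_true, encodeStack_cons]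
      simpa [encodeStacks, Prim.cmd] using (Cmd.put_runs (Sum.inl k) none v (encodeStacks S)).seq
        (Cmd.put_runs (Sum.inl k) (some true) v _)
  | @drop k _ x l h =>
    obtain ⟨v', h'⟩ := Cmd.discard_runs (Sum.inl k) x.bits (none :: encodeStack l) rfl v
      (encodeStacks S) (by simp [encodeStacks, h, encodeStack_cons])
    have := hlen (k := k) (x := x) (by simp [h])
    exact ⟨v', by rw [encodeStacks_update]; exact h'.mono (by omega)⟩
  | @move i j _ x l h hij =>
    obtain ⟨v', h'⟩ := Cmd.moveCmd_runs (i := Sum.inl i) (j := Sum.inl j) (t := Sum.inr false)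
      (by simpa using hij) (by simp) (by simp) x (encodeStack l) v (encodeStacks S) rfl
      (by simp [encodeStacks, h, encodeStack_cons])
    have := hlen (k := i) (x := x) (by simp [h])
    refine ⟨v', ?_⟩
    rw [encodeStacks_update, encodeStacks_update, encodeStack_cons]
    exact h'.mono (by omega)
  | @copy i j _ x l h hij =>
    obtain ⟨v', h'⟩ := Cmd.copyCmd_runs (i := Sum.inl i) (j := Sum.inl j) (t := Sum.inr false)
      (by simpa using hij) (by simp) (by simp) x (encodeStack l) v (encodeStacks S) rfl
      (by simp [encodeStacks, h, encodeStack_cons])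
    have := hlen (k := i) (x := x) (by simp [h])
    refine ⟨v', ?_⟩
    rw [encodeStacks_update, encodeStack_cons]
    exact h'.mono (by omega)
  | @add k _ x y l h =>
    obtain ⟨v', h'⟩ := Cmd.addCmd_runs (k := Sum.inl k) (t := Sum.inr false) (t' := Sum.inr true)
      (by simp) (by simp) (by simp) x y w (hlen (k := k) (by simp [h]))
      (hlen (k := k) (by simp [h])) (encodeStack l) v (encodeStacks S) rfl rfl
      (by simp [encodeStacks, h, encodeStack_cons])
    exact ⟨v', by rw [encodeStacks_update, encodeStack_cons]; exact h'⟩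
  | @sub k _ x y l h =>
    obtain ⟨v', h'⟩ := Cmd.subCmd_runs (k := Sum.inl k) (t := Sum.inr false) (t' := Sum.inr true)
      (by simp) (by simp) (by simp) x y w (hlen (k := k) (by simp [h]))
      (hlen (k := k) (by simp [h])) (encodeStack l) v (encodeStacks S) rfl rfl
      (by simp [encodeStacks, h, encodeStack_cons])
    exact ⟨v', by rw [encodeStacks_update, encodeStack_cons]; exact h'⟩

/-- A test must not change the stacks, so the popped symbol is pushed back, unless the stack was
empty. -/
theorem peek_runs {J : Type} [DecidableEq J] (k : J) (g : Option (Option Bool) → Bool) (v : Reg)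
    (S : J → List (Option Bool)) :
    (Cmd.seq (Cmd.popX k) (.seq (.ite (fun v : Reg => v.1.isSome)
      (.push k fun v => v.1.getD none) Cmd.skip) (.load fun v => (v.1, v.2.1, g v.1)))).Runs
      (v, S) (((S k).head?, v.2.1, g (S k).head?), S) 4 := by
  refine ((Cmd.popX_runs k v S).seq (Cmd.Runs.seq (b := 2) (b' := 1)
    (s' := (((S k).head?, v.2), S)) (Cmd.Runs.ite (b := 1) ?_) (Cmd.Exec.load _ _ _).runs))
  cases h : S k with
  | nil =>
    have : S = Function.update S k [].tail := by
      rw [List.tail_nil, ← h, Function.update_eq_self]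
    convert (Cmd.skip_runs (J := J) _ _) using 2
    simp
  | cons a l =>
    have : S = Function.update S k (a :: l) := by rw [← h, Function.update_eq_self]
    simp only [List.head?_cons, Option.isSome_some, if_true, List.tail_cons]
    have hp := (Cmd.Exec.push (σ := Reg) k (fun v => v.1.getD none) (some a, v.2)
      (Function.update S k l)).runs
    simpa [h, ← this] using hp

theorem Test.runs (t : Test K) (S : K → List ℕ) (v : Reg) :
    ∃ v', v'.2.2 = t.holds S ∧ t.cmd.Runs (v, encodeStacks S) (v', encodeStacks S) 4 := by
  cases t with
  | nonempty k =>
    refine ⟨_, ?_, peek_runs (Sum.inl k) (fun s => s.isSome) v _⟩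
    simp only [holds, encodeStacks]
    cases S k with
    | nil => simp [encodeStack]
    | cons x l =>
      rw [encodeStack_cons]
      cases x.bits <;> simp
  | nonzero k =>
    refine ⟨_, ?_, peek_runs (Sum.inl k) isBit v _⟩
    simp only [holds, encodeStacks]
    cases S k with
    | nil => simp [encodeStack, isBit]
    | cons x l => simp [isBit_head_encode]

/-- A program on numbers is simulated with an overhead that is linear in the number of digits. -/
theorem NCmd.Exec.runs {c : NCmd K} {S S' : K → List ℕ} {n : ℕ} (h : c.Exec S S' n) {w b : ℕ}
    (hw : WidthLE S w) (hb : w + n ≤ b) (v : Reg) :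
    ∃ v', c.cmd.Runs (v, encodeStacks S) (v', encodeStacks S') (23 * (n * (b + 1))) := by
  -- A compiled loop tests once before the string-level loop and again at the end of each pass. The
  -- second conjunct treats the string-level loop entered with the flag already set; the `4` steps
  -- of that test are deducted from its bound.
  have key : ∀ {c : NCmd K} {S S' : K → List ℕ} {n : ℕ}, c.Exec S S' n →
      ∀ {w : ℕ}, WidthLE S w → w + n ≤ b → ∀ v,
      (∃ v', c.cmd.Runs (v, encodeStacks S) (v', encodeStacks S') (23 * (n * (b + 1)))) ∧
      (∀ t a, c = NCmd.loop t a → v.2.2 = t.holds S → ∃ v',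
        (Cmd.loop (fun v : Reg => v.2.2) (.seq a.cmd t.cmd)).Runs (v, encodeStacks S)
          (v', encodeStacks S') (23 * (n * (b + 1)) - 4)) := by
    clear hb hw h v w c S S' n
    intro c S S' n h
    induction h with
    | prim h =>
      intro w hw hb v
      refine ⟨?_, by simp⟩
      obtain ⟨v', h'⟩ := h.runs hw v
      exact ⟨v', h'.mono (by nlinarith)⟩
    | @seq a c S S' S'' n n' ha hb iha ihb =>
      intro w hw hb' v
      refine ⟨?_, by simp⟩
      obtain ⟨v1, h1⟩ := (iha hw (by omega) v).1
      obtain ⟨v2, h2⟩ := (ihb (ha.widthLE hw) (by omega) v1).1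
      exact ⟨v2, (h1.seq h2).mono (by rw [Nat.add_mul]; omega)⟩
    | @ite t a c S S' n h ih =>
      intro w hw hb' v
      refine ⟨?_, by simp⟩
      obtain ⟨v1, hv1, h1⟩ := t.runs S v
      obtain ⟨v2, h2⟩ := (ih hw (by omega) v1).1
      refine ⟨v2, (h1.seq (Cmd.Runs.ite (b := 23 * (n * (b + 1))) ?_)).mono
        (by rw [Nat.add_mul]; omega)⟩
      simp only [hv1]
      cases ht : t.holds S <;> simpa [ht] using h2
    | @loop_false t a S ht =>
      intro w hw hb' v
      refine ⟨?_, ?_⟩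
      · obtain ⟨v1, hv1, h1⟩ := t.runs S v
        exact ⟨v1, (h1.seq (Cmd.Exec.loop_false (by simp [hv1, ht])).runs).mono (by omega)⟩
      · rintro _ _ ⟨⟩ hv
        exact ⟨v, (Cmd.Exec.loop_false (by simp [hv, ht])).runs.mono (by omega)⟩
    | @loop_true t a S S' S'' n n' ht ha hl iha ihl =>
      intro w hw hb' v
      have e : (1 + n + n') * (b + 1) = (b + 1) + n * (b + 1) + n' * (b + 1) := by ring
      have main : ∀ v : Reg, v.2.2 = t.holds S → ∃ v',
        (Cmd.loop (fun v : Reg => v.2.2) (.seq a.cmd t.cmd)).Runs (v, encodeStacks S)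
          (v', encodeStacks S'') (23 * ((1 + n + n') * (b + 1)) - 4) := by
        intro v hv
        obtain ⟨v1, h1⟩ := (iha hw (by omega) v).1
        obtain ⟨v2, hv2, h2⟩ := t.runs S' v1
        obtain ⟨v3, h3⟩ := (ihl (ha.widthLE hw) (by omega) v2).2 t a rfl hv2
        exact ⟨v3, (Cmd.Runs.loop_true (by simp [hv, ht]) (h1.seq h2) h3).mono (by omega)⟩
      refine ⟨?_, ?_⟩
      · obtain ⟨v1, hv1, h1⟩ := t.runs S v
        obtain ⟨v2, h2⟩ := main v1 hv1
        exact ⟨v2, (h1.seq h2).mono (by omega)⟩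
      · rintro _ _ ⟨⟩ hv
        exact main v hv
  exact (key h hw hb v).1

end StackProgram

/-! ### Expressions and programs over a memory, executed on stacks of numbers -/

namespace StackProgram
open Polynomial

namespace NCmd
variable {K : Type} [DecidableEq K]

/-- The program transforms `S` to `S'` with at most `b` operations and tests. -/
def Runs (c : NCmd K) (S S' : K → List ℕ) (b : ℕ) : Prop :=
  ∃ n ≤ b, c.Exec S S' n

theorem Runs.mono {c : NCmd K} {S S' : K → List ℕ} {b b' : ℕ} (h : c.Runs S S' b)
    (hb : b ≤ b') : c.Runs S S' b' :=
  let ⟨n, hn, h⟩ := h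
  ⟨n, hn.trans hb, h⟩

theorem Runs.congr {c : NCmd K} {S S' S'' : K → List ℕ} {b : ℕ} (h : c.Runs S S' b)
    (hS : S' = S'') : c.Runs S S'' b :=
  hS ▸ h

theorem Runs.seq {c d : NCmd K} {S S' S'' : K → List ℕ} {b b' : ℕ} (h : c.Runs S S' b)
    (h' : d.Runs S' S'' b') : (c.seq d).Runs S S'' (b + b') :=
  let ⟨_, hn, h⟩ := h
  let ⟨_, hn', h'⟩ := h'
  ⟨_, add_le_add hn hn', .seq h h'⟩

theorem Runs.ite {t : Test K} {c d : NCmd K} {S S' : K → List ℕ} {b : ℕ}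
    (h : (if t.holds S then c else d).Runs S S' b) : (NCmd.ite t c d).Runs S S' (1 + b) :=
  let ⟨_, hn, h⟩ := h
  ⟨_, by omega, .ite h⟩

theorem Runs.loop_false {t : Test K} {c : NCmd K} {S : K → List ℕ} (ht : t.holds S = false) :
    (NCmd.loop t c).Runs S S 1 :=
  ⟨1, le_rfl, .loop_false ht⟩

theorem Runs.loop_true {t : Test K} {c : NCmd K} {S S' S'' : K → List ℕ} {b b' : ℕ}
    (ht : t.holds S = true) (h : c.Runs S S' b) (h' : (NCmd.loop t c).Runs S' S'' b') :
    (NCmd.loop t c).Runs S S'' (1 + b + b') :=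
  let ⟨_, hn, h⟩ := h
  let ⟨_, hn', h'⟩ := h'
  ⟨_, by omega, .loop_true ht h h'⟩

theorem push_runs (b : Bool) (k : K) (S : K → List ℕ) :
    (prim (.push b k)).Runs S (Function.update S k (b.toNat :: S k)) 1 :=
  ⟨1, le_rfl, .prim (.push b k S)⟩

theorem drop_runs {k : K} {S : K → List ℕ} (h : S k ≠ []) :
    (prim (.drop k)).Runs S (Function.update S k (S k).tail) 1 := by
  obtain ⟨x, l, hx⟩ := List.exists_cons_of_ne_nil h
  exact ⟨1, le_rfl, by simpa [hx] using NCmd.Exec.prim (.drop hx)⟩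

theorem move_runs {i j : K} {S : K → List ℕ} (h : S i ≠ []) (hij : i ≠ j) :
    (prim (.move i j)).Runs S
      (Function.update (Function.update S i (S i).tail) j ((S i).headD 0 :: S j)) 1 := by
  obtain ⟨x, l, hx⟩ := List.exists_cons_of_ne_nil h
  exact ⟨1, le_rfl, by simpa [hx] using NCmd.Exec.prim (.move hx hij)⟩

theorem copy_runs {i j : K} {S : K → List ℕ} (h : S i ≠ []) (hij : i ≠ j) :
    (prim (.copy i j)).Runs S (Function.update S j ((S i).headD 0 :: S j)) 1 := by
  obtain ⟨x, l, hx⟩ := List.exists_cons_of_ne_nil h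
  exact ⟨1, le_rfl, by simpa [hx] using NCmd.Exec.prim (.copy hx hij)⟩

theorem add_runs {k : K} {S : K → List ℕ} {x y : ℕ} {l : List ℕ} (h : S k = y :: x :: l) :
    (prim (.add k)).Runs S (Function.update S k ((x + y) :: l)) 1 :=
  ⟨1, le_rfl, .prim (.add h)⟩

theorem sub_runs {k : K} {S : K → List ℕ} {x y : ℕ} {l : List ℕ} (h : S k = y :: x :: l) :
    (prim (.sub k)).Runs S (Function.update S k ((x - y) :: l)) 1 :=
  ⟨1, le_rfl, .prim (.sub h)⟩

/-- Puts the distance between the numbers on top of `a` and of `b` on `d`. -/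
def distance (a b d : K) : NCmd K :=
  .seq (prim (.copy a d)) <| .seq (prim (.copy b d)) <| .seq (prim (.sub d)) <|
  .seq (prim (.copy b d)) <| .seq (prim (.copy a d)) <| .seq (prim (.sub d)) (prim (.add d))

/-- With truncated subtraction one of the two differences is `0`, so their sum vanishes exactly if
the numbers agree; this reduces equality to a zero test. -/
theorem distance_runs {a b d : K} (had : a ≠ d) (hbd : b ≠ d) {S : K → List ℕ} {x y : ℕ}
    {l l' : List ℕ} (ha : S a = x :: l) (hb : S b = y :: l') :
    (distance a b d).Runs S (Function.update S d ((x - y + (y - x)) :: S d)) 7 := by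
  refine ((copy_runs (by simp [ha]) had).seq ((copy_runs (by simp [hb, hbd]) hbd).seq
    ((sub_runs (x := x) (y := y) (l := S d) (by simp [ha, hb, hbd])).seq
    ((copy_runs (by simp [hb, hbd]) hbd).seq ((copy_runs (by simp [ha, had]) had).seq
    ((sub_runs (x := y) (y := x) (l := (x - y) :: S d) (by simp [ha, hb, had, hbd])).seq
    (add_runs (x := x - y) (y := y - x) (l := S d) (by simp)))))))).congr ?_
  simp

/-- Removes all numbers from a stack. -/
def clear (k : K) : NCmd K := .loop (.nonempty k) (prim (.drop k))

theorem clear_runs (k : K) (S : K → List ℕ) :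
    (clear k).Runs S (Function.update S k []) (2 * (S k).length + 1) := by
  induction h : S k generalizing S with
  | nil =>
    refine (Runs.loop_false (by simp [Test.holds, h])).congr ?_
    rw [← h, Function.update_eq_self]
  | cons x l ih =>
    refine (Runs.loop_true (by simp [Test.holds, h]) (drop_runs (by simp [h]))
      ((ih _ (by simp [h])).congr (by simp))).mono ?_
    simp
    omega

/-- Moves all numbers from a stack to another one. -/
def moveAll (i j : K) : NCmd K := .loop (.nonempty i) (prim (.move i j))

theorem moveAll_runs {i j : K} (hij : i ≠ j) (S : K → List ℕ) :
    (moveAll i j).Runs S (Function.update (Function.update S i []) j ((S i).reverse ++ S j))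
      (2 * (S i).length + 1) := by
  induction h : S i generalizing S with
  | nil =>
    refine (Runs.loop_false (by simp [Test.holds, h])).congr ?_
    rw [← h, Function.update_eq_self, h]
    simp
  | cons x l ih =>
    refine (Runs.loop_true (by simp [Test.holds, h]) (move_runs (by simp [h]) hij)
      ((ih _ (by simp [h, hij])).congr (S'' := Function.update (Function.update S i []) j
        ((x :: l).reverse ++ S j)) ?_)).mono ?_
    · funext k
      by_cases hk : k = j
      · subst hk; simp [h]
      · by_cases hk' : k = i
        · subst hk'; simp [hk]
        · simp [hk, hk']
    · simp
      omega

end NCmd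

/-- The stacks of the machine that evaluates expressions over a memory: the input, operands,
the memory, a second stack for the memory, loop counters, the loop length, distances, the name and
the index that are looked up, and the values of the variables. -/
inductive Loc (V : Type) : Type
  | inp | opd | mem | aux | ctr | len | dif | nam | idx
  | var (x : V)
  deriving DecidableEq, Fintype

/-- Expressions with variables in `V` over a memory that is addressed by a name and an index. -/
inductive Expr (V : Type) : Type
  | zero
  | one
  | var (x : V)
  | mem (a b : Expr V)
  | add (a b : Expr V)
  | sub (a b : Expr V)
  | ifz (e a b : Expr V)
  | sum (x : V) (e : Expr V)
  | sup (x : V) (e : Expr V)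

/-- Programs that write to the memory. -/
inductive Stm (V : Type) : Type
  | assign (a b e : Expr V)
  | seq (s t : Stm V)
  | forAll (x : V) (s : Stm V)

/-- The memory, as a list of entries (name, index, value) with the latest one first. -/
abbrev Mem : Type := List (ℕ × ℕ × ℕ)

/-- The value at an address; it is `0` if nothing has been written there. -/
def Mem.get : Mem → ℕ → ℕ → ℕ
  | [], _, _ => 0
  | (n, i, v) :: r, n', i' => if n = n' ∧ i = i' then v else Mem.get r n' i'

variable {V : Type} [DecidableEq V]

/-- The value of an expression; sums and suprema are over the numbers below `L`. -/
def Expr.eval (L : ℕ) (r : Mem) : (V → ℕ) → Expr V → ℕ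
  | _, zero => 0
  | _, one => 1
  | ρ, var x => ρ x
  | ρ, mem a b => r.get (a.eval L r ρ) (b.eval L r ρ)
  | ρ, add a b => a.eval L r ρ + b.eval L r ρ
  | ρ, sub a b => a.eval L r ρ - b.eval L r ρ
  | ρ, ifz e a b => if e.eval L r ρ = 0 then a.eval L r ρ else b.eval L r ρ
  | ρ, sum x e => ∑ i ∈ Finset.range L, e.eval L r (Function.update ρ x i)
  | ρ, sup x e => (Finset.range L).sup fun i => e.eval L r (Function.update ρ x i)

/-- The memory after a program has run; loops are over the numbers below `L`. -/
def Stm.run (L : ℕ) : (V → ℕ) → Stm V → Mem → Mem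
  | ρ, assign a b e, r => (a.eval L r ρ, b.eval L r ρ, e.eval L r ρ) :: r
  | ρ, seq s t, r => t.run L ρ (s.run L ρ r)
  | ρ, .forAll x s, r => Nat.rec r (fun i r => s.run L (Function.update ρ x i) r) L

open NCmd

/-- Looks up the name and the index on top of the operands. -/
def lookupCmd : NCmd (Loc V) :=
  .seq (prim (.move .opd .idx)) <| .seq (prim (.move .opd .nam)) <|
  .seq (prim (.push false .opd)) <| .seq (moveAll .mem .aux) <|
  .seq (.loop (.nonempty .aux)
    (.seq (distance .aux .idx .dif) <| .seq (prim (.move .aux .mem)) <|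
     .seq (distance .aux .nam .dif) <| .seq (prim (.add .dif)) <| .seq (prim (.move .aux .mem)) <|
     .seq (.ite (.nonzero .dif) (prim (.drop .dif))
       (.seq (prim (.drop .dif)) (.seq (prim (.drop .opd)) (prim (.copy .aux .opd)))))
     (prim (.move .aux .mem)))) <|
  .seq (prim (.drop .idx)) (prim (.drop .nam))

/-- Runs `c` for all values of `x` below the loop length. -/
def forCmd (x : V) (c : NCmd (Loc V)) : NCmd (Loc V) :=
  .seq (prim (.copy .len .ctr)) <| .seq (prim (.push false (.var x))) <|
  .seq (.loop (.nonzero .ctr)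
    (.seq (prim (.push true .ctr)) <| .seq (prim (.sub .ctr)) <| .seq c <|
     .seq (prim (.push true (.var x))) (prim (.add (.var x))))) <|
  .seq (prim (.drop (.var x))) (prim (.drop .ctr))

/-- Replaces the two numbers on top of the operands by their maximum. -/
def maxCmd : NCmd (Loc V) :=
  .seq (prim (.move .opd .dif)) <| .seq (prim (.copy .opd .dif)) <| .seq (prim (.sub .dif)) <|
  .seq (prim (.move .dif .opd)) (prim (.add .opd))

/-- Puts the value of an expression on the operands. -/
def Expr.cmd : Expr V → NCmd (Loc V)
  | zero => prim (.push false .opd)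
  | one => prim (.push true .opd)
  | var x => .ite (.nonempty (.var x)) (prim (.copy (.var x) .opd)) (prim (.push false .opd))
  | mem a b => .seq a.cmd (.seq b.cmd lookupCmd)
  | add a b => .seq a.cmd (.seq b.cmd (prim (.add .opd)))
  | sub a b => .seq a.cmd (.seq b.cmd (prim (.sub .opd)))
  | ifz e a b => .seq e.cmd (.ite (.nonzero .opd) (.seq (prim (.drop .opd)) b.cmd)
      (.seq (prim (.drop .opd)) a.cmd))
  | sum x e => .seq (prim (.push false .opd)) (forCmd x (.seq e.cmd (prim (.add .opd))))
  | sup x e => .seq (prim (.push false .opd)) (forCmd x (.seq e.cmd maxCmd))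

/-- Runs a program on the memory. -/
def Stm.cmd : Stm V → NCmd (Loc V)
  | assign a b e => .seq e.cmd <| .seq a.cmd <| .seq b.cmd <| .seq (prim (.move .opd .mem)) <|
      .seq (prim (.move .opd .mem)) (prim (.move .opd .mem))
  | seq s t => .seq s.cmd t.cmd
  | .forAll x s => forCmd x s.cmd

/-- The memory as a stack of numbers. -/
def Mem.toStack (r : Mem) : List ℕ := r.flatMap fun p => [p.2.2, p.1, p.2.1]

/-- The values of the variables. -/
def vals (S : Loc V → List ℕ) (x : V) : ℕ := (S (.var x)).headD 0

/-- The stacks represent the memory `r` and the loop length `L`. -/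
structure Represents (S : Loc V → List ℕ) (r : Mem) (L : ℕ) : Prop where
  mem : S .mem = r.toStack
  aux : S .aux = []
  len : S .len = [L]

theorem length_toStack (r : Mem) : r.toStack.length = 3 * r.length := by
  induction r with
  | nil => rfl
  | cons p r ih => simp_all [Mem.toStack]; omega

/-- The reversed memory shows an entry as index, name, value. The two distances are added on `dif`,
so a single zero test decides whether name and index both match. -/
theorem lookup_step_runs (S : Loc V → List ℕ) (n i v n' i' : ℕ) (la ln li lo : List ℕ) (o : ℕ)
    (haux : S .aux = i :: n :: v :: la) (hn : S .nam = n' :: ln) (hi : S .idx = i' :: li)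
    (ho : S .opd = o :: lo) :
    (.seq (distance .aux .idx .dif) <| .seq (prim (.move .aux .mem)) <|
     .seq (distance .aux .nam .dif) <| .seq (prim (.add .dif)) <| .seq (prim (.move .aux .mem)) <|
     .seq (.ite (.nonzero .dif) (prim (.drop .dif))
       (.seq (prim (.drop .dif)) (.seq (prim (.drop .opd)) (prim (.copy .aux .opd)))))
     (prim (.move .aux .mem)) : NCmd (Loc V)).Runs S
     (Function.update (Function.update (Function.update S .aux la) .mem (v :: n :: i :: S .mem))
       .opd ((if n = n' ∧ i = i' then v else o) :: lo)) 22 := by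
  refine Runs.mono ((distance_runs (by simp) (by simp) haux hi).seq
    ((move_runs (by simp [haux]) (by simp)).seq
    ((distance_runs (x := n) (y := n') (l := v :: la) (l' := ln) (by simp) (by simp)
      (by simp [haux]) (by simp [hn])).seq
    ((add_runs (x := (i - i') + (i' - i)) (y := (n - n') + (n' - n)) (l := S .dif) (by simp)).seq
    ((move_runs (by simp [haux]) (by simp)).seq
    ((Runs.ite (b := 3) (S' := Function.update (Function.update (Function.update S .aux
      (v :: la)) .mem (n :: i :: S .mem)) .opd ((if n = n' ∧ i = i' then v else o) :: lo)) ?_).seq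
    ((move_runs (by simp) (by simp)).congr ?_))))))) (by omega)
  · simp only [Test.holds]
    by_cases h : n = n' ∧ i = i'
    · obtain ⟨rfl, rfl⟩ := h
      simp only [ne_eq, reduceCtorEq, not_false_eq_true, Function.update_of_ne,
        Function.update_self, List.headD_cons, and_self, if_true, Nat.sub_self, Nat.add_zero,
        bne_self_eq_false, Bool.false_eq_true, if_false]
      refine ((drop_runs (by simp)).seq ((drop_runs (by simp [ho])).seq
        ((copy_runs (by simp [haux]) (by simp)).congr ?_)))
      funext k
      cases k <;> simp [haux, ho]
    · have : (i - i') + (i' - i) + ((n - n') + (n' - n)) ≠ 0 := by omega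
      simp only [ne_eq, reduceCtorEq, not_false_eq_true, Function.update_of_ne,
        Function.update_self, List.headD_cons, bne_iff_ne, this, if_true, h, if_false]
      refine ((drop_runs (by simp)).congr ?_).mono (by omega)
      funext k
      cases k <;> simp [haux, ho]
  · funext k
    cases k <;> simp

/-- The top of `aux` is the oldest entry still to be inspected. Entries return to `mem` from old to
new and each match overwrites the answer, so the latest write wins, as in `Mem.get`. Hence the
induction takes entries off the end of `r`. -/
theorem lookup_loop_runs (r : Mem) (S : Loc V → List ℕ) (r' : Mem) (n' i' : ℕ)
    (ln li lo : List ℕ) (haux : S .aux = r.toStack.reverse) (hmem : S .mem = r'.toStack)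
    (hn : S .nam = n' :: ln) (hi : S .idx = i' :: li) (ho : S .opd = r'.get n' i' :: lo) :
    (.loop (.nonempty .aux) (.seq (distance .aux .idx .dif) <| .seq (prim (.move .aux .mem)) <|
     .seq (distance .aux .nam .dif) <| .seq (prim (.add .dif)) <| .seq (prim (.move .aux .mem)) <|
     .seq (.ite (.nonzero .dif) (prim (.drop .dif))
       (.seq (prim (.drop .dif)) (.seq (prim (.drop .opd)) (prim (.copy .aux .opd)))))
     (prim (.move .aux .mem))) : NCmd (Loc V)).Runs S
     (Function.update (Function.update (Function.update S .aux []) .mem (r ++ r').toStack)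
       .opd ((r ++ r').get n' i' :: lo)) (23 * r.length + 1) := by
  induction r using List.reverseRecOn generalizing S r' with
  | nil =>
    refine (Runs.loop_false ?_).congr ?_
    · simp [Test.holds, haux, Mem.toStack]
    · funext k
      cases k <;> simp_all [Mem.toStack]
  | append_singleton r p ih =>
    obtain ⟨n, i, v⟩ := p
    have haux' : S .aux = i :: n :: v :: (Mem.toStack r).reverse := by
      simp [haux, Mem.toStack]
    have h1 := lookup_step_runs S n i v n' i' _ ln li lo _ haux' hn hi ho
    refine (Runs.loop_true (by simp [Test.holds, haux']) h1 ((ih _ ((n, i, v) :: r') (by simp)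
      ?_ (by simp [hn]) (by simp [hi]) (by simp [Mem.get])).congr ?_)).mono ?_
    · simp [Mem.toStack, hmem]
    · funext k
      cases k <;> simp [List.append_assoc]
    · simp
      omega

theorem lookupCmd_runs {S : Loc V → List ℕ} {r : Mem} {L : ℕ} (h : Represents S r L) (n i : ℕ)
    (lo : List ℕ) (ho : S .opd = i :: n :: lo) :
    lookupCmd.Runs S (Function.update S .opd (r.get n i :: lo)) (29 * (r.length + 1)) := by
  have h1 : Runs (.seq (prim (.move .opd .idx)) <| .seq (prim (.move .opd .nam)) <|
      .seq (prim (.push false .opd)) (moveAll .mem .aux)) S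
      (Function.update (Function.update (Function.update (Function.update (Function.update S
        .idx (i :: S .idx)) .nam (n :: S .nam)) .opd (0 :: lo)) .mem []) .aux r.toStack.reverse)
      (3 + (6 * r.length + 1)) := by
    refine ((move_runs (by simp [ho]) (by simp)).seq ((move_runs (by simp [ho]) (by simp)).seq
      ((push_runs _ _ _).seq ((moveAll_runs (by simp) _).congr ?_)))).mono ?_
    · funext k
      cases k <;> simp [ho, h.mem, h.aux]
    · simp [h.mem, length_toStack]
      omega
  have h2 := lookup_loop_runs r (Function.update (Function.update (Function.update
    (Function.update (Function.update S
        .idx (i :: S .idx)) .nam (n :: S .nam)) .opd (0 :: lo)) .mem []) .aux r.toStack.reverse)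
    [] n i (S .nam) (S .idx) lo (by simp) (by simp [Mem.toStack]) (by simp) (by simp)
    (by simp [Mem.get])
  -- The sequence is nested to the right, so the run of its first four commands is taken apart and
  -- recombined with the rest.
  obtain ⟨m1, hm1, e1⟩ := h1
  cases e1 with
  | seq ea eb =>
  cases eb with
  | seq eb ec =>
  cases ec with
  | seq ec ed =>
  refine (Runs.seq ⟨_, le_rfl, ea⟩ (Runs.seq ⟨_, le_rfl, eb⟩ (Runs.seq ⟨_, le_rfl, ec⟩
    (Runs.seq ⟨_, le_rfl, ed⟩ (h2.seq ((drop_runs (by simp)).seq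
      ((drop_runs (by simp)).congr ?_))))))).mono ?_
  · funext k
    cases k <;> simp [h.mem, h.aux]
  · omega

end StackProgram

namespace StackProgram
open Polynomial NCmd
variable {V : Type} [DecidableEq V]

/-- `T i` is the state before pass `i` with the loop's own counter and variable hidden. Both are
kept on top of stacks whose lower parts `lc` and `lx` belong to enclosing loops; this is why loops
may be nested. The counter runs down while the variable runs up. -/
theorem forCmd_runs (x : V) (c : NCmd (Loc V)) (T : ℕ → Loc V → List ℕ) (L b : ℕ)
    {l lc lx : List ℕ} (hlen : T 0 .len = L :: l) (hctr : ∀ i, T i .ctr = lc)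
    (hvar : ∀ i, T i (.var x) = lx)
    (h : ∀ i < L, ∀ m,
      c.Runs (Function.update (Function.update (T i) .ctr (m :: lc)) (.var x) (i :: lx))
        (Function.update (Function.update (T (i + 1)) .ctr (m :: lc)) (.var x) (i :: lx)) b) :
    (forCmd x c).Runs (T 0) (T L) (L * (b + 5) + 5) := by
  have key : ∀ m i, i + m = L → (NCmd.loop (.nonzero .ctr)
      (.seq (prim (.push true .ctr)) <| .seq (prim (.sub .ctr)) <| .seq c <|
       .seq (prim (.push true (.var x))) (prim (.add (.var x)))) : NCmd (Loc V)).Runs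
      (Function.update (Function.update (T i) .ctr (m :: lc)) (.var x) (i :: lx))
      (Function.update (Function.update (T L) .ctr (0 :: lc)) (.var x) (L :: lx))
      (m * (b + 5) + 1) := by
    intro m
    induction m with
    | zero =>
      rintro i rfl
      exact (Runs.loop_false (by simp [Test.holds])).mono (by omega)
    | succ m ih =>
      intro i hi
      refine (Runs.loop_true (by simp [Test.holds]) ((push_runs _ _ _).seq
        (((sub_runs (x := m + 1) (y := 1) (l := lc) (by simp)).congr ?_).seq
        ((h i (by omega) m).seq ((push_runs _ _ _).seq
        ((add_runs (x := i) (y := 1) (l := lx) (by simp)).congr ?_)))))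
        (ih (i + 1) (by omega))).mono (by rw [Nat.add_mul]; omega)
      · funext k
        by_cases hk : k = .ctr
        · subst hk; simp
        · by_cases hk' : k = .var x
          · subst hk'; simp
          · simp [hk, hk']
      · funext k
        by_cases hk : k = .ctr
        · subst hk; simp
        · by_cases hk' : k = .var x
          · subst hk'; simp
          · simp [hk, hk']
  refine ((copy_runs (by simp [hlen]) (by simp)).seq (((push_runs _ _ _).congr ?_).seq
    ((key L 0 (by omega)).seq ((drop_runs (by simp)).seq
    ((drop_runs (by simp)).congr ?_))))).mono (by omega)
  · simp [hlen, hctr, hvar]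
  · funext k
    by_cases hk : k = .ctr
    · subst hk; simp [hctr]
    · by_cases hk' : k = .var x
      · subst hk'; simp [hvar]
      · simp [hk, hk']

theorem maxCmd_runs {S : Loc V → List ℕ} {a v : ℕ} {l : List ℕ} (h : S .opd = v :: a :: l) :
    maxCmd.Runs S (Function.update S .opd (max a v :: l)) 5 := by
  refine ((move_runs (by simp [h]) (by simp)).seq ((copy_runs (by simp [h]) (by simp)).seq
    ((sub_runs (x := v) (y := a) (l := S .dif) (by simp [h])).seq
    ((move_runs (by simp) (by simp)).seq
    ((add_runs (x := a) (y := v - a) (l := l) (by simp [h])).congr ?_))))).mono (by omega)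
  have : a + (v - a) = max a v := by omega
  funext k
  cases k <;> simp [this]

/-- A bound on the number of operations for an expression, in terms of a bound on the loop length
and on the number of memory entries. -/
noncomputable def Expr.cost : Expr V → ℕ[X]
  | zero => 1
  | one => 1
  | var _ => 2
  | mem a b => a.cost + b.cost + 29 * (X + 1)
  | add a b => a.cost + b.cost + 1
  | sub a b => a.cost + b.cost + 1
  | ifz e a b => e.cost + a.cost + b.cost + 2
  | sum _ e => X * (e.cost + 10) + 6
  | sup _ e => X * (e.cost + 10) + 6

theorem Represents.update_opd {S : Loc V → List ℕ} {r : Mem} {L : ℕ} (h : Represents S r L)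
    (l : List ℕ) : Represents (Function.update S .opd l) r L :=
  ⟨by simp [h.mem], by simp [h.aux], by simp [h.len]⟩

theorem vals_update_opd (S : Loc V → List ℕ) (l : List ℕ) :
    vals (Function.update S .opd l) = vals S := by
  funext x
  simp [vals]

/-- A lookup scans the whole memory and a sum or supremum makes `L` passes; with `z` bounding memory
length and `L`, the cost is a fixed polynomial in `z` for each expression. Evaluation changes only
the operands, so the bounds remain valid throughout. -/
theorem Expr.cmd_runs (e : Expr V) {S : Loc V → List ℕ} {r : Mem} {L z : ℕ}
    (h : Represents S r L) (hL : L ≤ z) (hr : r.length ≤ z) :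
    e.cmd.Runs S (Function.update S .opd (e.eval L r (vals S) :: S .opd)) (e.cost.eval z) := by
  induction e generalizing S with
  | zero =>
    simpa [cost, Expr.eval, Expr.cmd] using push_runs false .opd S
  | one =>
    simpa [cost, Expr.eval, Expr.cmd] using push_runs true .opd S
  | var x =>
    have : (cost (var x)).eval z = 1 + 1 := by simp [cost]
    rw [this]
    refine Runs.ite ?_
    cases hx : S (.var x) with
    | nil =>
      simp only [Test.holds, hx, List.isEmpty_nil, Bool.not_true, Bool.false_eq_true, if_false]
      simpa [eval, vals, hx] using push_runs false .opd S
    | cons v l =>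
      simp only [Test.holds, hx, List.isEmpty_cons, Bool.not_false, if_true]
      exact copy_runs (by simp [hx]) (by simp)
  | mem a b iha ihb =>
    have h1 := iha h
    have h2 := ihb (h.update_opd (a.eval L r (vals S) :: S .opd))
    rw [vals_update_opd] at h2
    have h3 := lookupCmd_runs ((h.update_opd (a.eval L r (vals S) :: S .opd)).update_opd
      (b.eval L r (vals S) :: a.eval L r (vals S) :: S .opd)) (a.eval L r (vals S))
      (b.eval L r (vals S)) (S .opd) (by simp)
    refine ((h1.seq ((h2.congr ?_).seq h3)).congr ?_).mono ?_
    · simp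
    · simp [eval]
    · simp [cost]
      omega
  | add a b iha ihb =>
    have h1 := iha h
    have h2 := ihb (h.update_opd (a.eval L r (vals S) :: S .opd))
    rw [vals_update_opd] at h2
    refine ((h1.seq (h2.seq (add_runs (x := a.eval L r (vals S)) (y := b.eval L r (vals S))
      (l := S .opd) (by simp)))).congr ?_).mono ?_
    · simp [eval]
    · simp [cost]
      omega
  | sub a b iha ihb =>
    have h1 := iha h
    have h2 := ihb (h.update_opd (a.eval L r (vals S) :: S .opd))
    rw [vals_update_opd] at h2
    refine ((h1.seq (h2.seq (sub_runs (x := a.eval L r (vals S)) (y := b.eval L r (vals S))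
      (l := S .opd) (by simp)))).congr ?_).mono ?_
    · simp [eval]
    · simp [cost]
      omega
  | ifz e a b ihe iha ihb =>
    have h1 := ihe h
    have ha := iha h
    have hb := ihb h
    by_cases he : e.eval L r (vals S) = 0
    · refine ((h1.seq (Runs.ite (b := 1 + a.cost.eval z) ?_)).congr (S'' := _) rfl).mono ?_
      · simp only [Test.holds, Function.update_self, List.headD_cons, he, bne_self_eq_false,
          Bool.false_eq_true, if_false]
        refine ((drop_runs (by simp)).congr ?_).seq (ha.congr ?_)
        · simp
        · simp [eval, he]
      · simp [cost]
        omega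
    · refine ((h1.seq (Runs.ite (b := 1 + b.cost.eval z) ?_)).congr (S'' := _) rfl).mono ?_
      · simp only [Test.holds, Function.update_self, List.headD_cons, bne_iff_ne, ne_eq, he,
          not_false_eq_true, if_true]
        refine ((drop_runs (by simp)).congr ?_).seq (hb.congr ?_)
        · simp
        · simp [eval, he]
      · simp [cost]
        omega
  | sum x e ih =>
    -- Between passes the partial sum is the top operand, and the next term is computed above it.
    have h1 := forCmd_runs x (.seq e.cmd (prim (.add .opd)))
      (fun i => Function.update S .opd
        ((∑ j ∈ Finset.range i, e.eval L r (Function.update (vals S) x j)) :: S .opd))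
      L (e.cost.eval z + 1) (l := []) (lc := S .ctr) (lx := S (.var x)) (by simp [h.len])
      (by simp) (by simp) (fun i hi m => ?_)
    · refine (((push_runs _ _ _).congr ?_).seq (h1.congr ?_)).mono ?_
      · simp
      · simp [eval]
      · simp [cost]
        have := Nat.mul_le_mul_right (e.cost.eval z + 10) hL
        have : L * (e.cost.eval z + 1 + 5) ≤ L * (e.cost.eval z + 10) :=
          Nat.mul_le_mul_left _ (by omega)
        omega
    · have hv : vals (Function.update (Function.update (Function.update S .opd
          ((∑ j ∈ Finset.range i, e.eval L r (Function.update (vals S) x j)) :: S .opd))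
          .ctr (m :: S .ctr)) (.var x) (i :: S (.var x))) = Function.update (vals S) x i := by
        funext y
        by_cases hy : y = x
        · subst hy; simp [vals]
        · simp [vals, hy]
      have h2 := ih (S := Function.update (Function.update (Function.update S .opd
          ((∑ j ∈ Finset.range i, e.eval L r (Function.update (vals S) x j)) :: S .opd))
          .ctr (m :: S .ctr)) (.var x) (i :: S (.var x)))
        ⟨by simp [h.mem], by simp [h.aux], by simp [h.len]⟩
      rw [hv] at h2
      refine h2.seq ((add_runs
        (x := ∑ j ∈ Finset.range i, e.eval L r (Function.update (vals S) x j))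
        (y := e.eval L r (Function.update (vals S) x i)) (l := S .opd) (by simp)).congr ?_)
      rw [Finset.sum_range_succ]
      funext k
      cases k <;> simp [Function.update_apply]
  | sup x e ih =>
    have h1 := forCmd_runs x (.seq e.cmd maxCmd)
      (fun i => Function.update S .opd
        (((Finset.range i).sup fun j => e.eval L r (Function.update (vals S) x j)) :: S .opd))
      L (e.cost.eval z + 5) (l := []) (lc := S .ctr) (lx := S (.var x)) (by simp [h.len])
      (by simp) (by simp) (fun i hi m => ?_)
    · refine (((push_runs _ _ _).congr ?_).seq (h1.congr ?_)).mono ?_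
      · simp
      · simp [eval]
      · simp [cost]
        have := Nat.mul_le_mul_right (e.cost.eval z + 10) hL
        have : L * (e.cost.eval z + 5 + 5) ≤ L * (e.cost.eval z + 10) :=
          Nat.mul_le_mul_left _ (by omega)
        omega
    · have hv : vals (Function.update (Function.update (Function.update S .opd
          (((Finset.range i).sup fun j => e.eval L r (Function.update (vals S) x j)) :: S .opd))
          .ctr (m :: S .ctr)) (.var x) (i :: S (.var x))) = Function.update (vals S) x i := by
        funext y
        by_cases hy : y = x
        · subst hy; simp [vals]
        · simp [vals, hy]
      have h2 := ih (S := Function.update (Function.update (Function.update S .opd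
          (((Finset.range i).sup fun j => e.eval L r (Function.update (vals S) x j)) :: S .opd))
          .ctr (m :: S .ctr)) (.var x) (i :: S (.var x)))
        ⟨by simp [h.mem], by simp [h.aux], by simp [h.len]⟩
      rw [hv] at h2
      refine h2.seq ((maxCmd_runs
        (a := (Finset.range i).sup fun j => e.eval L r (Function.update (vals S) x j))
        (v := e.eval L r (Function.update (vals S) x i)) (l := S .opd) (by simp)).congr ?_)
      rw [Finset.range_add_one, Finset.sup_insert, sup_comm]
      funext k
      cases k <;> simp [Function.update_apply]

/-- A bound on the number of writes of a program, in terms of a bound on the loop length. -/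
noncomputable def Stm.writes : Stm V → ℕ[X]
  | assign _ _ _ => 1
  | seq s t => s.writes + t.writes
  | .forAll _ s => X * s.writes

/-- A bound on the number of operations of a program, in terms of a bound on the loop length and
on the number of memory entries. -/
noncomputable def Stm.cost : Stm V → ℕ[X]
  | assign a b e => a.cost + b.cost + e.cost + 3
  | seq s t => s.cost + t.cost
  | .forAll _ s => X * (s.cost + 5) + 5

/-- The memory is a log in which nothing is overwritten, so its growth depends on the program and
`L` alone, not on the data. -/
theorem Stm.length_run (s : Stm V) (L : ℕ) (ρ : V → ℕ) (r : Mem) :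
    (s.run L ρ r).length = r.length + s.writes.eval L := by
  induction s generalizing ρ r with
  | assign a b e => simp [run, writes]
  | seq s t ihs iht => simp [run, writes, ihs, iht]; ring
  | forAll x s ih =>
    have : ∀ n, (Nat.rec r (fun i r => s.run L (Function.update ρ x i) r) n : Mem).length =
        r.length + n * s.writes.eval L := by
      intro n
      induction n with
      | zero => simp
      | succ n ihn => simp only [ih, ihn]; ring
    simp [run, writes, this]

/-- Here `z` bounds the memory after the run, because later lookups also scan the entries written
earlier in the same run. -/
theorem Stm.cmd_runs (s : Stm V) {S : Loc V → List ℕ} {r : Mem} {L z : ℕ}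
    (h : Represents S r L) (hL : L ≤ z) (hr : r.length + s.writes.eval L ≤ z) :
    s.cmd.Runs S (Function.update S .mem (s.run L (vals S) r).toStack) (s.cost.eval z) := by
  induction s generalizing S r with
  | assign a b e =>
    have hr' : r.length ≤ z := by omega
    have h1 := e.cmd_runs h hL hr'
    have h2 := a.cmd_runs (h.update_opd (e.eval L r (vals S) :: S .opd)) hL hr'
    rw [vals_update_opd] at h2
    have h3 := b.cmd_runs ((h.update_opd (e.eval L r (vals S) :: S .opd)).update_opd
      (a.eval L r (vals S) :: e.eval L r (vals S) :: S .opd)) hL hr'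
    rw [vals_update_opd, vals_update_opd] at h3
    have h4 : Runs (.seq (prim (.move .opd .mem)) <| .seq (prim (.move .opd .mem))
        (prim (.move .opd .mem))) (Function.update S .opd
        (b.eval L r (vals S) :: a.eval L r (vals S) :: e.eval L r (vals S) :: S .opd))
        (Function.update S .mem (run L (vals S) (assign a b e) r).toStack) 3 := by
      refine ((move_runs (by simp) (by simp)).seq ((move_runs (by simp) (by simp)).seq
        ((move_runs (by simp) (by simp)).congr ?_))).mono (by omega)
      funext k
      cases k <;> simp [run, Mem.toStack, h.mem]
    refine (h1.seq (h2.seq (Runs.seq (h3.congr (by simp)) h4))).mono ?_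
    simp [cost]
    omega
  | seq s t ihs iht =>
    have hs : (s.writes + t.writes).eval L = s.writes.eval L + t.writes.eval L := by simp
    simp only [writes, hs] at hr
    have h1 := ihs h (by omega)
    have h2 := iht (S := Function.update S .mem (s.run L (vals S) r).toStack)
      (r := s.run L (vals S) r) ⟨by simp, by simp [h.aux], by simp [h.len]⟩
      (by rw [length_run]; omega)
    have hv : vals (Function.update S .mem (s.run L (vals S) r).toStack) = vals S := by
      funext x; simp [vals]
    rw [hv] at h2
    refine ((h1.seq h2).congr ?_).mono ?_
    · simp [run]
    · simp [cost]
  | forAll x s ih =>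
    simp only [writes, eval_mul, eval_X] at hr
    set R : ℕ → Mem := fun n => Nat.rec r (fun i r => s.run L (Function.update (vals S) x i) r) n
      with hR
    have hRlen : ∀ n, (R n).length = r.length + n * s.writes.eval L := by
      intro n
      induction n with
      | zero => simp [hR]
      | succ n ihn =>
        have : R (n + 1) = s.run L (Function.update (vals S) x n) (R n) := rfl
        rw [this, length_run, ihn]; ring
    have h1 := forCmd_runs x s.cmd (fun i => Function.update S .mem (R i).toStack)
      L (s.cost.eval z) (l := []) (lc := S .ctr) (lx := S (.var x)) (by simp [h.len])
      (by simp) (by simp) (fun i hi m => ?_)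
    · have h0 : Function.update S .mem (R 0).toStack = S := by
        have : (R 0).toStack = S .mem := h.mem.symm
        rw [this, Function.update_eq_self]
      rw [h0] at h1
      refine h1.mono ?_
      simp [cost]
      exact hL
    · have hv : vals (Function.update (Function.update (Function.update S .mem (R i).toStack)
          .ctr (m :: S .ctr)) (.var x) (i :: S (.var x))) = Function.update (vals S) x i := by
        funext y
        by_cases hy : y = x
        · subst hy; simp [vals]
        · simp [vals, hy]
      have h2 := ih (S := Function.update (Function.update (Function.update S .mem (R i).toStack)
          .ctr (m :: S .ctr)) (.var x) (i :: S (.var x))) (r := R i)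
        ⟨by simp, by simp [h.aux], by simp [h.len]⟩ (by
          rw [hRlen]
          have : (i + 1) * s.writes.eval L ≤ L * s.writes.eval L := Nat.mul_le_mul_right _ hi
          rw [Nat.add_mul] at this
          omega)
      rw [hv] at h2
      refine h2.congr ?_
      have : R (i + 1) = s.run L (Function.update (vals S) x i) (R i) := rfl
      funext k
      cases k <;> simp [this, Function.update_apply]

end StackProgram

/-! ### Polynomial time for decision programs -/

namespace StackProgram
open Polynomial NCmd
variable {V : Type} [DecidableEq V]

theorem eval_mono (p : ℕ[X]) {a b : ℕ} (h : a ≤ b) : p.eval a ≤ p.eval b := by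
  rw [eval_eq_sum_range, eval_eq_sum_range]
  exact Finset.sum_le_sum fun i _ => Nat.mul_le_mul_left _ (Nat.pow_le_pow_left h i)

/-- The memory with the numbers of a list written under the name `0` from the index `i` on. -/
def Mem.load : ℕ → List ℕ → Mem → Mem
  | _, [], r => r
  | i, a :: l, r => Mem.load (i + 1) l ((0, i, a) :: r)

theorem Mem.length_load (i : ℕ) (l : List ℕ) (r : Mem) :
    (Mem.load i l r).length = r.length + l.length := by
  induction l generalizing i r with
  | nil => simp [load]
  | cons a l ih => simp [load, ih]; omega

theorem Mem.get_load (i : ℕ) (l : List ℕ) (r : Mem) (n j : ℕ) :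
    (Mem.load i l r).get n j =
      if n = 0 ∧ i ≤ j ∧ j < i + l.length then l.getD (j - i) 0 else r.get n j := by
  induction l generalizing i r with
  | nil =>
    simp [load]
  | cons a l ih =>
    rw [load, ih, get]
    by_cases h1 : n = 0 ∧ i + 1 ≤ j ∧ j < i + 1 + l.length
    · rw [if_pos h1, if_pos (by simp; omega)]
      have : j - i = (j - (i + 1)) + 1 := by omega
      rw [this, List.getD_cons_succ]
    · rw [if_neg h1]
      by_cases h2 : 0 = n ∧ i = j
      · obtain ⟨rfl, rfl⟩ := h2
        simp
      · rw [if_neg h2, if_neg (by simp; omega)]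

/-- Pushes `n` zeros. -/
def zeros (k : Loc V) : ℕ → NCmd (Loc V)
  -- `NCmd` has no empty program; a push and a drop take its place.
  | 0 => .seq (prim (.push false k)) (prim (.drop k))
  | n + 1 => .seq (zeros k n) (prim (.push false k))

theorem zeros_runs (k : Loc V) (n : ℕ) (S : Loc V → List ℕ) :
    (zeros k n).Runs S (Function.update S k (List.replicate n 0 ++ S k)) (n + 2) := by
  induction n with
  | zero =>
    refine ((push_runs _ _ _).seq ((drop_runs (by simp)).congr ?_)).mono (by omega)
    simp
  | succ n ih =>
    refine (ih.seq ((push_runs _ _ _).congr ?_)).mono (by omega)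
    simp [List.replicate_succ]

/-- Moves the input into the memory. -/
def loadCmd : NCmd (Loc V) :=
  .seq (prim (.push false .len)) <| .loop (.nonempty .inp) <|
    .seq (prim (.copy .len .mem)) <| .seq (prim (.push false .mem)) <|
    .seq (prim (.move .inp .mem)) <| .seq (prim (.push true .len)) (prim (.add .len))

theorem loadCmd_runs (S : Loc V → List ℕ) (hl : S .len = []) (hm : S .mem = []) :
    loadCmd.Runs S (Function.update (Function.update (Function.update S .inp [])
      .mem (Mem.load 0 (S .inp) []).toStack) .len [(S .inp).length])
      (6 * (S .inp).length + 2) := by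
  have key : ∀ (l : List ℕ) (i : ℕ) (r : Mem) (S : Loc V → List ℕ), S .inp = l →
      S .len = [i] → S .mem = r.toStack → (NCmd.loop (.nonempty .inp) <|
        .seq (prim (.copy .len .mem)) <| .seq (prim (.push false .mem)) <|
        .seq (prim (.move .inp .mem)) <| .seq (prim (.push true .len))
          (prim (.add .len)) : NCmd (Loc V)).Runs S
        (Function.update (Function.update (Function.update S .inp [])
          .mem (Mem.load i l r).toStack) .len [i + l.length]) (6 * l.length + 1) := by
    intro l
    induction l with
    | nil =>
      intro i r S hi hl hm
      refine (Runs.loop_false (by simp [Test.holds, hi])).congr ?_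
      funext k
      cases k <;> simp [hi, hl, hm, Mem.load]
    | cons a l ih =>
      intro i r S hi hl hm
      refine (Runs.loop_true (by simp [Test.holds, hi]) ((copy_runs (by simp [hl])
        (by simp)).seq ((push_runs _ _ _).seq ((move_runs (by simp [hi]) (by simp)).seq
        ((push_runs _ _ _).seq (add_runs (x := i) (y := 1) (l := []) (by simp [hl]))))))
        ((ih (i + 1) ((0, i, a) :: r) _ (by simp [hi]) (by simp)
        (by simp [Mem.toStack, hl, hm, hi])).congr ?_)).mono ?_
      · funext k
        cases k <;> simp [Mem.load]
        omega
      · simp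
        omega
  refine ((push_runs _ _ _).seq ((key (S .inp) 0 [] _ (by simp) (by simp [hl])
    (by simp [hm, Mem.toStack])).congr ?_)).mono (by omega)
  funext k
  cases k <;> simp

/-- Loads the input, preceded by some zeros, runs a program, evaluates an expression, and leaves
a single number on the operands if the value is not `0`, and nothing else. -/
def decideCmd (pre : ℕ) (s : Stm V) (e : Expr V) : NCmd (Loc V) :=
  .seq (zeros .inp pre) <| .seq loadCmd <| .seq s.cmd <| .seq e.cmd <| .seq (clear .mem) <|
  .seq (prim (.drop .len)) <| .ite (.nonzero .opd)
    (.seq (prim (.drop .opd)) (prim (.push false .opd))) (prim (.drop .opd))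

/-- The memory before the program runs. -/
def initMem (pre : ℕ) (A : List ℕ) : Mem := Mem.load 0 (List.replicate pre 0 ++ A) []

/-- The value of the expression after the program has run on the input `A`. -/
def result (pre : ℕ) (s : Stm V) (e : Expr V) (A : List ℕ) : ℕ :=
  e.eval (pre + A.length) (s.run (pre + A.length) (fun _ => 0) (initMem pre A)) fun _ => 0

/-- A bound on the number of memory entries. -/
noncomputable def memBound (pre : ℕ) (s : Stm V) : ℕ[X] := (X + C pre) + s.writes.comp (X + C pre)

/-- A bound on the number of operations. -/
noncomputable def decideCost (pre : ℕ) (s : Stm V) (e : Expr V) : ℕ[X] :=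
  C (pre + 2) + (6 * (X + C pre) + 2) + s.cost.comp (memBound pre s) +
    e.cost.comp (memBound pre s) + (6 * memBound pre s + 1) + 4

theorem decideCmd_runs (pre : ℕ) (s : Stm V) (e : Expr V) (A : List ℕ) :
    (decideCmd pre s e).Runs (Function.update (fun _ => []) .inp A)
      (Function.update (fun _ => []) .opd (if result pre s e A = 0 then [] else [0]))
      ((decideCost pre s e).eval A.length) := by
  set L := pre + A.length with hL
  have hlen : (List.replicate pre 0 ++ A).length = L := by simp [hL]
  have h1 := zeros_runs (V := V) .inp pre (Function.update (fun _ => []) .inp A)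
  have h2 := loadCmd_runs (V := V)
    (Function.update (fun _ => []) .inp (List.replicate pre 0 ++ A)) (by simp) (by simp)
  set S2 : Loc V → List ℕ := Function.update (Function.update (fun _ => [])
      .mem (initMem pre A).toStack) .len [L] with hS2
  have hrep : Represents S2 (initMem pre A) L := ⟨by simp [hS2], by simp [hS2], by simp [hS2]⟩
  have hv : vals S2 = fun _ => 0 := by
    funext x; simp [vals, hS2]
  have hml : (initMem pre A).length = L := by
    rw [initMem, Mem.length_load, hlen]; simp
  set z := (memBound pre s).eval A.length with hz
  have hz' : z = L + s.writes.eval L := by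
    rw [hz, memBound]
    simp only [eval_add, eval_X, eval_C, eval_comp]
    rw [hL, Nat.add_comm pre]
  have h3 := s.cmd_runs (z := z) hrep (by omega) (by omega)
  rw [hv] at h3
  set r := s.run L (fun _ => 0) (initMem pre A) with hr
  have hrl : r.length = z := by rw [hr, Stm.length_run, hml, hz']
  set S3 := Function.update S2 .mem r.toStack with hS3
  have hrep3 : Represents S3 r L := ⟨by simp [hS3], by simp [hS3, hS2], by simp [hS3, hS2]⟩
  have hv3 : vals S3 = fun _ => 0 := by
    funext x; simp [vals, hS3, hS2]
  have h4 := e.cmd_runs (z := z) hrep3 (by omega) (by omega)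
  have hres : result pre s e A = e.eval L r (vals S3) := by rw [hv3]; rfl
  rw [← hres] at h4
  set S4 := Function.update S3 .opd (result pre s e A :: S3 .opd) with hS4
  have h5 := clear_runs (.mem : Loc V) S4
  have h6 : (NCmd.ite (.nonzero .opd) (.seq (prim (.drop .opd)) (prim (.push false .opd)))
      (prim (.drop .opd)) : NCmd (Loc V)).Runs
      (Function.update (fun _ => []) .opd [result pre s e A])
      (Function.update (fun _ => []) .opd (if result pre s e A = 0 then [] else [0])) (1 + 2) := by
    refine Runs.ite ?_
    by_cases h0 : result pre s e A = 0
    · simp only [Test.holds, Function.update_self, List.headD_cons, h0, bne_self_eq_false,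
        Bool.false_eq_true, if_false, if_true]
      exact ((drop_runs (by simp)).congr (by simp)).mono (by omega)
    · simp only [Test.holds, Function.update_self, List.headD_cons, bne_iff_ne, ne_eq, h0,
        not_false_eq_true, if_true, if_false]
      exact ((drop_runs (by simp)).seq ((push_runs _ _ _).congr (by simp)))
  refine ((h1.congr ?_).seq ((h2.congr (S'' := S2) ?_).seq (h3.seq (h4.seq (h5.seq
    (((drop_runs (S := Function.update S4 .mem []) ?_).congr ?_).seq h6)))))).mono ?_
  · simp
  · funext k
    cases k <;> simp [hS2, initMem, hL]
  · simp [hS4, hS3, hS2]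
  · funext k
    cases k <;> simp [hS4, hS3, hS2]
  · have : (S4 .mem).length = 3 * z := by
      rw [← hrl, ← length_toStack]; simp [hS4, hS3]
    simp only [decideCost, eval_add, eval_mul, eval_comp, eval_C, eval_X, eval_ofNat, eval_one,
      ← hz, this, Function.update_self, hlen]
    omega

theorem size_le_length_encodeStack (A : List ℕ) : ∀ x ∈ A, x.size ≤ (encodeStack A).length := by
  induction A with
  | nil => simp
  | cons a A ih =>
    intro x hx
    rw [encodeStack_cons]
    simp only [List.length_append, List.length_map, List.length_cons, length_bits]
    rcases List.mem_cons.1 hx with rfl | hx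
    · omega
    · have := ih x hx
      omega

theorem length_le_length_encodeStack (A : List ℕ) : A.length ≤ (encodeStack A).length := by
  induction A with
  | nil => simp
  | cons a A ih =>
    rw [encodeStack_cons]
    simp only [List.length_append, List.length_map, List.length_cons]
    omega

/-- A decision problem that is decided by a program on the memory is decided in polynomial time by
a Turing machine. -/
theorem solvableInPolyTime [Fintype V] {α : Type} (A : α → List ℕ) (pre : ℕ) (s : Stm V)
    (e : Expr V) (enc : α → List (Option Bool)) (henc : ∀ x, enc x = encodeStack (A x))
    (P : α → Prop) (hP : ∀ x, result pre s e (A x) ≠ 0 ↔ P x) : SolvableInPolyTime enc P := by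
  refine ⟨fun x => result pre s e (A x) != 0, fun x => by simpa using hP x, ?_⟩
  -- A positive answer is left as the number `0`, whose string is a single separator. One further
  -- pop therefore empties the last stack and puts the answer into the register. The time bound
  -- comes from at most `decideCost` operations on numbers whose width is at most the input length
  -- plus the number of operations.
  refine Cmd.computable (.seq (decideCmd pre s e).cmd (Cmd.popX (.inl .opd))) (.inl .inp)
    ((none, none, false) : Reg) (fun v => v.1.isSome) enc _
    (23 * (decideCost pre s e * (X + decideCost pre s e + 1)) + 1) fun x => ?_
  obtain ⟨n, hn, h⟩ := decideCmd_runs pre s e (A x)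
  have hw : WidthLE (Function.update (fun _ => []) .inp (A x) : Loc V → List ℕ)
      (enc x).length := by
    rw [henc]
    intro k y hy
    by_cases hk : k = .inp
    · subst hk
      exact size_le_length_encodeStack _ _ (by simpa using hy)
    · simp [hk] at hy
  obtain ⟨v, n', hn', h'⟩ := h.runs hw le_rfl (none, none, false)
  have hpop := Cmd.Exec.pop (σ := Reg) (K := Loc V ⊕ Bool) (.inl .opd) (fun v s => (s, v.2)) v
    (encodeStacks (Function.update (fun _ => []) .opd
      (if result pre s e (A x) = 0 then [] else [0])))
  have e1 : encodeStacks (Function.update (fun _ => []) .inp (A x) : Loc V → List ℕ) =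
      Function.update (fun _ => []) (.inl .inp) (enc x) := by
    rw [encodeStacks_update, henc]
    congr 1
    funext k
    cases k <;> rfl
  have e2 : Function.update (encodeStacks (Function.update (fun _ => []) (.opd : Loc V)
      (if result pre s e (A x) = 0 then [] else [0]))) (.inl .opd)
      (encodeStacks (Function.update (fun _ => []) (.opd : Loc V)
      (if result pre s e (A x) = 0 then [] else [0])) (.inl .opd)).tail = fun _ => [] := by
    funext k
    rw [encodeStacks_update]
    by_cases hk : k = .inl .opd
    · subst hk
      simp only [Function.update_self]
      split_ifs <;> simp [encodeStack, IDM.encodeNumber]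
    · rw [Function.update_of_ne hk, Function.update_of_ne hk]
      cases k <;> rfl
  rw [e1] at h'
  rw [e2] at hpop
  refine ⟨_, _, .seq h' hpop, ?_, ?_⟩
  · simp only [encodeStacks_update, Function.update_self]
    split_ifs with h0 <;> simp [encodeStack, IDM.encodeNumber, h0]
  · have hN : n ≤ (decideCost pre s e).eval (enc x).length :=
      hn.trans (eval_mono _ (by rw [henc]; exact length_le_length_encodeStack _))
    simp only [eval_add, eval_mul, eval_X, eval_ofNat, eval_one]
    refine Nat.add_le_add_right (hn'.trans ?_) 1
    gcongr

end StackProgram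

/-! ### Well-founded recursion, and earliest-deadline-first scheduling -/

/-- A function that is determined by its values on smaller arguments can be defined recursively. -/
theorem WellFounded.exists_eq {ι α : Type*} [Nonempty α] {r : ι → ι → Prop} (hr : WellFounded r)
    (F : (ι → α) → ι → α) (hF : ∀ f g v, (∀ w, r w v → f w = g w) → F f v = F g v) :
    ∃ f : ι → α, ∀ v, f v = F f v := by
  classical
  let a : α := Classical.arbitrary α
  let f : ι → α := hr.fix fun v f => F (fun w => if h : r w v then f w h else a) v
  refine ⟨f, fun v => ?_⟩
  have : f v = F (fun w => if r w v then f w else a) v := by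
    show hr.fix _ v = _
    rw [WellFounded.fix_eq]
    rfl
  rw [this]
  exact hF _ _ _ fun w hw => by simp [hw]

/-- The jobs `e`, of size `a e`, can be processed in their intervals `[r e, d e]` such that the
total work done by time `t` is `l t`, provided that the total work is right and that `l` grows
fast enough for the jobs that have to be processed within any given time interval. -/
theorem exists_processing {ι : Type*} [Fintype ι] [DecidableEq ι] (r d : ι → ℕ) (T : ℕ)
    (hr : ∀ e, 0 < r e) (hd : ∀ e, d e ≤ T) (N : ℕ) (a : ι → ℕ) (hN : ∑ e, a e = N) (l : ℕ → ℕ)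
    (h0 : l 0 = 0) (hT : l T = N)
    (hl : ∀ s t, s ≤ t → t ≤ T → l s + (∑ e with s < r e ∧ d e ≤ t, a e) ≤ l t) :
    ∃ p : ι → ℕ → ℕ, (∀ e t, p e t ≠ 0 → r e ≤ t ∧ t ≤ d e) ∧
      (∀ e, ∑ s ∈ Finset.Icc 1 T, p e s = a e) ∧
      ∀ t ≤ T, ∑ e, ∑ s ∈ Finset.Icc 1 t, p e s = l t := by
  -- Work is assigned unit by unit. At the first time `q` with `l q ≥ 1`, one unit goes to an
  -- unfinished job `e₀` with the earliest deadline among those released by `q`; then `l` is lowered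
  -- by one from `q` on.
  induction N generalizing a l with
  | zero =>
    have ha : ∀ e, a e = 0 := by simpa using hN
    refine ⟨fun _ _ => 0, by simp, by simp [ha], fun t ht => ?_⟩
    have := hl t T ht le_rfl
    simp only [Finset.sum_const_zero]
    omega
  | succ N ih =>
    have hex : ∃ t, 1 ≤ l t := ⟨T, by omega⟩
    set q := Nat.find hex with hq
    have hq1 : 1 ≤ l q := Nat.find_spec hex
    have hqT : q ≤ T := Nat.find_min' hex (by omega)
    have hlt : ∀ t < q, l t = 0 := fun t ht => by
      have := Nat.find_min hex ht
      omega
    have hmono : ∀ s t, s ≤ t → t ≤ T → l s ≤ l t := fun s t hs ht => by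
      have := hl s t hs ht
      omega
    have hge : ∀ t, q ≤ t → t ≤ T → 1 ≤ l t := fun t h1 h2 => hq1.trans (hmono q t h1 h2)
    obtain ⟨e₀, he₀, hmin⟩ : ∃ e₀ ∈ Finset.univ.filter (fun e => r e ≤ q ∧ 0 < a e),
        ∀ e ∈ Finset.univ.filter (fun e => r e ≤ q ∧ 0 < a e), d e₀ ≤ d e := by
      -- If no unfinished job were released by `q`, all `N + 1` units would have to be done after
      -- `q`, but `l T = N + 1` and `l q ≥ 1`.
      refine Finset.exists_min_image _ _ ?_
      by_contra hne
      rw [Finset.not_nonempty_iff_eq_empty, Finset.filter_eq_empty_iff] at hne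
      have h1 := hl q T hqT le_rfl
      have h2 : ∑ e with q < r e ∧ d e ≤ T, a e = ∑ e, a e := by
        rw [Finset.sum_filter]
        refine Finset.sum_congr rfl fun e _ => ?_
        have := hne (Finset.mem_univ e)
        by_cases hqr : q < r e
        · simp [hqr, hd e]
        · rw [if_neg (by tauto)]
          have : ¬ 0 < a e := fun h => this ⟨by omega, h⟩
          omega
      omega
    simp only [Finset.mem_filter, Finset.mem_univ, true_and] at he₀ hmin
    set a' : ι → ℕ := fun e => a e - if e = e₀ then 1 else 0 with ha'
    have haa' : ∀ e, a e = a' e + if e = e₀ then 1 else 0 := by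
      intro e
      by_cases h : e = e₀
      · subst h; simp [ha']; omega
      · simp [ha', h]
    have hsum : ∀ s t, ∑ e with s < r e ∧ d e ≤ t, a e =
        (∑ e with s < r e ∧ d e ≤ t, a' e) + if s < r e₀ ∧ d e₀ ≤ t then 1 else 0 := by
      intro s t
      simp_rw [haa', Finset.sum_add_distrib]
      congr 1
      rw [Finset.sum_ite_eq']
      simp
    have hdq : q ≤ d e₀ := by
      -- A deadline before `q` would force `l` to be positive before `q`.
      by_contra hlt'
      have h1 := hl 0 (d e₀) (by omega) (hd _)
      have h2 := hlt (d e₀) (by omega)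
      rw [hsum, if_pos ⟨hr _, le_rfl⟩] at h1
      omega
    have hN' : ∑ e, a' e = N := by
      have : ∑ e, a e = ∑ e, a' e + 1 := by
        simp_rw [haa', Finset.sum_add_distrib]
        simp
      omega
    obtain ⟨p, hp1, hp2, hp3⟩ := ih a' hN' (fun t => l t - 1) (by simp [h0])
      (by simp [hT]) (by
        intro s t hst ht
        have h1 := hl s t hst ht
        have hs1 := hsum s t
        by_cases hsq : q ≤ s
        · have := hge s hsq (hst.trans ht)
          omega
        · have hs0 := hlt s (by omega)
          by_cases htq : q ≤ t
          · have ht1 := hge t htq ht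
            by_cases hin : s < r e₀ ∧ d e₀ ≤ t
            · rw [if_pos hin] at hs1
              omega
            · rw [if_neg hin] at hs1
              -- Here `s < q ≤ t`, and the sum does not lose the unit of `e₀`. If `e₀` is due by
              -- `t`, the sum from `0` contains that unit and gives the slack. Otherwise, as `e₀`
              -- has the earliest deadline, every unfinished job due by `t` is released after `q`;
              -- the bound from `q` to `t` then has the slack `l q ≥ 1`.
              by_cases hdt : d e₀ ≤ t
              · have h2 := hl 0 t (by omega) ht
                rw [hsum, if_pos ⟨hr _, hdt⟩] at h2
                have h3 : ∑ e with s < r e ∧ d e ≤ t, a' e ≤ ∑ e with 0 < r e ∧ d e ≤ t, a' e := by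
                  refine Finset.sum_le_sum_of_subset ?_
                  intro e
                  simp only [Finset.mem_filter, Finset.mem_univ, true_and]
                  exact fun h => ⟨hr _, h.2⟩
                omega
              · have h2 := hl q t htq ht
                have h3 : ∑ e with s < r e ∧ d e ≤ t, a e = ∑ e with q < r e ∧ d e ≤ t, a e := by
                  rw [Finset.sum_filter, Finset.sum_filter]
                  refine Finset.sum_congr rfl fun e _ => ?_
                  by_cases hqr : q < r e
                  · have : s < r e := by omega
                    simp [hqr, this]
                  · rw [if_neg (c := q < r e ∧ d e ≤ t) (by tauto)]
                    split_ifs with hc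
                    · have := hmin e
                      by_contra hne
                      have := this ⟨by omega, by omega⟩
                      omega
                    · rfl
                omega
          · have := hlt t (by omega)
            omega)
    refine ⟨fun e t => p e t + if e = e₀ ∧ t = q then 1 else 0, ?_, ?_, ?_⟩
    · intro e t h
      by_cases hc : e = e₀ ∧ t = q
      · obtain ⟨rfl, rfl⟩ := hc
        exact ⟨he₀.1, hdq⟩
      · beta_reduce at h
        rw [if_neg hc, add_zero] at h
        exact hp1 e t h
    · intro e
      have hq0 : 1 ≤ q := by
        have := hr e₀
        omega
      rw [Finset.sum_add_distrib, hp2, haa' e]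
      by_cases h : e = e₀
      · subst h
        simp [hq0, hqT]
      · simp [h]
    · intro t ht
      have hq0 : 1 ≤ q := by
        have := hr e₀
        omega
      simp_rw [Finset.sum_add_distrib]
      rw [hp3 t ht]
      have : ∑ e, ∑ s ∈ Finset.Icc 1 t, (if e = e₀ ∧ s = q then 1 else 0) =
          if q ≤ t then 1 else 0 := by
        rw [Finset.sum_eq_single e₀ (by intro e _ he; simp [he]) (by simp)]
        simp [hq0]
      rw [this]
      split_ifs with h
      · have := hge t h ht
        omega
      · have := hlt t (by omega)
        omega

/-! ### Required payments and grants in a forest -/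

namespace IDM

variable (I : IDM)

theorem due_le_lifetime (e : Fin I.m) : (I.debt e).due ≤ I.lifetime :=
  Finset.le_sup (f := fun e => (I.debt e).due) (Finset.mem_univ e)

/-- `w` is the creditor of a debt of `v`. -/
def IsChild (w v : Fin I.n) : Prop := ∃ e, (I.debt e).debtor = v ∧ (I.debt e).creditor = w

instance (w v : Fin I.n) : Decidable (I.IsChild w v) := by
  unfold IsChild; infer_instance

/-- The total amount of the debts to `v` that are payable after `s` and due by `t`. -/
def between (v : Fin I.n) (s t : ℕ) : ℕ :=
  ∑ e with (I.debt e).creditor = v ∧ s < (I.debt e).start ∧ (I.debt e).due ≤ t, (I.debt e).amount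

/-- The total amount of the debts to `v` that are payable from a time `≤ t`. -/
def payableBy (v : Fin I.n) (t : ℕ) : ℕ :=
  ∑ e with (I.debt e).creditor = v ∧ (I.debt e).start ≤ t, (I.debt e).amount

/-- The total of `l w t` over the creditors `w` of `v`. -/
def demand (l : Fin I.n → ℕ → ℕ) (v : Fin I.n) (t : ℕ) : ℕ :=
  ∑ w with I.IsChild w v, l w t

/-- The bailout that `v` needs in order to pay out `I.demand l v t` by each time `t`, even if it is
paid as early as possible. -/
def grant (l : Fin I.n → ℕ → ℕ) (v : Fin I.n) : ℕ :=
  Finset.univ.sup fun j => I.demand l v (I.debt j).due - (I.assets v + I.payableBy v (I.debt j).due)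

/-- What `v` has to be paid by time `t` in addition to its assets and its bailout. -/
def need (l : Fin I.n → ℕ → ℕ) (v : Fin I.n) (t : ℕ) : ℕ :=
  I.demand l v t - (I.assets v + I.grant l v)

/-- What `v` has to be paid by time `t` in total, if `l` is such a function for its creditors. -/
def nextRequired (l : Fin I.n → ℕ → ℕ) (v : Fin I.n) (t : ℕ) : ℕ :=
  max (I.between v 0 t) (Finset.univ.sup fun j =>
    if (I.debt j).due ≤ t then I.need l v (I.debt j).due + I.between v (I.debt j).due t else 0)

/-- Every bank has at most one debtor, and there are no cycles. -/
structure IsForest : Prop where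
  debtor_eq : ∀ e e', (I.debt e).creditor = (I.debt e').creditor →
    (I.debt e).debtor = (I.debt e').debtor
  wf : WellFounded I.IsChild

variable {I}

theorem demand_congr {l l' : Fin I.n → ℕ → ℕ} {v : Fin I.n} (h : ∀ w, I.IsChild w v → l w = l' w) :
    I.demand l v = I.demand l' v := by
  funext t
  refine Finset.sum_congr rfl fun w hw => ?_
  rw [h w (by simpa using hw)]

theorem nextRequired_congr {l l' : Fin I.n → ℕ → ℕ} {v : Fin I.n}
    (h : ∀ w, I.IsChild w v → l w = l' w) : I.nextRequired l v = I.nextRequired l' v := by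
  unfold nextRequired need grant
  rw [demand_congr h]

theorem IsForest.exists_required (hI : I.IsForest) :
    ∃ l : Fin I.n → ℕ → ℕ, ∀ v, l v = I.nextRequired l v :=
  hI.wf.exists_eq _ fun _ _ _ h => nextRequired_congr h

/-- A debt payable after `s` cannot be due by `s`, so the two sums have no debt in common. -/
theorem between_add_le {v : Fin I.n} {q s t : ℕ} (hqs : q ≤ s) (hst : s ≤ t) :
    I.between v q s + I.between v s t ≤ I.between v q t := by
  unfold between
  rw [← Finset.sum_union]
  · refine Finset.sum_le_sum_of_subset fun e => ?_
    simp only [Finset.mem_union, Finset.mem_filter, Finset.mem_univ, true_and]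
    rintro (⟨h1, h2, h3⟩ | ⟨h1, h2, h3⟩)
    · exact ⟨h1, h2, h3.trans hst⟩
    · exact ⟨h1, by omega, h3⟩
  · rw [Finset.disjoint_left]
    intro e
    simp only [Finset.mem_filter, Finset.mem_univ, true_and]
    rintro ⟨_, _, h1⟩ ⟨_, h2, _⟩
    have := (I.debt e).start_le_due
    omega

theorem payableBy_add_between (v : Fin I.n) (t : ℕ) :
    I.payableBy v t + I.between v t I.lifetime = ∑ e with (I.debt e).creditor = v,
      (I.debt e).amount := by
  unfold payableBy between
  rw [← Finset.sum_union]
  · refine Finset.sum_congr ?_ fun _ _ => rfl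
    ext e
    simp only [Finset.mem_union, Finset.mem_filter, Finset.mem_univ, true_and]
    have := I.due_le_lifetime e
    constructor
    · rintro (h | h) <;> exact h.1
    · intro h
      rcases le_or_gt (I.debt e).start t with h' | h'
      · exact Or.inl ⟨h, h'⟩
      · exact Or.inr ⟨h, h', this⟩
  · rw [Finset.disjoint_left]
    intro e
    simp only [Finset.mem_filter, Finset.mem_univ, true_and]
    omega

/-- This is the purpose of `grant`: what is still required from the debtor can be paid without
violating any start time. -/
theorem need_le_payableBy (l : Fin I.n → ℕ → ℕ) (v : Fin I.n) (j : Fin I.m) :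
    I.need l v (I.debt j).due ≤ I.payableBy v (I.debt j).due := by
  have : I.demand l v (I.debt j).due - (I.assets v + I.payableBy v (I.debt j).due) ≤
      I.grant l v :=
    Finset.le_sup (f := fun j => I.demand l v (I.debt j).due -
      (I.assets v + I.payableBy v (I.debt j).due)) (Finset.mem_univ j)
  unfold need
  omega

theorem between_le_required {l : Fin I.n → ℕ → ℕ} (hl : ∀ v, l v = I.nextRequired l v)
    (v : Fin I.n) (t : ℕ) : I.between v 0 t ≤ l v t := by
  rw [hl v]
  exact le_max_left _ _

theorem need_add_between_le_required {l : Fin I.n → ℕ → ℕ} (hl : ∀ v, l v = I.nextRequired l v)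
    (v : Fin I.n) {t : ℕ} (j : Fin I.m) (hj : (I.debt j).due ≤ t) :
    I.need l v (I.debt j).due + I.between v (I.debt j).due t ≤ l v t := by
  rw [hl v]
  unfold nextRequired
  refine le_max_of_le_right ?_
  have := Finset.le_sup (f := fun j => if (I.debt j).due ≤ t then
    I.need l v (I.debt j).due + I.between v (I.debt j).due t else 0) (Finset.mem_univ j)
  simp only [if_pos hj] at this
  exact this

/-- Minimality of `l v`: the two lower bounds above are the only constraints. -/
theorem required_le_of {l : Fin I.n → ℕ → ℕ} (hl : ∀ v, l v = I.nextRequired l v)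
    {v : Fin I.n} {t b : ℕ} (h0 : I.between v 0 t ≤ b)
    (h : ∀ j, (I.debt j).due ≤ t →
      I.need l v (I.debt j).due + I.between v (I.debt j).due t ≤ b) : l v t ≤ b := by
  rw [hl v]
  refine max_le h0 (Finset.sup_le fun j _ => ?_)
  split_ifs with hj
  · exact h j hj
  · exact Nat.zero_le _

end IDM

/-! ### The grants suffice and are optimal -/

namespace IDM

variable {I : IDM}

/-- Every debt to a creditor of `v` is owed by `v` itself, so the debts of `v` can be grouped by
creditor. This makes `demand` the total outflow of `v`. -/
theorem IsForest.sum_debtor (hI : I.IsForest) (v : Fin I.n) (f : Fin I.m → ℕ) :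
    ∑ e with (I.debt e).debtor = v, f e =
      ∑ w with I.IsChild w v, ∑ e with (I.debt e).creditor = w, f e := by
  rw [← Finset.sum_fiberwise_of_maps_to (g := fun e => (I.debt e).creditor)
    (t := Finset.univ.filter fun w => I.IsChild w v)]
  · refine Finset.sum_congr rfl fun w hw => Finset.sum_congr ?_ fun _ _ => rfl
    obtain ⟨e', he', hw'⟩ : I.IsChild w v := by simpa using hw
    ext e
    simp only [Finset.mem_filter, Finset.mem_univ, true_and]
    exact ⟨fun h => h.2, fun h => ⟨(hI.debtor_eq e e' (h.trans hw'.symm)).trans he', h⟩⟩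
  · intro e he
    simp only [Finset.mem_filter, Finset.mem_univ, true_and] at he ⊢
    exact ⟨e, he, rfl⟩

theorem paidBy_succ (p : I.Schedule) (e : Fin I.m) (t : ℕ) :
    I.paidBy p e (t + 1) = I.paidBy p e t + p e (t + 1) :=
  Finset.sum_Icc_succ_top (by omega) _

theorem paidBy_mono (p : I.Schedule) (e : Fin I.m) : Monotone (I.paidBy p e) :=
  monotone_nat_of_le_succ fun t => by
    rw [paidBy_succ]
    exact Nat.le_add_right _ _

theorem cash_eq (p : I.Schedule) (v : Fin I.n) (t : ℕ) :
    I.cash p v t = I.assets v + (∑ e with (I.debt e).creditor = v, I.paidBy p e t : ℕ) -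
      (∑ e with (I.debt e).debtor = v, I.paidBy p e t : ℕ) := by
  induction t with
  | zero => simp [cash, paidBy]
  | succ t ih =>
    rw [cash, ih]
    simp only [income, outgoing, paidBy_succ, Finset.sum_add_distrib]
    push_cast
    ring

/-- Without overdue debts no bank can be withholding, so affordability, windows and full payment are
all that has to be checked. -/
theorem perfect_of {p : I.Schedule}
    (hcash : ∀ v t, t ≤ I.lifetime → ∑ e with (I.debt e).debtor = v, I.paidBy p e t ≤
      I.assets v + ∑ e with (I.debt e).creditor = v, I.paidBy p e t)
    (hp : ∀ e t, p e t ≠ 0 → (I.debt e).start ≤ t ∧ t ≤ (I.debt e).due)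
    (hpaid : ∀ e, I.paidBy p e I.lifetime = (I.debt e).amount) : I.Perfect p := by
  have hover : ∀ e t, ¬ I.Overdue p e t := by
    rintro e t ⟨h1, h2, h3⟩
    have : I.paidBy p e t = I.paidBy p e I.lifetime := by
      refine Finset.sum_subset (Finset.Icc_subset_Icc le_rfl h2) fun s _ hs => ?_
      by_contra h
      have := hp e s h
      have := (I.debt e).start_pos
      exact hs (Finset.mem_Icc.2 ⟨by omega, by omega⟩)
    rw [this, hpaid] at h3
    exact lt_irrefl _ h3
  refine ⟨⟨fun v t ht => ?_, fun e => (hpaid e).le, fun e => ?_, ?_⟩, hover⟩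
  · rw [cash_eq]
    have := hcash v t ht
    omega
  · refine Finset.sum_eq_zero fun s hs => ?_
    by_contra h
    have := hp e s h
    have := (I.debt e).start_pos
    have := Finset.mem_Icc.1 hs
    omega
  · rintro v ⟨t, _, _, ⟨e, _, he⟩, _⟩
    exact hover e t he

theorem Perfect.sum_debtor_le {p : I.Schedule} (hp : I.Perfect p) (v : Fin I.n) {t : ℕ}
    (ht : t ≤ I.lifetime) : ∑ e with (I.debt e).debtor = v, I.paidBy p e t ≤
      I.assets v + ∑ e with (I.debt e).creditor = v, I.paidBy p e t := by
  have := hp.1.cash_nonneg v t ht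
  rw [cash_eq] at this
  omega

theorem Perfect.paidBy_le {p : I.Schedule} (hp : I.Perfect p) (e : Fin I.m) {t : ℕ}
    (ht : t ≤ I.lifetime) : I.paidBy p e t ≤ (I.debt e).amount :=
  (paidBy_mono p e ht).trans (hp.1.not_overpaid e)

theorem Perfect.paidBy_eq_zero {p : I.Schedule} (hp : I.Perfect p) (e : Fin I.m) {t : ℕ}
    (ht : t < (I.debt e).start) : I.paidBy p e t = 0 := by
  have := hp.1.not_early e
  have := paidBy_mono p e (show t ≤ (I.debt e).start - 1 by omega)
  omega

theorem Perfect.le_paidBy {p : I.Schedule} (hp : I.Perfect p) (e : Fin I.m) {t : ℕ}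
    (ht : (I.debt e).due ≤ t) (ht' : t ≤ I.lifetime) : (I.debt e).amount ≤ I.paidBy p e t := by
  by_contra h
  exact hp.2 e t ⟨ht, ht', by omega⟩

theorem Perfect.sum_creditor_le {p : I.Schedule} (hp : I.Perfect p) (v : Fin I.n) {t : ℕ}
    (ht : t ≤ I.lifetime) :
    ∑ e with (I.debt e).creditor = v, I.paidBy p e t ≤ I.payableBy v t := by
  unfold payableBy
  rw [Finset.sum_filter, Finset.sum_filter]
  refine Finset.sum_le_sum fun e _ => ?_
  by_cases h : (I.debt e).start ≤ t
  · simp only [h, and_true]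
    split_ifs
    · exact hp.paidBy_le e ht
    · exact le_rfl
  · rw [hp.paidBy_eq_zero e (by omega)]
    simp

/-- The debts counted by `between` are untouched at `s` and fully paid at `t`; the others contribute
monotonically. -/
theorem Perfect.add_between_le {p : I.Schedule} (hp : I.Perfect p) (v : Fin I.n) {s t : ℕ}
    (hst : s ≤ t) (ht : t ≤ I.lifetime) :
    ∑ e with (I.debt e).creditor = v, I.paidBy p e s + I.between v s t ≤
      ∑ e with (I.debt e).creditor = v, I.paidBy p e t := by
  unfold between
  rw [Finset.sum_filter, Finset.sum_filter, Finset.sum_filter, ← Finset.sum_add_distrib]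
  refine Finset.sum_le_sum fun e _ => ?_
  have := paidBy_mono p e hst
  by_cases h : (I.debt e).creditor = v
  · simp only [h, true_and, if_true]
    split_ifs with h'
    · rw [hp.paidBy_eq_zero e h'.1, zero_add]
      exact hp.le_paidBy e h'.2 ht
    · exact this
  · simp [h]

/-- The time enters only through comparisons with due times. Hence the values at due times determine
the function, which is what makes a polynomial table possible. -/
theorem nextRequired_eq_of (l : Fin I.n → ℕ → ℕ) (v : Fin I.n) {q t : ℕ} (hq : q ≤ t)
    (h : ∀ j, (I.debt j).due ≤ t → (I.debt j).due ≤ q) :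
    I.nextRequired l v t = I.nextRequired l v q := by
  have h' : ∀ j, (I.debt j).due ≤ t ↔ (I.debt j).due ≤ q := fun j => ⟨h j, fun h => h.trans hq⟩
  have hb : ∀ s, I.between v s t = I.between v s q := fun s => by
    unfold between
    simp only [h']
  unfold nextRequired
  simp only [h', hb]

theorem required_zero {l : Fin I.n → ℕ → ℕ} (hl : ∀ v, l v = I.nextRequired l v) (v : Fin I.n) :
    l v 0 = 0 := by
  have h : ∀ j, 0 < (I.debt j).due := fun j => (I.debt j).start_pos.trans_le (I.debt j).start_le_due
  refine Nat.le_zero.1 (required_le_of hl ?_ fun j hj => absurd (h j) (by omega))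
  refine (Finset.sum_eq_zero fun e he => ?_).le
  have h1 := h e
  have h2 := (Finset.mem_filter.1 he).2.2.2
  omega

/-- Appending the window from `s` to `t` to any constraint that defines `l v s` gives a constraint
on `l v t`. This is the growth condition of `exists_processing`. -/
theorem required_add_between_le {l : Fin I.n → ℕ → ℕ} (hl : ∀ v, l v = I.nextRequired l v)
    (v : Fin I.n) {s t : ℕ} (hst : s ≤ t) : l v s + I.between v s t ≤ l v t := by
  have h0 := between_le_required hl v t
  have h1 := between_add_le (v := v) (Nat.zero_le s) hst
  have : l v s ≤ l v t - I.between v s t := by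
    refine required_le_of hl (by omega) fun j hj => ?_
    have h2 := need_add_between_le_required hl v j (hj.trans hst)
    have h3 := between_add_le (v := v) hj hst
    omega
  omega

/-- No more than the total debt is ever required: by `need_le_payableBy` each need is covered by
debts already payable, and `between` counts only debts payable later. -/
theorem required_lifetime {l : Fin I.n → ℕ → ℕ} (hl : ∀ v, l v = I.nextRequired l v)
    (v : Fin I.n) : l v I.lifetime = ∑ e with (I.debt e).creditor = v, (I.debt e).amount := by
  have h0 := payableBy_add_between v 0
  refine le_antisymm (required_le_of hl (by omega) fun j _ => ?_) ?_
  · have h1 := payableBy_add_between v (I.debt j).due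
    have h2 := need_le_payableBy l v j
    omega
  · have h1 := between_le_required hl v I.lifetime
    have h2 : I.payableBy v 0 = 0 := by
      refine Finset.sum_eq_zero fun e he => ?_
      have h3 := (Finset.mem_filter.1 he).2.2
      have h4 := (I.debt e).start_pos
      omega
    omega

/-- At a due time this is the definition of `need`. At any other time the demand equals its value at
the last due time before, or at `0` if there is none. -/
theorem demand_le {l : Fin I.n → ℕ → ℕ} (hl : ∀ v, l v = I.nextRequired l v) (v : Fin I.n)
    (t : ℕ) : I.demand l v t ≤ I.assets v + I.grant l v + l v t := by
  have key : ∀ q ≤ t, (∀ j, (I.debt j).due ≤ t → (I.debt j).due ≤ q) →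
      I.demand l v t = I.demand l v q := by
    intro q hq h
    refine Finset.sum_congr rfl fun w _ => ?_
    rw [hl w]
    exact nextRequired_eq_of l w hq h
  by_cases hj : (Finset.univ.filter fun j => (I.debt j).due ≤ t).Nonempty
  · obtain ⟨j, hj, hmax⟩ := Finset.exists_max_image _ (fun j => (I.debt j).due) hj
    simp only [Finset.mem_filter, Finset.mem_univ, true_and] at hj hmax
    rw [key _ hj hmax]
    have := need_add_between_le_required hl v j hj
    unfold need at this
    omega
  · rw [Finset.not_nonempty_iff_eq_empty, Finset.filter_eq_empty_iff] at hj
    rw [key 0 (Nat.zero_le _) fun j h => absurd h (hj (Finset.mem_univ j))]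
    unfold demand
    simp [required_zero hl]

theorem IsForest.hasPerfectSchedule_bailout_grant (hI : I.IsForest) {l : Fin I.n → ℕ → ℕ}
    (hl : ∀ v, l v = I.nextRequired l v) : (I.bailout (I.grant l)).HasPerfectSchedule := by
  have key : ∀ v, ∃ p : Fin I.m → ℕ → ℕ,
      (∀ e t, p e t ≠ 0 → (I.debt e).start ≤ t ∧ t ≤ (I.debt e).due) ∧
      (∀ e, ∑ s ∈ Finset.Icc 1 I.lifetime, p e s =
        if (I.debt e).creditor = v then (I.debt e).amount else 0) ∧
      ∀ t ≤ I.lifetime, ∑ e, ∑ s ∈ Finset.Icc 1 t, p e s = l v t := by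
    intro v
    -- All debts serve as jobs; those not owed to `v` get size `0`.
    refine exists_processing _ _ I.lifetime (fun e => (I.debt e).start_pos) I.due_le_lifetime
      (∑ e with (I.debt e).creditor = v, (I.debt e).amount) _ (Finset.sum_filter _ _).symm (l v)
      (required_zero hl v) (required_lifetime hl v) fun s t hst _ => ?_
    refine le_of_eq_of_le ?_ (required_add_between_le hl v hst)
    unfold between
    rw [Finset.sum_filter, Finset.sum_filter]
    congr 1
    refine Finset.sum_congr rfl fun e _ => ?_
    split_ifs <;> first | rfl | (exfalso; tauto)
  choose p hp1 hp2 hp3 using key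
  -- Each debt has one creditor, so the separate processings do not interfere.
  let q : I.Schedule := fun e => p (I.debt e).creditor e
  have hin : ∀ v t, t ≤ I.lifetime → ∑ e with (I.debt e).creditor = v, I.paidBy q e t = l v t := by
    intro v t ht
    rw [← hp3 v t ht, Finset.sum_filter]
    refine Finset.sum_congr rfl fun e _ => ?_
    split_ifs with h
    · subst h
      rfl
    · have h2 := hp2 v e
      rw [if_neg h, Finset.sum_eq_zero_iff] at h2
      refine (Finset.sum_eq_zero fun s hs => h2 s ?_).symm
      exact Finset.Icc_subset_Icc le_rfl ht hs
  have hcash : ∀ v t, t ≤ I.lifetime → ∑ e with (I.debt e).debtor = v, I.paidBy q e t ≤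
      I.assets v + I.grant l v + ∑ e with (I.debt e).creditor = v, I.paidBy q e t := by
    intro v t ht
    rw [hin v t ht, hI.sum_debtor]
    refine le_of_eq_of_le (Finset.sum_congr rfl fun w _ => ?_) (demand_le hl v t)
    exact hin w t ht
  exact ⟨q, perfect_of (I := I.bailout (I.grant l)) hcash (fun e t => hp1 _ e t)
    fun e => (hp2 _ e).trans (if_pos rfl)⟩

theorem IsForest.sum_grant_le (hI : I.IsForest) {l : Fin I.n → ℕ → ℕ}
    (hl : ∀ v, l v = I.nextRequired l v) {B : Fin I.n → ℕ}
    (hB : (I.bailout B).HasPerfectSchedule) : ∑ v, I.grant l v ≤ ∑ v, B v := by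
  obtain ⟨p, hp⟩ := hB
  -- `X v` is the surplus of `B` over the grants in the subtree of `v`. It is an integer, since its
  -- sign is part of the claim.
  obtain ⟨X, hX⟩ := hI.wf.exists_eq (fun (f : Fin I.n → ℤ) v =>
    (B v : ℤ) - I.grant l v + ∑ w with I.IsChild w v, f w) fun f g v h => by
      congr 1
      exact Finset.sum_congr rfl fun w hw => h w (by simpa using hw)
  have key : ∀ v, 0 ≤ X v ∧ ∀ t ≤ I.lifetime, (l v t : ℤ) ≤
      (∑ e with (I.debt e).creditor = v, I.paidBy p e t : ℕ) + X v := by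
    intro v
    induction v using hI.wf.induction with
    | _ v ih =>
      have hY : 0 ≤ ∑ w with I.IsChild w v, X w :=
        Finset.sum_nonneg fun w hw => (ih w (by simpa using hw)).1
      have hd : ∀ t ≤ I.lifetime, (I.demand l v t : ℤ) ≤ I.assets v + B v +
          (∑ e with (I.debt e).creditor = v, I.paidBy p e t : ℕ) +
          ∑ w with I.IsChild w v, X w := by
        intro t ht
        have h1 : ∑ e with (I.debt e).debtor = v, I.paidBy p e t ≤ I.assets v + B v +
          ∑ e with (I.debt e).creditor = v, I.paidBy p e t := hp.sum_debtor_le v ht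
        rw [hI.sum_debtor] at h1
        have h2 : (I.demand l v t : ℤ) ≤ ∑ w with I.IsChild w v,
            ((∑ e with (I.debt e).creditor = w, I.paidBy p e t : ℕ) + X w) := by
          unfold demand
          rw [Nat.cast_sum]
          exact Finset.sum_le_sum fun w hw => (ih w (by simpa using hw)).2 t ht
        rw [Finset.sum_add_distrib, ← Nat.cast_sum] at h2
        omega
      have hpay : ∀ t ≤ I.lifetime, ∑ e with (I.debt e).creditor = v, I.paidBy p e t ≤
          I.payableBy v t := fun t ht => hp.sum_creditor_le v ht
      have hbet : ∀ s t, s ≤ t → t ≤ I.lifetime →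
          ∑ e with (I.debt e).creditor = v, I.paidBy p e s + I.between v s t ≤
          ∑ e with (I.debt e).creditor = v, I.paidBy p e t :=
        fun s t hst ht => hp.add_between_le v hst ht
      -- At the due time where the grant is attained, `v` has been paid at most `payableBy`. So the
      -- demand, up to the surplus below `v`, must be met from assets and `B v`.
      have hgrant : (I.grant l v : ℤ) ≤ B v + ∑ w with I.IsChild w v, X w := by
        have : I.grant l v ≤ (B v + ∑ w with I.IsChild w v, X w).toNat := by
          refine Finset.sup_le fun j _ => ?_
          have h1 := hd _ (I.due_le_lifetime j)
          have h2 := hpay _ (I.due_le_lifetime j)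
          omega
        omega
      have hX0 : 0 ≤ X v := by
        rw [hX v]
        omega
      refine ⟨hX0, fun t ht => ?_⟩
      have hXv := hX v
      have : l v t ≤ ∑ e with (I.debt e).creditor = v, I.paidBy p e t + (X v).toNat := by
        refine required_le_of hl ?_ fun j hj => ?_
        · have := hbet 0 t (Nat.zero_le _) ht
          omega
        · have h1 := hd _ (I.due_le_lifetime j)
          have h2 := hbet _ t hj ht
          unfold need
          omega
      omega
  -- Each bank has at most one debtor and `X` is nonnegative, so no surplus is counted twice.
  have hsum : ∑ v, ∑ w with I.IsChild w v, X w ≤ ∑ w, X w := by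
    simp_rw [Finset.sum_filter]
    rw [Finset.sum_comm]
    refine Finset.sum_le_sum fun w _ => ?_
    rw [← Finset.sum_filter, Finset.sum_const]
    have : (Finset.univ.filter fun v => I.IsChild w v).card ≤ 1 := by
      refine Finset.card_le_one.2 fun u hu v hv => ?_
      obtain ⟨e, rfl, he⟩ : I.IsChild w u := by simpa using hu
      obtain ⟨e', rfl, he'⟩ : I.IsChild w v := by simpa using hv
      exact hI.debtor_eq e e' (he.trans he'.symm)
    have h0 := (key w).1
    rcases Nat.le_one_iff_eq_zero_or_eq_one.1 this with h | h <;> simp [h, h0]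
  have : ∑ v, X v = ∑ v, (B v : ℤ) - ∑ v, (I.grant l v : ℤ) + ∑ v, ∑ w with I.IsChild w v, X w := by
    rw [← Finset.sum_sub_distrib, ← Finset.sum_add_distrib]
    exact Finset.sum_congr rfl fun v _ => hX v
  zify
  omega

theorem IsForest.bailoutable_iff (hI : I.IsForest) {l : Fin I.n → ℕ → ℕ}
    (hl : ∀ v, l v = I.nextRequired l v) (b : ℤ) :
    I.Bailoutable b ↔ ((∑ v, I.grant l v : ℕ) : ℤ) ≤ b := by
  constructor
  · rintro ⟨B, hb, hB⟩
    have := hI.sum_grant_le hl hB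
    zify at this
    push_cast
    exact this.trans hb
  · intro h
    exact ⟨I.grant l, by exact_mod_cast h, hI.hasPerfectSchedule_bailout_grant hl⟩

theorem bailoutable_zero : I.Bailoutable 0 ↔ I.HasPerfectSchedule := by
  constructor
  · rintro ⟨B, hb, hB⟩
    have h : B = fun _ => 0 := by
      funext v
      have h1 : (∑ v, B v) ≤ 0 := by exact_mod_cast hb
      simpa using Finset.sum_eq_zero_iff.1 (Nat.le_zero.1 h1) v (Finset.mem_univ v)
    subst h
    exact hB
  · exact fun h => ⟨fun _ => 0, by simp, h⟩

theorem IsOutTree.exists_depth (hI : I.IsOutTree) :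
    ∃ d : Fin I.n → ℕ, (∀ v, d v < I.n) ∧
      ∀ e, d (I.debt e).creditor = d (I.debt e).debtor + 1 := by
  obtain ⟨hT, r, hr⟩ := hI
  refine ⟨I.footprint.dist r, fun v => ?_, hr⟩
  obtain ⟨p, hp, hlen⟩ := hT.connected.exists_path_of_dist r v
  have := hp.length_lt
  rw [Fintype.card_fin] at this
  omega

/-- A shortest walk from the root to a debtor, extended by the debt, is again shortest and hence a
path. Paths in a tree are unique, so the penultimate vertex of the path to the creditor determines
the debtor. Depths are below `n` and grow along debts, which excludes cycles. -/
theorem IsOutTree.isForest (hI : I.IsOutTree) : I.IsForest := by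
  refine ⟨fun e e' he => ?_, ?_⟩
  · obtain ⟨hT, r, hr⟩ := hI
    have key : ∀ e w, (I.debt e).creditor = w → ∃ p : I.footprint.Walk r w, p.IsPath ∧
        p.penultimate = (I.debt e).debtor := by
      rintro e w rfl
      obtain ⟨p, hp⟩ := hT.connected.exists_walk_length_eq_dist r (I.debt e).debtor
      have hadj : I.footprint.Adj (I.debt e).debtor (I.debt e).creditor := by
        rw [footprint, SimpleGraph.fromRel_adj]
        refine ⟨fun h => ?_, Or.inl ⟨e, rfl, rfl⟩⟩
        have := hr e
        rw [h] at this
        omega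
      refine ⟨p.concat hadj, ?_, by simp⟩
      apply SimpleGraph.Walk.isPath_of_length_eq_dist
      rw [SimpleGraph.Walk.length_concat, hp, hr]
    obtain ⟨p, hp, hpe⟩ := key e _ he
    obtain ⟨p', hp', hpe'⟩ := key e' _ rfl
    have : p = p' := congrArg Subtype.val
      ((hT.isAcyclic.subsingleton_path _ _).elim ⟨p, hp⟩ ⟨p', hp'⟩)
    rw [← hpe, ← hpe', this]
  · obtain ⟨d, hd, hde⟩ := hI.exists_depth
    refine Subrelation.wf (r := InvImage (· < ·) fun v => I.n - d v) ?_
      (InvImage.wf _ Nat.lt_wfRel.wf)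
    rintro w v ⟨e, rfl, rfl⟩
    have h1 := hd (I.debt e).creditor
    have h2 := hde e
    show I.n - _ < I.n - _
    omega

end IDM

/-! ### Derived expressions and induction over program loops -/

namespace StackProgram

namespace Expr
variable {V : Type} [DecidableEq V] (L : ℕ) (r : Mem) (ρ : V → ℕ)

/-- A numeral. -/
def num : ℕ → Expr V
  | 0 => zero
  | k + 1 => add (num k) one

/-- A number of the input. -/
def input (a : Expr V) : Expr V := mem zero a

/-- `if a ≤ b then c else d` -/
def ifLE (a b c d : Expr V) : Expr V := ifz (sub a b) c d

/-- `if a = b then c else d` -/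
def ifEq (a b c d : Expr V) : Expr V := ifz (add (sub a b) (sub b a)) c d

/-- The sum over the values below `b` of the variable `x`. -/
def sumBelow (b : Expr V) (x : V) (e : Expr V) : Expr V := sum x (ifLE (add (var x) one) b e zero)

/-- The supremum over the values below `b` of the variable `x`. -/
def supBelow (b : Expr V) (x : V) (e : Expr V) : Expr V := sup x (ifLE (add (var x) one) b e zero)

@[simp]
theorem eval_num (k : ℕ) : (num k : Expr V).eval L r ρ = k := by
  induction k with
  | zero => rfl
  | succ k ih => simp [num, eval, ih]

@[simp]
theorem eval_input (a : Expr V) : (input a).eval L r ρ = r.get 0 (a.eval L r ρ) := rfl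

@[simp]
theorem eval_ifLE (a b c d : Expr V) : (ifLE a b c d).eval L r ρ =
    if a.eval L r ρ ≤ b.eval L r ρ then c.eval L r ρ else d.eval L r ρ := by
  simp [ifLE, eval, Nat.sub_eq_zero_iff_le]

@[simp]
theorem eval_ifEq (a b c d : Expr V) : (ifEq a b c d).eval L r ρ =
    if a.eval L r ρ = b.eval L r ρ then c.eval L r ρ else d.eval L r ρ := by
  simp only [ifEq, eval]
  refine if_congr ?_ rfl rfl
  omega

variable {L r ρ}

theorem eval_sumBelow {b e : Expr V} {x : V} {N : ℕ} (hN : N ≤ L) (f : Fin N → ℕ)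
    (hb : ∀ i, b.eval L r (Function.update ρ x i) = N)
    (he : ∀ i : Fin N, e.eval L r (Function.update ρ x i) = f i) :
    (sumBelow b x e).eval L r ρ = ∑ i, f i := by
  have h1 : ∑ i, f i = ∑ i ∈ Finset.range N, e.eval L r (Function.update ρ x i) := by
    rw [Finset.sum_range]
    exact Finset.sum_congr rfl fun i _ => (he i).symm
  rw [h1]
  simp only [sumBelow, eval, eval_ifLE, hb, Function.update_self]
  rw [← Finset.sum_filter]
  refine Finset.sum_congr ?_ fun _ _ => rfl
  ext i
  simp only [Finset.mem_filter, Finset.mem_range]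
  omega

theorem eval_supBelow {b e : Expr V} {x : V} {N : ℕ} (hN : N ≤ L) (f : Fin N → ℕ)
    (hb : ∀ i, b.eval L r (Function.update ρ x i) = N)
    (he : ∀ i : Fin N, e.eval L r (Function.update ρ x i) = f i) :
    (supBelow b x e).eval L r ρ = Finset.univ.sup f := by
  simp only [supBelow, eval, eval_ifLE, hb, Function.update_self]
  refine le_antisymm (Finset.sup_le fun i _ => ?_) (Finset.sup_le fun i _ => ?_)
  · split_ifs with h
    · rw [he ⟨i, h⟩]
      exact Finset.le_sup (f := f) (Finset.mem_univ _)
    · exact Nat.zero_le _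
  · have hi : (i : ℕ) ∈ Finset.range L := Finset.mem_range.2 (i.2.trans_le hN)
    refine le_of_eq_of_le ?_ (Finset.le_sup (f := fun i => if i + 1 ≤ N then
      e.eval L r (Function.update ρ x i) else 0) hi)
    rw [if_pos (Nat.succ_le_of_lt i.2), he]

end Expr

theorem Stm.forAll_induction {V : Type} [DecidableEq V] {L : ℕ} {ρ : V → ℕ} {x : V} {s : Stm V}
    {r : Mem} (P : ℕ → Mem → Prop) (h0 : P 0 r)
    (hs : ∀ i < L, ∀ r, P i r → P (i + 1) (s.run L (Function.update ρ x i) r)) :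
    P L ((Stm.forAll x s).run L ρ r) := by
  have : ∀ i ≤ L, P i (Nat.rec r (fun i r => s.run L (Function.update ρ x i) r) i) := by
    intro i
    induction i with
    | zero => exact fun _ => h0
    | succ i ih => exact fun hi => hs i hi _ (ih (Nat.le_of_succ_le hi))
  exact this L le_rfl

end StackProgram

/-! ### The bailout program and its correctness -/

namespace IDM
open StackProgram StackProgram.Expr

/-- The variables of the program for the bailout problem: `round` counts the rounds, and the others
stand for banks and debts. -/
inductive Var : Type
  | round | bank | time | before | other | child | edge
  deriving DecidableEq

instance : Fintype Var where
  elems := {.round, .bank, .time, .before, .other, .child, .edge}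
  complete x := by cases x <;> simp

/-- The numbers in the input string of an instance. -/
def numbers (I : IDM) : List ℕ :=
  I.n :: (List.ofFn I.assets ++ I.m :: (List.ofFn fun e => [((I.debt e).debtor : ℕ),
    ((I.debt e).creditor : ℕ), (I.debt e).amount, (I.debt e).start, (I.debt e).due]).flatten)

theorem encodeStack_numbers (I : IDM) : encodeStack I.numbers = I.encode := by
  simp [numbers, encode, encodeStack, List.flatMap_def, Function.comp_def, List.flatten_flatten,
    List.map_ofFn]

theorem encodeStack_numbers_with_budget (I : IDM) (b : ℤ) :
    encodeStack ((if b < 0 then 1 else 0) :: b.natAbs :: I.numbers) = I.encodeWithBudget b := by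
  rw [encodeWithBudget, ← encodeStack_numbers]
  simp [encodeStack]

theorem getD_flatten_ofFn {k m : ℕ} (g : Fin m → List ℕ) (hg : ∀ e, (g e).length = k) (e : Fin m)
    {f : ℕ} (hf : f < k) : (List.ofFn g).flatten.getD (k * e + f) 0 = (g e).getD f 0 := by
  induction m with
  | zero => exact e.elim0
  | succ m ih =>
    rw [List.ofFn_succ, List.flatten_cons]
    refine Fin.cases ?_ (fun e => ?_) e
    · rw [List.getD_append _ _ _ _ (by rw [hg]; simpa using hf)]
      simp
    · rw [List.getD_append_right _ _ _ _ (by rw [hg, Fin.val_succ]; nlinarith)]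
      rw [hg, ← ih _ (fun e => hg e.succ) e]
      congr 1
      rw [Fin.val_succ, Nat.mul_succ]
      omega

/-- The memory holds an instance and the budget, and the loops are long enough. -/
structure Holds (I : IDM) (b : ℤ) (L : ℕ) (r : Mem) : Prop where
  sign : r.get 0 0 = if b < 0 then 1 else 0
  budget : r.get 0 1 = b.natAbs
  n : r.get 0 2 = I.n
  assets : ∀ v : Fin I.n, r.get 0 (3 + v) = I.assets v
  m : r.get 0 (3 + I.n) = I.m
  debtor : ∀ e : Fin I.m, r.get 0 (4 + I.n + 5 * e) = (I.debt e).debtor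
  creditor : ∀ e : Fin I.m, r.get 0 (5 + I.n + 5 * e) = (I.debt e).creditor
  amount : ∀ e : Fin I.m, r.get 0 (6 + I.n + 5 * e) = (I.debt e).amount
  start : ∀ e : Fin I.m, r.get 0 (7 + I.n + 5 * e) = (I.debt e).start
  due : ∀ e : Fin I.m, r.get 0 (8 + I.n + 5 * e) = (I.debt e).due
  n_le : I.n ≤ L
  m_le : I.m ≤ L

/-- The input is stored under the name `0`, so a write under a positive name leaves it intact. -/
theorem Holds.cons {I : IDM} {b : ℤ} {L : ℕ} {r : Mem} (h : I.Holds b L r) (k i x : ℕ) :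
    I.Holds b L ((k + 1, i, x) :: r) := by
  have : ∀ j, Mem.get ((k + 1, i, x) :: r) 0 j = r.get 0 j := fun j => by simp [Mem.get]
  exact ⟨(this _).trans h.sign, (this _).trans h.budget, (this _).trans h.n,
    fun _ => (this _).trans (h.assets _), (this _).trans h.m,
    fun _ => (this _).trans (h.debtor _), fun _ => (this _).trans (h.creditor _),
    fun _ => (this _).trans (h.amount _), fun _ => (this _).trans (h.start _),
    fun _ => (this _).trans (h.due _), h.n_le, h.m_le⟩

/-- The sign, the budget and `n` take indices `0` to `2`, the assets start at `3`, `m` is at `3 +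
n`, and each debt occupies five cells from `4 + n` on. -/
theorem holds_of_getD (I : IDM) (b : ℤ) {L : ℕ} {r : Mem} (hL : I.n + I.m ≤ L)
    (hr : ∀ j, r.get 0 j = ((if b < 0 then 1 else 0) :: b.natAbs :: I.numbers).getD j 0) :
    I.Holds b L r := by
  have hd : ∀ (e : Fin I.m) (f : ℕ), f < 5 → r.get 0 (4 + f + I.n + 5 * e) =
      [((I.debt e).debtor : ℕ), ((I.debt e).creditor : ℕ), (I.debt e).amount, (I.debt e).start,
        (I.debt e).due].getD f 0 := by
    intro e f hf
    rw [hr, numbers, show 4 + f + I.n + 5 * (e : ℕ) = I.n + (5 * e + f + 1) + 1 + 1 + 1 by ring,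
      List.getD_cons_succ, List.getD_cons_succ, List.getD_cons_succ,
      List.getD_append_right _ _ _ _ (by simp), List.length_ofFn, Nat.add_sub_cancel_left,
      List.getD_cons_succ]
    exact getD_flatten_ofFn (k := 5) (fun e => [((I.debt e).debtor : ℕ),
      ((I.debt e).creditor : ℕ), (I.debt e).amount, (I.debt e).start, (I.debt e).due])
      (fun _ => rfl) e hf
  refine ⟨by rw [hr]; rfl, by rw [hr]; rfl, by rw [hr]; rfl, fun v => ?_, ?_,
    fun e => hd e 0 (by omega), fun e => hd e 1 (by omega), fun e => hd e 2 (by omega),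
    fun e => hd e 3 (by omega), fun e => hd e 4 (by omega), by omega, by omega⟩
  · rw [hr, numbers, show 3 + (v : ℕ) = v + 1 + 1 + 1 by ring, List.getD_cons_succ,
      List.getD_cons_succ, List.getD_cons_succ, List.getD_append _ _ _ _ (by simp)]
    simp
  · rw [hr, numbers, show 3 + I.n = I.n + 1 + 1 + 1 by ring, List.getD_cons_succ,
      List.getD_cons_succ, List.getD_cons_succ, List.getD_append_right _ _ _ _ (by simp)]
    simp

namespace Program

/-- The number of banks. -/
def banks : Expr Var := input (num 2)

/-- The number of debts. -/
def debts : Expr Var := input (add (num 3) banks)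

/-- The assets of a bank. -/
def assets (x : Var) : Expr Var := input (add (num 3) (var x))

/-- An entry in the list of the debts. -/
def field (f : ℕ) (x : Var) : Expr Var :=
  input (add (add (num (4 + f)) banks)
    (add (var x) (add (var x) (add (var x) (add (var x) (var x))))))

/-- The total amount of the debts that are payable after `s` and due by `t`. -/
def between (s t : Expr Var) : Expr Var :=
  sumBelow debts .edge <| ifEq (field 1 .edge) (var .bank)
    (ifLE (add s one) (field 3 .edge) (ifLE (field 4 .edge) t (field 2 .edge) zero) zero) zero

/-- The total amount of the debts that are payable from a time `≤ t`. -/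
def payableBy (t : Expr Var) : Expr Var :=
  sumBelow debts .edge <| ifEq (field 1 .edge) (var .bank)
    (ifLE (field 3 .edge) t (field 2 .edge) zero) zero

/-- The number of debts to `child`. -/
def isChild : Expr Var :=
  sumBelow debts .edge <| ifEq (field 0 .edge) (var .bank)
    (ifEq (field 1 .edge) (var .child) one zero) zero

/-- The total of the table entries of the creditors at the due time of the debt `x`. -/
def demand (x : Var) : Expr Var :=
  sumBelow banks .child <| ifz isChild zero (mem (add (var .child) one) (var x))

/-- The bailout. -/
def grant : Expr Var :=
  supBelow debts .other <|
    sub (demand .other) (add (assets .bank) (payableBy (field 4 .other)))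

/-- The payments needed by the due time of the debt `before`. -/
def need : Expr Var := sub (demand .before) (add (assets .bank) grant)

/-- The table entry. -/
def nextRequired : Expr Var :=
  -- A maximum is written as `a + (s - a)`.
  add (between zero (field 4 .time)) <| sub (supBelow debts .before <|
    ifLE (field 4 .before) (field 4 .time)
      (add need (between (field 4 .before) (field 4 .time))) zero) (between zero (field 4 .time))

/-- Fills the table. -/
def fill : Stm Var :=
  .forAll .round <| .forAll .bank <| .forAll .time <|
    -- Names are shifted by one because `0` holds the input. All loops have the same length, so some
    -- writes belong to no bank or no debt; they do not affect the genuine entries.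
    .assign (add (var .bank) one) (var .time) nextRequired

/-- Compares the total bailout to the budget. -/
def answer : Expr Var :=
  ifz (input zero) (ifLE (sumBelow banks .bank grant) (input one) one zero) zero

end Program

section Eval

variable {I : IDM} {b : ℤ} {L : ℕ} {r : Mem} (h : I.Holds b L r) (ρ : Var → ℕ)

include h

theorem eval_banks : Program.banks.eval L r ρ = I.n := by
  simp [Program.banks, h.n]

theorem eval_debts : Program.debts.eval L r ρ = I.m := by
  simp [Program.debts, Expr.eval, eval_banks h, h.m]

theorem eval_field (f : ℕ) (x : Var) :
    (Program.field f x).eval L r ρ = r.get 0 (4 + f + I.n + 5 * ρ x) := by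
  simp only [Program.field, Expr.eval, eval_banks h, eval_input, eval_num]
  congr 1
  ring

variable {ρ} {v : Fin I.n} (hv : ρ .bank = v)
include hv

theorem eval_between {s t : Expr Var} {s' t' : ℕ}
    (hs : ∀ i, s.eval L r (Function.update ρ .edge i) = s')
    (ht : ∀ i, t.eval L r (Function.update ρ .edge i) = t') :
    (Program.between s t).eval L r ρ = I.between v s' t' := by
  rw [Program.between, eval_sumBelow h.m_le _ (fun _ => eval_debts h _) (fun _ => rfl),
    IDM.between, Finset.sum_filter]
  refine Finset.sum_congr rfl fun e _ => ?_
  simp only [eval_ifEq, eval_ifLE, eval_field h, Expr.eval, Function.update_self, hs, ht]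
  rw [Function.update_of_ne (by simp), hv, h.creditor, h.start, h.due, h.amount]
  simp only [Fin.val_inj]
  split_ifs <;> first | rfl | (exfalso; omega)

theorem eval_payableBy {t : Expr Var} {t' : ℕ}
    (ht : ∀ i, t.eval L r (Function.update ρ .edge i) = t') :
    (Program.payableBy t).eval L r ρ = I.payableBy v t' := by
  rw [Program.payableBy, eval_sumBelow h.m_le _ (fun _ => eval_debts h _) (fun _ => rfl),
    IDM.payableBy, Finset.sum_filter]
  refine Finset.sum_congr rfl fun e _ => ?_
  simp only [eval_ifEq, eval_ifLE, eval_field h, Expr.eval, Function.update_self, ht]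
  rw [Function.update_of_ne (by simp), hv, h.creditor, h.start, h.amount]
  simp only [Fin.val_inj]
  split_ifs <;> first | rfl | (exfalso; tauto)

theorem eval_isChild {w : Fin I.n} (hw : ρ .child = w) :
    Program.isChild.eval L r ρ = 0 ↔ ¬ I.IsChild w v := by
  rw [Program.isChild, eval_sumBelow h.m_le _ (fun _ => eval_debts h _) (fun _ => rfl),
    Finset.sum_eq_zero_iff]
  simp only [eval_ifEq, eval_field h, Expr.eval, Function.update_self, Finset.mem_univ,
    forall_const, IsChild, not_exists]
  refine forall_congr' fun e => ?_
  rw [Function.update_of_ne (by simp), Function.update_of_ne (by simp), hv, hw, h.debtor,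
    h.creditor]
  simp only [Fin.val_inj]
  split_ifs <;> simp_all

variable {l : Fin I.n → ℕ → ℕ}
  (hl : ∀ w, I.IsChild w v → ∀ j : Fin I.m, r.get (w + 1) j = l w (I.debt j).due)
include hl

theorem eval_demand {x : Var} (hx : x ≠ .child) {j : Fin I.m} (hj : ρ x = j) :
    (Program.demand x).eval L r ρ = I.demand l v (I.debt j).due := by
  rw [Program.demand, eval_sumBelow h.n_le _ (fun _ => eval_banks h _) (fun _ => rfl),
    IDM.demand, Finset.sum_filter]
  refine Finset.sum_congr rfl fun w _ => ?_
  have hc := eval_isChild h (ρ := Function.update ρ .child w) (v := v) (w := w) (by simpa using hv)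
    (by simp)
  rw [Expr.eval]
  by_cases hw : I.IsChild w v
  · rw [if_neg (by rw [hc]; simpa using hw), if_pos hw, ← hl w hw j]
    simp [Expr.eval, hx, hj]
  · rw [if_pos (hc.2 hw), if_neg hw]
    rfl

theorem eval_grant : Program.grant.eval L r ρ = I.grant l v := by
  rw [Program.grant, eval_supBelow h.m_le _ (fun _ => eval_debts h _) (fun _ => rfl), IDM.grant]
  congr 1
  funext j
  have hv' : Function.update ρ .other (j : ℕ) .bank = v := by simpa using hv
  rw [Expr.eval, Expr.eval, eval_demand h hv' hl (by simp) (j := j) (by simp),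
    eval_payableBy h hv' (t' := (I.debt j).due)]
  · simp [Program.assets, Expr.eval, hv, h.assets]
  · intro i
    rw [eval_field h, Function.update_of_ne (by simp), Function.update_self, h.due]

theorem eval_nextRequired {j : Fin I.m} (hj : ρ .time = j) :
    Program.nextRequired.eval L r ρ = I.nextRequired l v (I.debt j).due := by
  have ht : ∀ ρ' : Var → ℕ, ρ' .time = j →
      (Program.field 4 .time).eval L r ρ' = (I.debt j).due := fun ρ' h' => by
    rw [eval_field h, h', h.due]
  have h0 : (Program.between .zero (Program.field 4 .time)).eval L r ρ =
      I.between v 0 (I.debt j).due :=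
    eval_between h hv (fun _ => rfl) fun i => ht _ (by simpa using hj)
  have h1 : (supBelow Program.debts .before <| ifLE (Program.field 4 .before)
      (Program.field 4 .time) (.add Program.need
        (Program.between (Program.field 4 .before) (Program.field 4 .time))) .zero).eval L r ρ =
      Finset.univ.sup fun i : Fin I.m => if (I.debt i).due ≤ (I.debt j).due then
        I.need l v (I.debt i).due + I.between v (I.debt i).due (I.debt j).due else 0 := by
    refine eval_supBelow h.m_le _ (fun _ => eval_debts h _) fun i => ?_
    have hv' : Function.update ρ .before (i : ℕ) .bank = v := by simpa using hv
    have hb : ∀ ρ' : Var → ℕ, ρ' .before = i →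
        (Program.field 4 .before).eval L r ρ' = (I.debt i).due := fun ρ' h' => by
      rw [eval_field h, h', h.due]
    rw [eval_ifLE, hb _ (by simp), ht _ (by simpa using hj)]
    refine if_congr Iff.rfl ?_ rfl
    rw [Expr.eval, eval_between h hv' (fun _ => hb _ (by simp)) fun _ => ht _ (by simpa using hj),
      Program.need, Expr.eval, Expr.eval, eval_demand h hv' hl (by simp) (j := i) (by simp),
      eval_grant h hv' hl]
    simp [Program.assets, Expr.eval, hv, h.assets, IDM.need]
  rw [Program.nextRequired, Expr.eval, Expr.eval, h0, h1, IDM.nextRequired]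
  omega

end Eval

/-- After `k` rounds the entries of the banks of depth at least `n - k` are right: creditors lie one
level deeper, so theirs were right one round earlier. There are at least `n` rounds. The nested
inductions keep all entries of earlier rounds right while the current round proceeds through banks
and debts. -/
theorem run_fill {I : IDM} {b : ℤ} {L : ℕ} {r : Mem} (h : I.Holds b L r) (ρ : Var → ℕ)
    {l : Fin I.n → ℕ → ℕ} (hl : ∀ v, l v = I.nextRequired l v) {d : Fin I.n → ℕ}
    (hd : ∀ v, d v < I.n) (hde : ∀ e, d (I.debt e).creditor = d (I.debt e).debtor + 1) :
    I.Holds b L (Program.fill.run L ρ r) ∧ ∀ (v : Fin I.n) (j : Fin I.m),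
      (Program.fill.run L ρ r).get (v + 1) j = l v (I.debt j).due := by
  have key := Stm.forAll_induction (L := L) (ρ := ρ) (r := r) (x := Var.round)
    (s := .forAll .bank <| .forAll .time <|
      .assign (.add (.var .bank) .one) (.var .time) Program.nextRequired)
    (fun k r => I.Holds b L r ∧ ∀ (v : Fin I.n) (j : Fin I.m), I.n ≤ d v + k →
      r.get (v + 1) j = l v (I.debt j).due)
    ⟨h, fun v j hk => absurd (hd v) (by omega)⟩ ?_
  · exact ⟨key.1, fun v j => key.2 v j (h.n_le.trans (Nat.le_add_left _ _))⟩
  intro k _ r hr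
  have key := Stm.forAll_induction (L := L) (ρ := Function.update ρ .round k) (r := r) (x := Var.bank)
    (s := .forAll .time <| .assign (.add (.var .bank) .one) (.var .time) Program.nextRequired)
    (fun u r => (I.Holds b L r ∧ ∀ (v : Fin I.n) (j : Fin I.m), I.n ≤ d v + k →
      r.get (v + 1) j = l v (I.debt j).due) ∧ ∀ (v : Fin I.n) (j : Fin I.m), v < u → I.n ≤ d v + (k + 1) →
      r.get (v + 1) j = l v (I.debt j).due)
    ⟨hr, fun v j hv => absurd hv (by omega)⟩ ?_
  · exact ⟨key.1.1, fun v j => key.2 v j (v.2.trans_le h.n_le)⟩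
  intro u _ r hr
  have key := Stm.forAll_induction (L := L)
    (ρ := Function.update (Function.update ρ .round k) .bank u) (r := r) (x := Var.time)
    (s := .assign (.add (.var .bank) .one) (.var .time) Program.nextRequired)
    (fun i r => (I.Holds b L r ∧ ∀ (v : Fin I.n) (j : Fin I.m), I.n ≤ d v + k →
      r.get (v + 1) j = l v (I.debt j).due) ∧ ∀ (v : Fin I.n) (j : Fin I.m), v < u ∨ v = u ∧ j < i →
      I.n ≤ d v + (k + 1) → r.get (v + 1) j = l v (I.debt j).due)
    ⟨hr.1, fun v j hv => hr.2 v j (by omega)⟩ ?_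
  · exact ⟨key.1, fun v j hv => key.2 v j (by have := j.2.trans_le h.m_le; omega)⟩
  rintro i _ r ⟨⟨hr1, hr2⟩, hr3⟩
  set ρ' : Var → ℕ := Function.update (Function.update (Function.update ρ .round k) .bank u) .time i
    with hρ
  have hrun : Stm.run L ρ' (.assign (.add (.var .bank) .one) (.var .time) Program.nextRequired) r =
      (u + 1, i, Program.nextRequired.eval L r ρ') :: r := by
    simp [Stm.run, Expr.eval, hρ]
  have hnew : ∀ (v : Fin I.n) (j : Fin I.m), v = u → j = i → I.n ≤ d v + (k + 1) →
      Program.nextRequired.eval L r ρ' = l v (I.debt j).due := by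
    intro v j hv hj hk
    rw [hl v]
    refine eval_nextRequired hr1 (by simp [hρ, hv]) (fun w hw j => hr2 w j ?_) (by simp [hρ, hj])
    obtain ⟨e, rfl, rfl⟩ := hw
    rw [hde]
    omega
  rw [hrun]
  refine ⟨⟨hr1.cons _ _ _, fun v j hk => ?_⟩, fun v j hv hk => ?_⟩
  · rw [Mem.get]
    split_ifs with hc
    -- An entry that was right already is overwritten with the same value.
    · exact hnew v j (by omega) (by omega) (by omega)
    · exact hr2 v j hk
  · rw [Mem.get]
    split_ifs with hc
    · exact hnew v j (by omega) (by omega) hk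
    · exact hr3 v j (by omega) hk

theorem eval_answer {I : IDM} {b : ℤ} {L : ℕ} {r : Mem} (h : I.Holds b L r) (ρ : Var → ℕ)
    {l : Fin I.n → ℕ → ℕ} (hl : ∀ (v : Fin I.n) (j : Fin I.m), r.get (v + 1) j = l v (I.debt j).due) :
    Program.answer.eval L r ρ ≠ 0 ↔ ((∑ v, I.grant l v : ℕ) : ℤ) ≤ b := by
  have : (sumBelow Program.banks .bank Program.grant).eval L r ρ = ∑ v, I.grant l v :=
    eval_sumBelow h.n_le _ (fun _ => eval_banks h _) fun v =>
      eval_grant h (by simp) fun w _ => hl w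
  simp only [Program.answer, Expr.eval, eval_ifLE, eval_input, this, h.sign, h.budget]
  -- For a negative budget the answer is no, as the total of the grants is nonnegative.
  by_cases hb : b < 0
  · simp only [hb, if_true, one_ne_zero, if_false]
    omega
  · simp only [hb, if_false, if_true]
    split_ifs <;> omega

theorem IsOutTree.result_ne_zero_iff {I : IDM} (hI : I.IsOutTree) (b : ℤ) {pre : ℕ} {A : List ℕ}
    (hA : List.replicate pre 0 ++ A = (if b < 0 then 1 else 0) :: b.natAbs :: I.numbers) :
    result pre Program.fill Program.answer A ≠ 0 ↔ I.Bailoutable b := by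
  obtain ⟨l, hl⟩ := hI.isForest.exists_required
  obtain ⟨d, hd, hde⟩ := hI.exists_depth
  have hlen := congrArg List.length hA
  -- The loop length is the number of input numbers; it is at least `n + m`, since every bank
  -- contributes one number and every debt five.
  have hflat : I.m ≤ (List.ofFn fun e => [((I.debt e).debtor : ℕ), ((I.debt e).creditor : ℕ),
      (I.debt e).amount, (I.debt e).start, (I.debt e).due]).flatten.length := by
    rw [List.length_flatten, List.map_ofFn, List.sum_ofFn]
    simp
    omega
  have hinit : I.Holds b (pre + A.length) (initMem pre A) := by
    refine holds_of_getD I b ?_ fun j => ?_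
    · simp only [List.length_append, List.length_replicate, List.length_cons, numbers,
        List.length_ofFn] at hlen
      omega
    · rw [initMem, Mem.get_load, hA]
      by_cases hj : j < ((if b < 0 then 1 else 0) :: b.natAbs :: I.numbers).length
      · rw [if_pos ⟨rfl, Nat.zero_le _, by omega⟩, Nat.sub_zero]
      · rw [if_neg (by omega), List.getD_eq_default _ _ (by omega)]
        rfl
  have hrun := run_fill hinit (fun _ => 0) hl hd hde
  rw [hI.isForest.bailoutable_iff hl, result]
  exact eval_answer hrun.1 _ hrun.2

end IDM

theorem theorem11 :
    SolvableInPolyTime (fun x : OutTreeIDM × ℤ => x.1.val.encodeWithBudget x.2)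
      (fun x => x.1.val.Bailoutable x.2) ∧
    SolvableInPolyTime (fun I : OutTreeIDM => I.val.encode)
      (fun I => I.val.HasPerfectSchedule) :=
  ⟨StackProgram.solvableInPolyTime
    (fun x => (if x.2 < 0 then 1 else 0) :: x.2.natAbs :: x.1.val.numbers) 0 IDM.Program.fill
    IDM.Program.answer _ (fun x => (x.1.val.encodeStack_numbers_with_budget x.2).symm) _
    fun x => x.1.property.result_ne_zero_iff x.2 rfl,
  -- Perfect Scheduling is the case of budget `0`: the same program runs with two zeros, the sign
  -- and the budget, put before the input.
  StackProgram.solvableInPolyTime (fun I => I.val.numbers) 2 IDM.Program.fill IDM.Program.answer _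
    (fun I => I.val.encodeStack_numbers.symm) _
    fun I => (I.property.result_ne_zero_iff 0 rfl).trans IDM.bailoutable_zero⟩
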